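/- Let $G$ be a finite group, let $\omega\in Z^3(G,\mathbb C^*)$ be a normalized 3-cocycle, and let $\mathrm{Vect}(G,\omega)$ be the fusion category of finite-dimensional $G$-graded complex vector spaces with associativity constraint $\omega$. Let $A\subseteq G$ be a subgroup and let $\mu\in C^2(G,\mathrm{Map}(A\backslash G,\mathbb C^*))$ be a normalized cochain with $\delta_G\mu^{-1}=\pi^*\omega$, i.e. $\omega(g_1,g_2,g_3)\,\mu(k;g_1,g_2g_3)\,\mu(kg_1;g_2,g_3)=\mu(k;g_1g_2,g_3)\,\mu(k;g_1,g_2)$ for all $k\in A\backslash G$ and $g_i\in G$. Let $\mathcal M(A\backslash G,\mu)$ be the right module category over $\mathrm{Vect}(G,\omega)$ of finite-dimensional $A\backslash G$-graded vector spaces with module associativity constraint $M\otimes(X\otimes Y)\cong(M\otimes X)\otimes Y$ given by $\mu$. Let $\mathrm{Vect}(G,\omega)^*_{\mathcal M(A\backslash G,\mu)}$ be the tensor category of $\mathbb C$-linear module endofunctors of $\mathcal M(A\backslash G,\mu)$, with composition as tensor product. It is called pointed if all of its simple objects are invertible. For a normal subgroup $A$ of $G$ with quotient $K=G/A$, let $C^{p,q}=C^p(K,C^q(G,\mathrm{Map}(K,\mathbb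 C^*)))$ be the double complex of normalized cochains, where $g\in G$ acts on $\mathrm{Map}(K,\mathbb C^*)$ by $(g\triangleright f)(k)=f(k\cdot gA)$ and $k\in K$ acts on $C^q(G,\mathrm{Map}(K,\mathbb C^*))$ from the right by $(f\triangleleft k)(x;g_1,\dots,g_q)=f(kx;g_1,\dots,g_q)$, with total differential $\delta_{\mathrm{Tot}}=\delta_K\oplus(\delta_G)^{(-1)^p}$. Filtering $\mathrm{Tot}(C^{*,*})$ by the degree $p$ of the $K$-cochains gives the Lyndon–Hochschild–Serre spectral sequence of $1\to A\to G\to K\to 1$; let $E_\infty^{p,q}$ be its limit terms. A cocycle $\omega$ of $G$ is regarded as the element $\pi^*\omega\in C^{0,3}$, $(\pi^*\omega)(k;g_1,g_2,g_3)=\omega(g_1,g_2,g_3)$, and $\pi^*$ induces the map $H^3(G,\mathbb C^*)\to H^3(\mathrm{Tot})$. Put $$\Omega(G;A):=\ker\Big(\ker\big(H^3(G,\mathbb C^*)\to E_\infty^{0,3}\big)\to E_\infty^{1,2}\Big)\subseteq H^3(G,\mathbb C^*).$$ **Statement.** If $\mathrm{Vect}(G,\omega)^*_{\mathcal M(A\backslash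 G,\mu)}$ is pointed, then $A$ is normal in $G$, and $\omega$ is cohomologous in $\mathrm{Tot}(C^{*,*})$ to a 3-cocycle that lies in $C^{2,1}\oplus C^{3,0}$. Equivalently, $[\omega]\in\Omega(G;A)$; more precisely, a cocycle $\eta\in Z^3(G,\mathbb C^*)$ is cohomologous to a cocycle in $C^{2,1}\oplus C^{3,0}$ if and only if $[\eta]\in\Omega(G;A)$. -/

import Mathlib

set_option linter.unusedSectionVars false

universe u

noncomputable section

open CategoryTheory MonoidalCategory MonoidalRightAction TensorProduct

namespace PointedDual

/-! ## Graded vector spaces -/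

/-- A finite-dimensional complex vector space graded by the finite set `X`. The grading
`V = ⨁ x, V_x` is recorded by the projections `proj x` onto the homogeneous components
`V_x = range (proj x)`: orthogonal idempotents with sum the identity. -/
structure GrVect (X : Type u) [Fintype X] where
  carrier : Type
  [addCommGroup : AddCommGroup carrier]
  [module : Module ℂ carrier]
  [finiteDimensional : FiniteDimensional ℂ carrier]
  proj : X → carrier →ₗ[ℂ] carrier
  proj_self : ∀ x v, proj x (proj x v) = proj x v
  proj_ne : ∀ x y, x ≠ y → ∀ v, proj x (proj y v) = 0
  sum_proj : ∀ v, ∑ x, proj x v = v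

attribute [instance] GrVect.addCommGroup GrVect.module GrVect.finiteDimensional

namespace GrVect

section Basic

variable {X : Type u} [Fintype X]

/-- A morphism of graded vector spaces: a linear map of degree zero. -/
@[ext]
structure Hom (V W : GrVect X) where
  lin : V.carrier →ₗ[ℂ] W.carrier
  comm : ∀ x v, lin (V.proj x v) = W.proj x (lin v)

instance : Category (GrVect X) where
  Hom := Hom
  id V := ⟨LinearMap.id, fun _ _ => rfl⟩
  comp f g := ⟨g.lin ∘ₗ f.lin, fun x v => by simp [f.comm, g.comm]⟩

@[ext]
theorem hom_ext {V W : GrVect X} {f g : V ⟶ W} (h : ∀ v, f.lin v = g.lin v) : f = g :=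
  Hom.ext (LinearMap.ext h)

@[simp] theorem id_lin (V : GrVect X) (v : V.carrier) : Hom.lin (𝟙 V) v = v := rfl

@[simp] theorem comp_lin {V W U : GrVect X} (f : V ⟶ W) (g : W ⟶ U) (v : V.carrier) :
    Hom.lin (f ≫ g) v = g.lin (f.lin v) := rfl

instance (V W : GrVect X) : Zero (V ⟶ W) := ⟨⟨0, fun _ _ => by simp⟩⟩

instance (V W : GrVect X) : Add (V ⟶ W) :=
  ⟨fun f g => ⟨f.lin + g.lin, fun x v => by simp [f.comm, g.comm]⟩⟩

instance (V W : GrVect X) : Neg (V ⟶ W) := ⟨fun f => ⟨-f.lin, fun x v => by simp [f.comm]⟩⟩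

instance (V W : GrVect X) : AddCommGroup (V ⟶ W) where
  add_assoc f g h := Hom.ext (add_assoc f.lin g.lin h.lin)
  zero_add f := Hom.ext (zero_add f.lin)
  add_zero f := Hom.ext (add_zero f.lin)
  neg_add_cancel f := Hom.ext (neg_add_cancel f.lin)
  add_comm f g := Hom.ext (add_comm f.lin g.lin)
  nsmul := nsmulRec
  zsmul := zsmulRec

@[simp] theorem zero_lin (V W : GrVect X) : Hom.lin (0 : V ⟶ W) = 0 := rfl

@[simp] theorem add_lin {V W : GrVect X} (f g : V ⟶ W) : Hom.lin (f + g) = f.lin + g.lin := rfl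

instance : Preadditive (GrVect X) where
  add_comp _ _ _ f g h := by ext v; simp
  comp_add _ _ _ f g h := by ext v; simp

instance (V W : GrVect X) : Module ℂ (V ⟶ W) where
  smul r f := ⟨r • f.lin, fun x v => by simp [f.comm]⟩
  one_smul f := Hom.ext (one_smul ℂ f.lin)
  mul_smul r s f := Hom.ext (mul_smul r s f.lin)
  smul_zero r := Hom.ext (smul_zero r)
  smul_add r f g := Hom.ext (smul_add r f.lin g.lin)
  add_smul r s f := Hom.ext (add_smul r s f.lin)
  zero_smul f := Hom.ext (zero_smul ℂ f.lin)

@[simp] theorem smul_lin {V W : GrVect X} (r : ℂ) (f : V ⟶ W) : Hom.lin (r • f) = r • f.lin := rfl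

instance : Linear ℂ (GrVect X) where
  smul_comp _ _ _ r f g := by ext v; simp
  comp_smul _ _ _ f r g := by ext v; simp

/-- An isomorphism of graded vector spaces from mutually inverse linear maps, the first of which
has degree zero. -/
def mkIso {V W : GrVect X} (e : V.carrier ≃ₗ[ℂ] W.carrier)
    (h : ∀ x v, e (V.proj x v) = W.proj x (e v)) : V ≅ W where
  hom := ⟨e.toLinearMap, h⟩
  inv := ⟨e.symm.toLinearMap, fun x v => by
    apply e.injective; simp [h]⟩
  hom_inv_id := by ext v; simp
  inv_hom_id := by ext v; simp

/-- `v` is homogeneous of degree `x`. -/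
def IsHomog (V : GrVect X) (x : X) (v : V.carrier) : Prop := V.proj x v = v

theorem isHomog_proj (V : GrVect X) (x : X) (v : V.carrier) : V.IsHomog x (V.proj x v) :=
  V.proj_self x v

open Classical in
theorem IsHomog.proj_eq {V : GrVect X} {x : X} {v : V.carrier} (h : V.IsHomog x v) (y : X) :
    V.proj y v = if x = y then v else 0 := by
  split_ifs with hxy
  · subst hxy; exact h
  · rw [← show V.proj x v = v from h]; exact V.proj_ne y x (Ne.symm hxy) v

theorem IsHomog.map {V W : GrVect X} {x : X} {v : V.carrier} (h : V.IsHomog x v) (f : V ⟶ W) :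
    W.IsHomog x (f.lin v) := by
  unfold IsHomog; rw [← f.comm, h]

/-- Linear maps that agree on homogeneous elements are equal. -/
theorem lin_ext {V : GrVect X} {M : Type*} [AddCommGroup M] [Module ℂ M]
    {f g : V.carrier →ₗ[ℂ] M} (h : ∀ x v, V.IsHomog x v → f v = g v) : f = g := by
  ext v
  rw [← V.sum_proj v, map_sum, map_sum]
  exact Finset.sum_congr rfl fun x _ => h x _ (V.isHomog_proj x v)

end Basic

/-! ## Tensor products of graded vector spaces along a map of index sets -/

section Tensor

variable {X Y Z : Type u} [Fintype X] [Fintype Y]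

open Classical in
/-- The projections onto `⨁ V_x ⊗ W_y`, the sum over the pairs with `m x y = z`. -/
def tensorProj (m : X → Y → Z) (V : GrVect X) (W : GrVect Y) (z : Z) :
    V.carrier ⊗[ℂ] W.carrier →ₗ[ℂ] V.carrier ⊗[ℂ] W.carrier :=
  ∑ x, ∑ y, if m x y = z then TensorProduct.map (V.proj x) (W.proj y) else 0

open Classical in
theorem tensorProj_homog (m : X → Y → Z) {V : GrVect X} {W : GrVect Y} (z : Z) {x : X} {y : Y}
    {v : V.carrier} {w : W.carrier} (hv : V.IsHomog x v) (hw : W.IsHomog y w) :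
    tensorProj m V W z (v ⊗ₜ w) = if m x y = z then v ⊗ₜ w else 0 := by
  unfold tensorProj
  rw [LinearMap.sum_apply, Finset.sum_eq_single x, LinearMap.sum_apply, Finset.sum_eq_single y]
  · split_ifs with h
    · rw [TensorProduct.map_tmul, hv, hw]
    · rfl
  · intro y' _ hy'
    split_ifs
    · rw [TensorProduct.map_tmul, hw.proj_eq, if_neg hy'.symm, tmul_zero]
    · rfl
  · simp
  · intro x' _ hx'
    rw [LinearMap.sum_apply]
    refine Finset.sum_eq_zero fun y' _ => ?_
    split_ifs
    · rw [TensorProduct.map_tmul, hv.proj_eq, if_neg hx'.symm, zero_tmul]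
    · rfl
  · simp

/-- Linear maps on a tensor product that agree on tensors of homogeneous elements are equal. -/
theorem tensor_lin_ext {V : GrVect X} {W : GrVect Y} {M : Type*} [AddCommGroup M] [Module ℂ M]
    {f g : V.carrier ⊗[ℂ] W.carrier →ₗ[ℂ] M}
    (h : ∀ x v, V.IsHomog x v → ∀ y w, W.IsHomog y w → f (v ⊗ₜ w) = g (v ⊗ₜ w)) : f = g := by
  apply TensorProduct.ext
  refine lin_ext fun x v hv => ?_
  exact lin_ext fun y w hw => by simpa using h x v hv y w hw

variable [Fintype Z]

/-- The tensor product of an `X`-graded and a `Y`-graded vector space, graded by `Z` along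
`m : X → Y → Z`, that is `(V ⊗ W)_z = ⨁_{m x y = z} V_x ⊗ W_y`. -/
abbrev tensor (m : X → Y → Z) (V : GrVect X) (W : GrVect Y) : GrVect Z where
  carrier := V.carrier ⊗[ℂ] W.carrier
  proj := tensorProj m V W
  proj_self z t := by
    classical
    have : tensorProj m V W z ∘ₗ tensorProj m V W z = tensorProj m V W z :=
      tensor_lin_ext fun x v hv y w hw => by
        simp only [LinearMap.comp_apply, tensorProj_homog m z hv hw]
        split_ifs with h
        · rw [tensorProj_homog m z hv hw, if_pos h]
        · simp
    exact LinearMap.congr_fun this t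
  proj_ne z z' hz t := by
    classical
    have : tensorProj m V W z ∘ₗ tensorProj m V W z' = 0 :=
      tensor_lin_ext fun x v hv y w hw => by
        simp only [LinearMap.comp_apply, tensorProj_homog m z' hv hw]
        split_ifs with h
        · rw [tensorProj_homog m z hv hw, if_neg (by rw [h]; exact hz.symm)]; rfl
        · simp
    exact LinearMap.congr_fun this t
  sum_proj t := by
    classical
    have : ∑ z, tensorProj m V W z = LinearMap.id :=
      tensor_lin_ext fun x v hv y w hw => by
        simp only [LinearMap.sum_apply, tensorProj_homog m _ hv hw]
        simp
    simpa using LinearMap.congr_fun this t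

theorem IsHomog.tmul (m : X → Y → Z) {V : GrVect X} {W : GrVect Y} {x : X} {y : Y}
    {v : V.carrier} {w : W.carrier} (hv : V.IsHomog x v) (hw : W.IsHomog y w) :
    (tensor m V W).IsHomog (m x y) (v ⊗ₜ[ℂ] w) := by
  classical
  exact (tensorProj_homog m _ hv hw).trans (if_pos rfl)

/-- The tensor product of morphisms. -/
def tensorMap (m : X → Y → Z) {V V' : GrVect X} {W W' : GrVect Y} (f : V ⟶ V') (g : W ⟶ W') :
    tensor m V W ⟶ tensor m V' W' where
  lin := TensorProduct.map f.lin g.lin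
  comm z t := by
    classical
    have : TensorProduct.map f.lin g.lin ∘ₗ tensorProj m V W z =
        tensorProj m V' W' z ∘ₗ TensorProduct.map f.lin g.lin :=
      tensor_lin_ext fun x v hv y w hw => by
        simp only [LinearMap.comp_apply, tensorProj_homog m z hv hw, TensorProduct.map_tmul,
          tensorProj_homog m z (hv.map f) (hw.map g)]
        split_ifs <;> simp
    exact LinearMap.congr_fun this t

@[simp] theorem tensorMap_tmul (m : X → Y → Z) {V V' : GrVect X} {W W' : GrVect Y} (f : V ⟶ V')
    (g : W ⟶ W') (v : V.carrier) (w : W.carrier) :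
    (tensorMap m f g).lin (v ⊗ₜ[ℂ] w) = f.lin v ⊗ₜ[ℂ] g.lin w := rfl

theorem tensor_hom_ext (m : X → Y → Z) {V : GrVect X} {W : GrVect Y} {U : GrVect Z}
    {f g : tensor m V W ⟶ U}
    (h : ∀ x v, V.IsHomog x v → ∀ y w, W.IsHomog y w →
      f.lin (v ⊗ₜ[ℂ] w) = g.lin (v ⊗ₜ[ℂ] w)) : f = g :=
  Hom.ext (tensor_lin_ext h)

end Tensor

/-! ## The associativity constraint with scalars -/

section Assoc

variable {X Y Z P Q T : Type u} [Fintype X] [Fintype Y] [Fintype Z] [Fintype P] [Fintype Q]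
  [Fintype T]

/-- The linear map which multiplies `V_x ⊗ (W_y ⊗ U_z)` by the scalar `c x y z`. -/
def scale (c : X → Y → Z → ℂˣ) (V : GrVect X) (W : GrVect Y) (U : GrVect Z) :
    V.carrier ⊗[ℂ] (W.carrier ⊗[ℂ] U.carrier) →ₗ[ℂ] V.carrier ⊗[ℂ] (W.carrier ⊗[ℂ] U.carrier) :=
  ∑ x, ∑ y, ∑ z, (c x y z : ℂ) •
    TensorProduct.map (V.proj x) (TensorProduct.map (W.proj y) (U.proj z))

theorem scale_homog (c : X → Y → Z → ℂˣ) {V : GrVect X} {W : GrVect Y} {U : GrVect Z}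
    {x : X} {y : Y} {z : Z} {v : V.carrier} {w : W.carrier} {u : U.carrier}
    (hv : V.IsHomog x v) (hw : W.IsHomog y w) (hu : U.IsHomog z u) :
    scale c V W U (v ⊗ₜ (w ⊗ₜ u)) = (c x y z : ℂ) • (v ⊗ₜ (w ⊗ₜ u)) := by
  classical
  unfold scale
  rw [LinearMap.sum_apply, Finset.sum_eq_single x, LinearMap.sum_apply, Finset.sum_eq_single y,
    LinearMap.sum_apply, Finset.sum_eq_single z]
  · rw [LinearMap.smul_apply, TensorProduct.map_tmul, TensorProduct.map_tmul, hv, hw, hu]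
  · intro z' _ hz'
    simp [hu.proj_eq, hz'.symm]
  · simp
  · intro y' _ hy'
    simp [hw.proj_eq, hy'.symm]
  · simp
  · intro x' _ hx'
    simp [hv.proj_eq, hx'.symm]
  · simp

theorem tensor_lin_ext₃ {V : GrVect X} {W : GrVect Y} {U : GrVect Z}
    {M : Type*} [AddCommGroup M] [Module ℂ M]
    {f g : V.carrier ⊗[ℂ] (W.carrier ⊗[ℂ] U.carrier) →ₗ[ℂ] M}
    (h : ∀ x v, V.IsHomog x v → ∀ y w, W.IsHomog y w → ∀ z u, U.IsHomog z u →
      f (v ⊗ₜ (w ⊗ₜ u)) = g (v ⊗ₜ (w ⊗ₜ u))) : f = g := by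
  apply TensorProduct.ext
  refine lin_ext fun x v hv => ?_
  exact tensor_lin_ext fun y w hw z u hu => by simpa using h x v hv y w hw z u hu

theorem tensor_lin_ext₃' {V : GrVect X} {W : GrVect Y} {U : GrVect Z}
    {M : Type*} [AddCommGroup M] [Module ℂ M]
    {f g : (V.carrier ⊗[ℂ] W.carrier) ⊗[ℂ] U.carrier →ₗ[ℂ] M}
    (h : ∀ x v, V.IsHomog x v → ∀ y w, W.IsHomog y w → ∀ z u, U.IsHomog z u →
      f ((v ⊗ₜ w) ⊗ₜ u) = g ((v ⊗ₜ w) ⊗ₜ u)) : f = g := by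
  apply TensorProduct.ext
  refine tensor_lin_ext fun x v hv y w hw => ?_
  exact lin_ext fun z u hu => by simpa using h x v hv y w hw z u hu

theorem scale_scale (c d : X → Y → Z → ℂˣ) (hcd : ∀ x y z, c x y z * d x y z = 1)
    (V : GrVect X) (W : GrVect Y) (U : GrVect Z) :
    scale c V W U ∘ₗ scale d V W U = LinearMap.id :=
  tensor_lin_ext₃ fun x v hv y w hw z u hu => by
    rw [LinearMap.comp_apply, scale_homog d hv hw hu, map_smul, scale_homog c hv hw hu, smul_smul,
      mul_comm, ← Units.val_mul, hcd]
    simp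

/-- The linear isomorphism `(V ⊗ W) ⊗ U ≃ V ⊗ (W ⊗ U)` which sends `(v ⊗ w) ⊗ u`, with
`v`, `w`, `u` homogeneous of degrees `x`, `y`, `z`, to `c x y z • (v ⊗ (w ⊗ u))`. -/
def assocEquiv (c : X → Y → Z → ℂˣ) (V : GrVect X) (W : GrVect Y) (U : GrVect Z) :
    (V.carrier ⊗[ℂ] W.carrier) ⊗[ℂ] U.carrier ≃ₗ[ℂ]
      V.carrier ⊗[ℂ] (W.carrier ⊗[ℂ] U.carrier) :=
  TensorProduct.assoc ℂ V.carrier W.carrier U.carrier ≪≫ₗ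
    { scale c V W U with
      invFun := scale (fun x y z => (c x y z)⁻¹) V W U
      left_inv := fun t => LinearMap.congr_fun
        (scale_scale _ c (fun _ _ _ => inv_mul_cancel _) V W U) t
      right_inv := fun t => LinearMap.congr_fun
        (scale_scale c _ (fun _ _ _ => mul_inv_cancel _) V W U) t }

theorem assocEquiv_homog (c : X → Y → Z → ℂˣ) {V : GrVect X} {W : GrVect Y} {U : GrVect Z}
    {x : X} {y : Y} {z : Z} {v : V.carrier} {w : W.carrier} {u : U.carrier}
    (hv : V.IsHomog x v) (hw : W.IsHomog y w) (hu : U.IsHomog z u) :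
    assocEquiv c V W U ((v ⊗ₜ w) ⊗ₜ u) = (c x y z : ℂ) • (v ⊗ₜ (w ⊗ₜ u)) :=
  scale_homog c hv hw hu

/-- The isomorphism `(V ⊗ W) ⊗ U ≅ V ⊗ (W ⊗ U)` of graded vector spaces with scalars `c`. -/
def assocIso (m₁ : X → Y → P) (m₂ : P → Z → T) (n₁ : Y → Z → Q) (n₂ : X → Q → T)
    (h : ∀ x y z, m₂ (m₁ x y) z = n₂ x (n₁ y z)) (c : X → Y → Z → ℂˣ)
    (V : GrVect X) (W : GrVect Y) (U : GrVect Z) :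
    tensor m₂ (tensor m₁ V W) U ≅ tensor n₂ V (tensor n₁ W U) :=
  mkIso (V := tensor m₂ (tensor m₁ V W) U) (W := tensor n₂ V (tensor n₁ W U))
    (assocEquiv c V W U) (by
      classical
      intro t a
      have key : (assocEquiv c V W U).toLinearMap ∘ₗ tensorProj m₂ (tensor m₁ V W) U t =
          tensorProj n₂ V (tensor n₁ W U) t ∘ₗ (assocEquiv c V W U).toLinearMap := by
        refine tensor_lin_ext₃' fun x v hv y w hw z u hu => ?_
        have h₁ : tensorProj m₂ (tensor m₁ V W) U t ((v ⊗ₜ w) ⊗ₜ u) =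
            if m₂ (m₁ x y) z = t then (v ⊗ₜ w) ⊗ₜ u else 0 :=
          tensorProj_homog m₂ t (hv.tmul m₁ hw) hu
        have h₂ : tensorProj n₂ V (tensor n₁ W U) t (v ⊗ₜ (w ⊗ₜ u)) =
            if n₂ x (n₁ y z) = t then v ⊗ₜ (w ⊗ₜ u) else 0 :=
          tensorProj_homog n₂ t hv (hw.tmul n₁ hu)
        have h₃ := assocEquiv_homog c hv hw hu
        calc assocEquiv c V W U (tensorProj m₂ (tensor m₁ V W) U t ((v ⊗ₜ w) ⊗ₜ u))
            = if n₂ x (n₁ y z) = t then (c x y z : ℂ) • (v ⊗ₜ (w ⊗ₜ u)) else 0 := by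
              rw [h₁, h]; split_ifs
              · exact h₃
              · exact map_zero _
          _ = tensorProj n₂ V (tensor n₁ W U) t ((c x y z : ℂ) • (v ⊗ₜ (w ⊗ₜ u))) := by
              refine Eq.trans ?_ (LinearMap.map_smul _ _ _).symm
              rw [h₂]; split_ifs
              · rfl
              · exact (smul_zero _).symm
          _ = _ := congrArg _ h₃.symm
      exact LinearMap.congr_fun key a)

theorem assocIso_hom_homog (m₁ : X → Y → P) (m₂ : P → Z → T) (n₁ : Y → Z → Q) (n₂ : X → Q → T)
    (h : ∀ x y z, m₂ (m₁ x y) z = n₂ x (n₁ y z)) (c : X → Y → Z → ℂˣ)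
    {V : GrVect X} {W : GrVect Y} {U : GrVect Z}
    {x : X} {y : Y} {z : Z} {v : V.carrier} {w : W.carrier} {u : U.carrier}
    (hv : V.IsHomog x v) (hw : W.IsHomog y w) (hu : U.IsHomog z u) :
    (assocIso m₁ m₂ n₁ n₂ h c V W U).hom.lin ((v ⊗ₜ[ℂ] w) ⊗ₜ[ℂ] u) =
      (c x y z : ℂ) • (v ⊗ₜ[ℂ] (w ⊗ₜ[ℂ] u)) :=
  assocEquiv_homog c hv hw hu

theorem assocIso_inv_homog (m₁ : X → Y → P) (m₂ : P → Z → T) (n₁ : Y → Z → Q) (n₂ : X → Q → T)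
    (h : ∀ x y z, m₂ (m₁ x y) z = n₂ x (n₁ y z)) (c : X → Y → Z → ℂˣ)
    {V : GrVect X} {W : GrVect Y} {U : GrVect Z}
    {x : X} {y : Y} {z : Z} {v : V.carrier} {w : W.carrier} {u : U.carrier}
    (hv : V.IsHomog x v) (hw : W.IsHomog y w) (hu : U.IsHomog z u) :
    (assocIso m₁ m₂ n₁ n₂ h c V W U).inv.lin (v ⊗ₜ[ℂ] (w ⊗ₜ[ℂ] u)) =
      ((c x y z)⁻¹ : ℂˣ).val • ((v ⊗ₜ[ℂ] w) ⊗ₜ[ℂ] u) := by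
  have h₁ : (assocEquiv c V W U).symm (v ⊗ₜ[ℂ] (w ⊗ₜ[ℂ] u)) =
      ((c x y z)⁻¹ : ℂˣ).val • ((v ⊗ₜ[ℂ] w) ⊗ₜ[ℂ] u) := by
    rw [LinearEquiv.symm_apply_eq, map_smul, assocEquiv_homog c hv hw hu, smul_smul]
    simp
  exact h₁

end Assoc

/-! ## The unit -/

section Unit

variable {X Y : Type u} [Fintype X] [Fintype Y]

open Classical in
/-- The one-dimensional space `ℂ` in degree `e`. -/
abbrev unit (e : X) : GrVect X where
  carrier := ℂ
  proj x := if x = e then LinearMap.id else 0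
  proj_self x v := by split_ifs <;> simp
  proj_ne x y hxy v := by
    by_cases hx : x = e
    · have hy : y ≠ e := fun hy => hxy (hx.trans hy.symm)
      rw [if_neg hy]; simp
    · rw [if_neg hx]; simp
  sum_proj v := by
    rw [Finset.sum_eq_single e] <;> simp +contextual

theorem isHomog_unit (e : X) (r : ℂ) : (unit e).IsHomog e r := by
  simp [IsHomog]

/-- The isomorphism `ℂ ⊗ V ≅ V`, where `ℂ` sits in a degree that acts as a left identity. -/
def leftUnitIso (m : X → Y → Y) (e : X) (he : ∀ y, m e y = y) (V : GrVect Y) :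
    tensor m (unit e) V ≅ V :=
  mkIso (V := tensor m (unit e) V) (TensorProduct.lid ℂ V.carrier) (by
    classical
    intro y t
    have key : (TensorProduct.lid ℂ V.carrier).toLinearMap ∘ₗ tensorProj m (unit e) V y =
        V.proj y ∘ₗ (TensorProduct.lid ℂ V.carrier).toLinearMap := by
      apply TensorProduct.ext
      refine LinearMap.ext fun r => lin_ext fun z v hv => ?_
      have h₁ : tensorProj m (unit e) V y (r ⊗ₜ[ℂ] v) = if m e z = y then r ⊗ₜ[ℂ] v else 0 :=
        tensorProj_homog m y (isHomog_unit e r) hv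
      have h₂ := hv.proj_eq y
      show TensorProduct.lid ℂ V.carrier (tensorProj m (unit e) V y (r ⊗ₜ[ℂ] v)) = V.proj y (TensorProduct.lid ℂ V.carrier (r ⊗ₜ[ℂ] v))
      rw [h₁, he]
      split_ifs at h₂ ⊢ <;> simp [h₂]
    exact LinearMap.congr_fun key t)

/-- The isomorphism `V ⊗ ℂ ≅ V`, where `ℂ` sits in a degree that acts as a right identity. -/
def rightUnitIso (m : Y → X → Y) (e : X) (he : ∀ y, m y e = y) (V : GrVect Y) :
    tensor m V (unit e) ≅ V :=
  mkIso (V := tensor m V (unit e)) (TensorProduct.rid ℂ V.carrier) (by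
    classical
    intro y t
    have key : (TensorProduct.rid ℂ V.carrier).toLinearMap ∘ₗ tensorProj m V (unit e) y =
        V.proj y ∘ₗ (TensorProduct.rid ℂ V.carrier).toLinearMap := by
      apply TensorProduct.ext
      refine lin_ext fun z v hv => LinearMap.ext fun r => ?_
      have h₁ : tensorProj m V (unit e) y (v ⊗ₜ[ℂ] r) = if m z e = y then v ⊗ₜ[ℂ] r else 0 :=
        tensorProj_homog m y hv (isHomog_unit e r)
      have h₂ := hv.proj_eq y
      show TensorProduct.rid ℂ V.carrier (tensorProj m V (unit e) y (v ⊗ₜ[ℂ] r)) = V.proj y (TensorProduct.rid ℂ V.carrier (v ⊗ₜ[ℂ] r))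
      rw [h₁, he]
      split_ifs at h₂ ⊢ <;> simp [h₂]
    exact LinearMap.congr_fun key t)

@[simp] theorem leftUnitIso_hom_tmul (m : X → Y → Y) (e : X) (he : ∀ y, m e y = y)
    (V : GrVect Y) (r : ℂ) (v : V.carrier) :
    (leftUnitIso m e he V).hom.lin (r ⊗ₜ[ℂ] v) = r • v :=
  TensorProduct.lid_tmul v r

@[simp] theorem rightUnitIso_hom_tmul (m : Y → X → Y) (e : X) (he : ∀ y, m y e = y)
    (V : GrVect Y) (v : V.carrier) (r : ℂ) :
    (rightUnitIso m e he V).hom.lin (v ⊗ₜ[ℂ] r) = r • v :=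
  TensorProduct.rid_tmul v r

end Unit

/-! ## Coherence -/

section Coherence

variable {X Y Z P Q T : Type u} [Fintype X] [Fintype Y] [Fintype Z] [Fintype P] [Fintype Q]
  [Fintype T]

theorem tensorMap_id (m : X → Y → Z) (V : GrVect X) (W : GrVect Y) :
    tensorMap m (𝟙 V) (𝟙 W) = 𝟙 (tensor m V W) :=
  tensor_hom_ext m fun _ _ _ _ _ _ => rfl

theorem tensorMap_comp (m : X → Y → Z) {V V' V'' : GrVect X} {W W' W'' : GrVect Y} (f : V ⟶ V')
    (f' : V' ⟶ V'') (g : W ⟶ W') (g' : W' ⟶ W'') :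
    tensorMap m (f ≫ f') (g ≫ g') = tensorMap m f g ≫ tensorMap m f' g' :=
  tensor_hom_ext m fun _ _ _ _ _ _ => rfl

theorem tensorMap_def (m : X → Y → Z) {V V' : GrVect X} {W W' : GrVect Y} (f : V ⟶ V')
    (g : W ⟶ W') : tensorMap m f g = tensorMap m f (𝟙 W) ≫ tensorMap m (𝟙 V') g :=
  tensor_hom_ext m fun _ _ _ _ _ _ => rfl

theorem zero_tensorMap (m : X → Y → Z) (V V' : GrVect X) {W W' : GrVect Y} (g : W ⟶ W') :
    tensorMap m (0 : V ⟶ V') g = 0 :=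
  tensor_hom_ext m fun _ _ _ _ w _ => TensorProduct.zero_tmul _ (g.lin w)

theorem assocIso_naturality (m₁ : X → Y → P) (m₂ : P → Z → T) (n₁ : Y → Z → Q) (n₂ : X → Q → T)
    (h : ∀ x y z, m₂ (m₁ x y) z = n₂ x (n₁ y z)) (c : X → Y → Z → ℂˣ)
    {V V' : GrVect X} {W W' : GrVect Y} {U U' : GrVect Z}
    (f : V ⟶ V') (g : W ⟶ W') (k : U ⟶ U') :
    tensorMap m₂ (tensorMap m₁ f g) k ≫ (assocIso m₁ m₂ n₁ n₂ h c V' W' U').hom =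
      (assocIso m₁ m₂ n₁ n₂ h c V W U).hom ≫ tensorMap n₂ f (tensorMap n₁ g k) := by
  refine Hom.ext (tensor_lin_ext₃' fun x v hv y w hw z u hu => ?_)
  have h₁ := assocIso_hom_homog m₁ m₂ n₁ n₂ h c (hv.map f) (hw.map g) (hu.map k)
  have h₂ := assocIso_hom_homog m₁ m₂ n₁ n₂ h c hv hw hu
  refine h₁.trans (Eq.symm ((congrArg (tensorMap n₂ f (tensorMap n₁ g k)).lin h₂).trans ?_))
  exact (LinearMap.map_smul _ _ _)

theorem leftUnitIso_naturality (m : X → Y → Y) (e : X) (he : ∀ y, m e y = y)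
    {V W : GrVect Y} (f : V ⟶ W) :
    tensorMap m (𝟙 (unit e)) f ≫ (leftUnitIso m e he W).hom = (leftUnitIso m e he V).hom ≫ f :=
  tensor_hom_ext m fun _ r _ _ v _ =>
    (leftUnitIso_hom_tmul m e he W r (f.lin v)).trans
      (((congrArg f.lin (leftUnitIso_hom_tmul m e he V r v)).trans (map_smul f.lin r v)).symm)

theorem rightUnitIso_naturality (m : Y → X → Y) (e : X) (he : ∀ y, m y e = y)
    {V W : GrVect Y} (f : V ⟶ W) :
    tensorMap m f (𝟙 (unit e)) ≫ (rightUnitIso m e he W).hom = (rightUnitIso m e he V).hom ≫ f :=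
  tensor_hom_ext m fun _ v _ _ r _ =>
    (rightUnitIso_hom_tmul m e he W (f.lin v) r).trans
      (((congrArg f.lin (rightUnitIso_hom_tmul m e he V v r)).trans (map_smul f.lin r v)).symm)

end Coherence

section Action

variable {G X : Type u} [Fintype G] [Fintype X] [Group G] (a : X → G → X)
  (ha : ∀ x g h, a (a x g) h = a x (g * h)) (ha₁ : ∀ x, a x 1 = x)

/-- The associativity isomorphism `(M ⊗ V) ⊗ W ≅ M ⊗ (V ⊗ W)` with scalars `c`, for an `X`-graded
space `M`, where `G` acts on `X` from the right. -/
abbrev actAssoc (c : X → G → G → ℂˣ) (M : GrVect X) (V W : GrVect G) :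
    tensor a (tensor a M V) W ≅ tensor a M (tensor (· * ·) V W) :=
  assocIso a a (· * ·) a ha c M V W

theorem actAssoc_pentagon (c : X → G → G → ℂˣ) (w : G → G → G → ℂˣ)
    (hc : ∀ x g h l, c x g h * c x (g * h) l * w g h l = c (a x g) h l * c x g (h * l))
    (M : GrVect X) (V W U : GrVect G) :
    tensorMap a (actAssoc a ha c M V W).hom (𝟙 U) ≫
        (actAssoc a ha c M (tensor (· * ·) V W) U).hom ≫
          tensorMap a (𝟙 M) (actAssoc (· * ·) mul_assoc w V W U).hom =
      (actAssoc a ha c (tensor a M V) W U).hom ≫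
        (actAssoc a ha c M V (tensor (· * ·) W U)).hom := by
  refine Hom.ext (TensorProduct.ext (tensor_lin_ext₃' fun x m hm g v hv h w' hw =>
    lin_ext fun l u hu => ?_))
  have h₁ := assocIso_hom_homog a a (· * ·) a ha c hm hv hw
  have h₂ := assocIso_hom_homog a a (· * ·) a ha c hm (hv.tmul (· * ·) hw) hu
  have h₃ := assocIso_hom_homog (· * ·) (· * ·) (· * ·) (· * ·) mul_assoc w hv hw hu
  have h₄ := assocIso_hom_homog a a (· * ·) a ha c (hm.tmul a hv) hw hu
  have h₅ := assocIso_hom_homog a a (· * ·) a ha c hm hv (hw.tmul (· * ·) hu)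
  have e₁ := congrArg (fun t => (tensorMap a (𝟙 M) (actAssoc (· * ·) mul_assoc w V W U).hom).lin
    ((actAssoc a ha c M (tensor (· * ·) V W) U).hom.lin (t ⊗ₜ[ℂ] u))) h₁
  have e₂ := congrArg (actAssoc a ha c M V (tensor (· * ·) W U)).hom.lin h₄
  refine Eq.trans e₁ (Eq.trans ?_ e₂.symm)
  have e₃ : (tensorMap a (𝟙 M) (actAssoc (· * ·) mul_assoc w V W U).hom).lin
      ((actAssoc a ha c M (tensor (· * ·) V W) U).hom.lin ((m ⊗ₜ[ℂ] (v ⊗ₜ[ℂ] w')) ⊗ₜ[ℂ] u)) =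
      (c x (g * h) l * w g h l : ℂ) • (m ⊗ₜ[ℂ] (v ⊗ₜ[ℂ] (w' ⊗ₜ[ℂ] u))) := by
    refine (congrArg (tensorMap a (𝟙 M) (actAssoc (· * ·) mul_assoc w V W U).hom).lin h₂).trans ?_
    refine (LinearMap.map_smul _ _ _).trans ?_
    rw [← smul_smul]
    exact congrArg _ ((congrArg (fun t => m ⊗ₜ[ℂ] t) h₃).trans (tmul_smul _ _ _))
  have e₄ : (tensorMap a (𝟙 M) (actAssoc (· * ·) mul_assoc w V W U).hom).lin
      ((actAssoc a ha c M (tensor (· * ·) V W) U).hom.lin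
        (((c x g h : ℂ) • (m ⊗ₜ[ℂ] (v ⊗ₜ[ℂ] w'))) ⊗ₜ[ℂ] u)) =
      (c x g h : ℂ) • (c x (g * h) l * w g h l : ℂ) • (m ⊗ₜ[ℂ] (v ⊗ₜ[ℂ] (w' ⊗ₜ[ℂ] u))) := by
    rw [smul_tmul']
    refine (congrArg (tensorMap a (𝟙 M) (actAssoc (· * ·) mul_assoc w V W U).hom).lin
      (LinearMap.map_smul _ _ _)).trans ((LinearMap.map_smul _ _ _).trans (congrArg _ e₃))
  have e₅ : (actAssoc a ha c M V (tensor (· * ·) W U)).hom.lin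
      ((c (a x g) h l : ℂ) • ((m ⊗ₜ[ℂ] v) ⊗ₜ[ℂ] (w' ⊗ₜ[ℂ] u))) =
      (c (a x g) h l : ℂ) • (c x g (h * l) : ℂ) • (m ⊗ₜ[ℂ] (v ⊗ₜ[ℂ] (w' ⊗ₜ[ℂ] u))) :=
    (LinearMap.map_smul _ _ _).trans (congrArg _ h₅)
  refine e₄.trans (Eq.trans ?_ e₅.symm)
  rw [smul_smul, smul_smul, ← mul_assoc, ← Units.val_mul, ← Units.val_mul, ← Units.val_mul, hc]

theorem actAssoc_triangle (c : X → G → G → ℂˣ) (hc : ∀ x g, c x 1 g = 1)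
    (M : GrVect X) (V : GrVect G) :
    (actAssoc a ha c M (unit 1) V).hom ≫ tensorMap a (𝟙 M) (leftUnitIso (· * ·) 1 one_mul V).hom =
      tensorMap a (rightUnitIso a 1 ha₁ M).hom (𝟙 V) := by
  refine Hom.ext (TensorProduct.ext (TensorProduct.ext (lin_ext fun x m hm =>
    LinearMap.ext fun r => lin_ext fun g v hv => ?_)))
  have h₁ := assocIso_hom_homog a a (· * ·) a ha c hm (isHomog_unit 1 r) hv
  have e₁ := congrArg
    (tensorMap a (𝟙 M) (leftUnitIso (· * ·) 1 one_mul V).hom).lin h₁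
  refine Eq.trans e₁ ?_
  refine (LinearMap.map_smul _ _ _).trans ?_
  rw [hc, Units.val_one, one_smul]
  refine (congrArg (fun t => m ⊗ₜ[ℂ] t) (leftUnitIso_hom_tmul (· * ·) 1 one_mul V r v)).trans ?_
  refine Eq.trans ?_ (congrArg (fun t => t ⊗ₜ[ℂ] v) (rightUnitIso_hom_tmul a 1 ha₁ M m r)).symm
  exact (smul_tmul r m v).symm

theorem actAssoc_right_unit (c : X → G → G → ℂˣ) (hc : ∀ x g, c x g 1 = 1)
    (M : GrVect X) (V : GrVect G) :
    (actAssoc a ha c M V (unit 1)).hom ≫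
        tensorMap a (𝟙 M) (rightUnitIso (· * ·) 1 mul_one V).hom =
      (rightUnitIso a 1 ha₁ (tensor a M V)).hom := by
  refine Hom.ext (TensorProduct.ext (tensor_lin_ext fun x m hm g v hv => LinearMap.ext fun r => ?_))
  have h₁ := assocIso_hom_homog a a (· * ·) a ha c hm hv (isHomog_unit 1 r)
  have e₁ := congrArg
    (tensorMap a (𝟙 M) (rightUnitIso (· * ·) 1 mul_one V).hom).lin h₁
  refine Eq.trans e₁ ?_
  refine (LinearMap.map_smul _ _ _).trans ?_
  rw [hc, Units.val_one, one_smul]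
  refine (congrArg (fun t => m ⊗ₜ[ℂ] t) (rightUnitIso_hom_tmul (· * ·) 1 mul_one V v r)).trans ?_
  refine Eq.trans ?_ (rightUnitIso_hom_tmul a 1 ha₁ (tensor a M V) (m ⊗ₜ[ℂ] v) r).symm
  exact tmul_smul r m v

theorem actAssoc_inv_naturality (c : X → G → G → ℂˣ) {M M' : GrVect X} {V V' W W' : GrVect G}
    (f : M ⟶ M') (g : V ⟶ V') (k : W ⟶ W') :
    tensorMap a f (tensorMap (· * ·) g k) ≫ (actAssoc a ha c M' V' W').inv =
      (actAssoc a ha c M V W).inv ≫ tensorMap a (tensorMap a f g) k := by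
  rw [Iso.comp_inv_eq, Category.assoc, Iso.eq_inv_comp]
  exact (assocIso_naturality a a (· * ·) a ha c f g k).symm

theorem actAssoc_conj (c : X → G → G → ℂˣ) {M M' : GrVect X} {V V' W W' : GrVect G}
    (f : M ⟶ M') (g : V ⟶ V') (k : W ⟶ W') :
    tensorMap a f (tensorMap (· * ·) g k) =
      (actAssoc a ha c M V W).inv ≫ tensorMap a (tensorMap a f g) k ≫
        (actAssoc a ha c M' V' W').hom := by
  rw [Iso.eq_inv_comp]
  exact (assocIso_naturality a a (· * ·) a ha c f g k).symm

theorem actAssoc_conj_right (c : X → G → G → ℂˣ) (M : GrVect X) (V : GrVect G) {W W' : GrVect G}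
    (k : W ⟶ W') :
    tensorMap a (𝟙 M) (tensorMap (· * ·) (𝟙 V) k) =
      (actAssoc a ha c M V W).inv ≫ tensorMap a (𝟙 (tensor a M V)) k ≫
        (actAssoc a ha c M V W').hom := by
  rw [actAssoc_conj a ha c, tensorMap_id]

theorem actAssoc_inv_pentagon (c : X → G → G → ℂˣ) (w : G → G → G → ℂˣ)
    (hc : ∀ x g h l, c x g h * c x (g * h) l * w g h l = c (a x g) h l * c x g (h * l))
    (M : GrVect X) (V W U : GrVect G) :
    tensorMap a (𝟙 M) (actAssoc (· * ·) mul_assoc w V W U).hom ≫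
        (actAssoc a ha c M V (tensor (· * ·) W U)).inv ≫
          (actAssoc a ha c (tensor a M V) W U).inv =
      (actAssoc a ha c M (tensor (· * ·) V W) U).inv ≫
        tensorMap a (actAssoc a ha c M V W).inv (𝟙 U) := by
  have h₁ := actAssoc_pentagon a ha c w hc M V W U
  have h₂ : tensorMap a (actAssoc a ha c M V W).inv (𝟙 U) ≫
      tensorMap a (actAssoc a ha c M V W).hom (𝟙 U) = 𝟙 _ := by
    rw [← tensorMap_comp, Iso.inv_hom_id, Category.comp_id, tensorMap_id]
  rw [← Category.assoc, Iso.comp_inv_eq, Iso.comp_inv_eq]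
  simp only [Category.assoc]
  rw [Iso.eq_inv_comp, ← h₁, reassoc_of% h₂]

end Action

end GrVect

/-! ## Group cochains -/

section Cochains

variable {G : Type u} [Group G]

/-- A function of several group variables is normalized if it is `1` whenever some variable
is `1`. -/
def IsNormalized {n : ℕ} (f : (Fin n → G) → ℂˣ) : Prop :=
  ∀ g, (∃ i, g i = 1) → f g = 1

/-- The differential of the complex `C^*(G, ℂ*)`. -/
def dGroup (n : ℕ) : ((Fin n → G) → ℂˣ) →* ((Fin (n + 1) → G) → ℂˣ) where
  toFun f g := f (Fin.tail g) *
    (∏ j : Fin n, f (Fin.contractNth j.castSucc (· * ·) g) ^ ((-1 : ℤ) ^ (j.val + 1))) *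
    f (Fin.init g) ^ ((-1 : ℤ) ^ (n + 1))
  map_one' := by ext g; simp
  map_mul' f f' := by
    funext g
    simp only [Pi.mul_apply, mul_zpow, Finset.prod_mul_distrib]
    ac_rfl

/-- The differential `δ_G` of the complex `C^*(G, Map(X, ℂ*))`, for a right `G`-set `X`. -/
def dG {X : Type u} [MulAction Gᵐᵒᵖ X] (n : ℕ) :
    (X → (Fin n → G) → ℂˣ) →* (X → (Fin (n + 1) → G) → ℂˣ) where
  toFun f x g := f (MulOpposite.op (g 0) • x) (Fin.tail g) *
    (∏ j : Fin n, f x (Fin.contractNth j.castSucc (· * ·) g) ^ ((-1 : ℤ) ^ (j.val + 1))) *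
    f x (Fin.init g) ^ ((-1 : ℤ) ^ (n + 1))
  map_one' := by ext x g; simp
  map_mul' f f' := by
    funext x g
    simp only [Pi.mul_apply, mul_zpow, Finset.prod_mul_distrib]
    ac_rfl

variable (G) in
/-- The group `C^n(G, ℂ*)` of normalized cochains. -/
def CGroup (n : ℕ) : Subgroup ((Fin n → G) → ℂˣ) where
  carrier := {f | IsNormalized f}
  one_mem' _ _ := rfl
  mul_mem' hf hf' g hg := by simp [hf g hg, hf' g hg]
  inv_mem' hf g hg := by simp [hf g hg]

variable (G) in
/-- The group `Z^n(G, ℂ*)` of normalized cocycles. -/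
def ZGroup (n : ℕ) : Subgroup ((Fin n → G) → ℂˣ) := CGroup G n ⊓ (dGroup n).ker

variable (G) in
/-- The group `B^n(G, ℂ*)` of coboundaries of normalized cochains. -/
def BGroup : (n : ℕ) → Subgroup ((Fin n → G) → ℂˣ)
  | 0 => ⊥
  | n + 1 => (CGroup G n).map (dGroup n)

variable (G) in
/-- The cohomology group `H^n(G, ℂ*)`. -/
abbrev HGroup (n : ℕ) : Type u := ZGroup G n ⧸ (BGroup G n).subgroupOf (ZGroup G n)

/-- The cocycle identity for a 3-cocycle. -/
theorem cocycle₃ (ω : ZGroup G 3) (g h k l : G) :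
    ω.1 ![h, k, l] * ω.1 ![g, h * k, l] * ω.1 ![g, h, k] =
      ω.1 ![g * h, k, l] * ω.1 ![g, h, k * l] := by
  have h₀ : dGroup 3 ω.1 ![g, h, k, l] = 1 := congrFun ω.2.2 _
  have h₁ : (Fin.init ![g, h, k, l] : Fin 3 → G) = ![g, h, k] := by
    ext i; fin_cases i <;> rfl
  have h₂ : (Fin.contractNth (Fin.castSucc 0) (· * ·) ![g, h, k, l] : Fin 3 → G) =
      ![g * h, k, l] := by ext i; fin_cases i <;> rfl
  have h₃ : (Fin.contractNth (Fin.castSucc 1) (· * ·) ![g, h, k, l] : Fin 3 → G) =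
      ![g, h * k, l] := by ext i; fin_cases i <;> rfl
  have h₄ : (Fin.contractNth (Fin.castSucc 2) (· * ·) ![g, h, k, l] : Fin 3 → G) =
      ![g, h, k * l] := by ext i; fin_cases i <;> rfl
  have h₅ : (Fin.tail ![g, h, k, l] : Fin 3 → G) = ![h, k, l] := rfl
  simp only [dGroup, MonoidHom.coe_mk, OneHom.coe_mk, Fin.prod_univ_three, h₁, h₂, h₃, h₄, h₅] at h₀
  norm_num at h₀
  have aux : ∀ a b c d e : ℂˣ, a * (b⁻¹ * c * d⁻¹) * e = 1 → a * c * e = b * d := by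
    intro a b c d e h
    have : a * c * e = (a * (b⁻¹ * c * d⁻¹) * e) * (b * d) := by
      rw [show (a * (b⁻¹ * c * d⁻¹) * e) * (b * d) = (a * c * e) * (b⁻¹ * b) * (d⁻¹ * d) by ac_rfl]
      simp
    rw [this, h, one_mul]
  exact aux _ _ _ _ _ h₀

/-- The right `G`-set `A \ G` of right cosets. -/
def RightCosets (A : Subgroup G) : Type u := Quotient (QuotientGroup.rightRel A)

/-- The action `(A x) ◁ g = A (x g)`. -/
instance (A : Subgroup G) : MulAction Gᵐᵒᵖ (RightCosets A) where
  smul g := Quotient.map (fun x => x * g.unop) (by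
    intro x y h
    have h' := QuotientGroup.rightRel_apply.1 h
    refine QuotientGroup.rightRel_apply.2 ?_
    simpa [mul_assoc] using h')
  one_smul k := by
    induction k using Quotient.inductionOn with
    | h x => exact congrArg _ (mul_one x)
  mul_smul g h k := by
    induction k using Quotient.inductionOn with
    | h x => exact congrArg _ (mul_assoc x h.unop g.unop).symm

instance [Finite G] (A : Subgroup G) : Fintype (RightCosets A) :=
  haveI : Finite (RightCosets A) := Quotient.finite _
  Fintype.ofFinite _

/-- The right action `k ◁ g` of `G` on `A \ G`. -/
def act {A : Subgroup G} (k : RightCosets A) (g : G) : RightCosets A := MulOpposite.op g • k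

theorem act_act {A : Subgroup G} (k : RightCosets A) (g h : G) : act (act k g) h = act k (g * h) := by
  simp [act, mul_smul]

theorem act_one {A : Subgroup G} (k : RightCosets A) : act k 1 = k := by
  simp [act]

theorem normalized₃ (ω : ZGroup G 3) (g h : G) : ω.1 ![g, 1, h] = 1 :=
  ω.2.1 _ ⟨1, rfl⟩

/-- The data of the module category `M(A \ G, μ)` over `Vect(G, ω)`: a normalized cochain
`μ ∈ C^2(G, Map(A \ G, ℂ*))` with `δ_G μ⁻¹ = π^* ω`. -/
structure ModuleDatum (A : Subgroup G) (ω : ZGroup G 3) where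
  μ : RightCosets A → (Fin 2 → G) → ℂˣ
  normalized : ∀ k, IsNormalized (μ k)
  δ_inv : dG 2 μ⁻¹ = fun _ g => ω.1 g

/-- The pentagon identity for `μ`. -/
theorem ModuleDatum.pentagon {A : Subgroup G} {ω : ZGroup G 3} (m : ModuleDatum A ω)
    (k : RightCosets A) (g h l : G) :
    ω.1 ![g, h, l] * m.μ k ![g, h * l] * m.μ (MulOpposite.op g • k) ![h, l] =
      m.μ k ![g * h, l] * m.μ k ![g, h] := by
  have h₀ : dG 2 m.μ⁻¹ k ![g, h, l] = ω.1 ![g, h, l] := congrFun (congrFun m.δ_inv k) _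
  have h₁ : (Fin.init ![g, h, l] : Fin 2 → G) = ![g, h] := by
    ext i; fin_cases i <;> rfl
  have h₂ : (Fin.contractNth (Fin.castSucc 0) (· * ·) ![g, h, l] : Fin 2 → G) =
      ![g * h, l] := by ext i; fin_cases i <;> rfl
  have h₃ : (Fin.contractNth (Fin.castSucc 1) (· * ·) ![g, h, l] : Fin 2 → G) =
      ![g, h * l] := by ext i; fin_cases i <;> rfl
  have h₄ : (Fin.tail ![g, h, l] : Fin 2 → G) = ![h, l] := rfl
  simp only [dG, MonoidHom.coe_mk, OneHom.coe_mk, Fin.prod_univ_two, h₁, h₂, h₃, h₄] at h₀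
  norm_num at h₀
  rw [← h₀]
  have aux : ∀ a b c d : ℂˣ, a⁻¹ * (b * c⁻¹) * d * c * a = b * d := by
    intro a b c d
    rw [show a⁻¹ * (b * c⁻¹) * d * c * a = (a⁻¹ * a) * (c⁻¹ * c) * (b * d) by ac_rfl]
    simp
  exact aux _ _ _ _

end Cochains

/-! ## The fusion category `Vect(G, ω)` -/

section Vect

variable {G : Type u} [Group G] [Fintype G]

/-- The category of `G`-graded finite-dimensional complex vector spaces; the cocycle `ω` enters
through the associativity constraint of its monoidal structure below. -/
def VectG (_ω : ZGroup G 3) : Type (max u 1) := GrVect G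

instance (ω : ZGroup G 3) : Category (VectG ω) := inferInstanceAs (Category (GrVect G))

instance (ω : ZGroup G 3) : Preadditive (VectG ω) := inferInstanceAs (Preadditive (GrVect G))

instance (ω : ZGroup G 3) : Linear ℂ (VectG ω) := inferInstanceAs (Linear ℂ (GrVect G))

open GrVect

instance (ω : ZGroup G 3) : MonoidalCategoryStruct (VectG ω) where
  tensorObj V W := tensor (· * ·) V W
  whiskerLeft V _ _ f := tensorMap (X := G) (Y := G) (· * ·) (𝟙 V) f
  whiskerRight f W := tensorMap (X := G) (Y := G) (· * ·) f (𝟙 W)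
  tensorHom f g := tensorMap (X := G) (Y := G) (· * ·) f g
  tensorUnit := unit (1 : G)
  associator V W U := actAssoc (· * ·) mul_assoc (fun g h k => ω.1 ![g, h, k]) V W U
  leftUnitor V := leftUnitIso (· * ·) 1 one_mul V
  rightUnitor V := rightUnitIso (· * ·) 1 mul_one V

instance (ω : ZGroup G 3) : MonoidalCategory (VectG ω) where
  tensorHom_def f g := tensorMap_def (X := G) (Y := G) (· * ·) f g
  id_tensorHom_id V W := tensorMap_id _ V W
  tensorHom_comp_tensorHom f g f' g' := (tensorMap_comp (X := G) (Y := G) (· * ·) f f' g g').symm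
  whiskerLeft_id V W := tensorMap_id _ V W
  id_whiskerRight V W := tensorMap_id _ V W
  associator_naturality f g k :=
    assocIso_naturality (X := G) (Y := G) (Z := G) (· * ·) (· * ·) (· * ·) (· * ·) mul_assoc _ f g k
  leftUnitor_naturality f := leftUnitIso_naturality (X := G) (Y := G) (· * ·) 1 one_mul f
  rightUnitor_naturality f := rightUnitIso_naturality (X := G) (Y := G) (· * ·) 1 mul_one f
  pentagon V W U S := actAssoc_pentagon (· * ·) mul_assoc (fun g h k => ω.1 ![g, h, k])
    (fun g h k => ω.1 ![g, h, k])
    (fun g h k l => by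
      rw [← cocycle₃ ω g h k l]; ac_rfl)
    V W U S
  triangle V W := actAssoc_triangle (· * ·) mul_assoc mul_one _ (fun g h => normalized₃ ω g h) V W

/-! ## The module category `M(A \ G, μ)` -/

variable {A : Subgroup G} {ω : ZGroup G 3}

/-- The category of `A \ G`-graded finite-dimensional complex vector spaces; the cochain `μ` enters
through the associativity constraint of the right action of `Vect(G, ω)` below. -/
def ModCat (_m : ModuleDatum A ω) : Type (max u 1) := GrVect (RightCosets A)

instance (m : ModuleDatum A ω) : Category (ModCat m) :=
  inferInstanceAs (Category (GrVect (RightCosets A)))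

instance (m : ModuleDatum A ω) : Preadditive (ModCat m) :=
  inferInstanceAs (Preadditive (GrVect (RightCosets A)))

instance (m : ModuleDatum A ω) : Linear ℂ (ModCat m) :=
  inferInstanceAs (Linear ℂ (GrVect (RightCosets A)))

/-- The associativity constraint `M ⊗ (V ⊗ W) ≅ (M ⊗ V) ⊗ W` is multiplication by `μ k g h` on
`M_k ⊗ (V_g ⊗ W_h)`. -/
instance (m : ModuleDatum A ω) : MonoidalRightActionStruct (VectG ω) (ModCat m) where
  actionObj M V := tensor act M V
  actionHomRight M _ _ f := tensorMap (X := RightCosets A) (Y := G) act (𝟙 M) f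
  actionHomLeft f V := tensorMap (X := RightCosets A) (Y := G) act f (𝟙 V)
  actionHom f g := tensorMap (X := RightCosets A) (Y := G) act f g
  actionAssocIso M V W :=
    (actAssoc act act_act (fun k g h => (m.μ k ![g, h])⁻¹) M V W).symm
  actionUnitIso M := rightUnitIso act 1 act_one M

instance (m : ModuleDatum A ω) : MonoidalRightAction (VectG ω) (ModCat m) where
  actionHom_def f g := tensorMap_def (X := RightCosets A) (Y := G) act f g
  actionHomRight_id V M := tensorMap_id _ M V
  id_actionHomLeft V M := tensorMap_id _ M V
  actionHom_comp f f' g g' := tensorMap_comp (X := RightCosets A) (Y := G) act f f' g g'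
  actionAssocIso_hom_naturality f g h := actAssoc_inv_naturality act act_act _ f g h
  actionUnitIso_hom_naturality f :=
    (rightUnitIso_naturality (X := G) (Y := RightCosets A) act 1 act_one f).symm
  actionHomRight_whiskerRight f W M :=
    actAssoc_conj act act_act _ (𝟙 (M : GrVect (RightCosets A))) f (𝟙 (W : GrVect G))
  whiskerRight_actionHomLeft V _ _ f M := actAssoc_conj_right act act_act _ M V f
  actionHom_associator V W U M :=
    actAssoc_inv_pentagon act act_act (fun k g h => (m.μ k ![g, h])⁻¹)
      (fun g h k => ω.1 ![g, h, k])
      (fun k g h l => by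
        have h₀ : ω.1 ![g, h, l] * m.μ k ![g, h * l] * m.μ (act k g) ![h, l] =
          m.μ k ![g * h, l] * m.μ k ![g, h] := m.pentagon k g h l
        have aux : ∀ o p q r s : ℂˣ, o * p * q = r * s → s⁻¹ * r⁻¹ * o = q⁻¹ * p⁻¹ := by
          intro o p q r s h
          rw [← mul_inv, ← mul_inv, mul_comm s r, ← h, inv_mul_eq_iff_eq_mul, mul_comm q p,
            mul_assoc o p q, mul_inv_cancel_right]
        exact aux _ _ _ _ _ h₀)
      M V W U
  actionHom_leftUnitor V M := by
    refine ((Iso.inv_comp_eq _).2 ?_).symm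
    exact (actAssoc_triangle act act_act act_one (fun k g h => (m.μ k ![g, h])⁻¹)
      (fun k g => inv_eq_one.2 (m.normalized k _ ⟨0, rfl⟩)) M V).symm
  actionHom_rightUnitor V M := by
    refine ((Iso.inv_comp_eq _).2 ?_).symm
    exact (actAssoc_right_unit act act_act act_one (fun k g h => (m.μ k ![g, h])⁻¹)
      (fun k g => inv_eq_one.2 (m.normalized k _ ⟨1, rfl⟩)) M V).symm

end Vect

/-! ## The dual category -/

section Dual

open Functor.OplaxRightLinear

section Composition

variable (C : Type*) [Category* C] [MonoidalCategory C] {D : Type*} [Category* D]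
  [MonoidalRightAction C D]

/-- The module functor structure on the composite `d ↦ F (F' d)`. -/
instance (F F' : D ⥤ D) [F.OplaxRightLinear C] [F'.OplaxRightLinear C] :
    (F' ⋙ F).OplaxRightLinear C where
  δᵣ d c := F.map (δᵣ F' d c) ≫ δᵣ F (F'.obj d) c
  δᵣ_naturality_right d c c' f := by
    simp [← Functor.map_comp_assoc]
  δᵣ_naturality_left f c := by
    simp [← Functor.map_comp_assoc]
  δᵣ_associativity d c c' := by
    simp only [Functor.comp_obj, Functor.comp_map, Category.assoc, comp_actionHomLeft]
    rw [δᵣ_associativity, ← Functor.map_comp_assoc, δᵣ_associativity]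
    simp
  δᵣ_unitality_inv d := by
    simp

variable {C} in
theorem comp_δ (F F' : D ⥤ D) [F.OplaxRightLinear C] [F'.OplaxRightLinear C] (d : D) (c : C) :
    δᵣ (F' ⋙ F) d c = F.map (δᵣ F' d c) ≫ δᵣ F (F'.obj d) c := rfl

/-- The module functor structure on the identity functor. -/
instance : (𝟭 D).OplaxRightLinear C where
  δᵣ d c := 𝟙 (d ⊙ᵣ c)

variable {C} in
theorem one_δ (d : D) (c : C) : δᵣ (𝟭 D) d c = 𝟙 (d ⊙ᵣ c) := rfl

end Composition

variable (C : Type*) [Category* C] [MonoidalCategory C] (D : Type*) [Category* D] [Preadditive D]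
  [Linear ℂ D] [MonoidalRightAction C D]

/-- Objects of the dual category `C^*_D = Fun_C(D, D)`: module functors `(F, γ)`, that is
`ℂ`-linear functors `F : D ⥤ D` with natural isomorphisms `γ = δᵣ : F (M ⊗ X) ≅ F M ⊗ X` which
satisfy the pentagon and triangle axioms. -/
structure DualCat where
  functor : D ⥤ D
  [additive : functor.Additive]
  [linear : functor.Linear ℂ]
  [oplax : functor.OplaxRightLinear C]
  [isIso_δ : ∀ (d : D) (c : C), IsIso (δᵣ functor d c)]

attribute [instance] DualCat.additive DualCat.linear DualCat.oplax DualCat.isIso_δ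

variable {C D}

namespace DualCat

/-- Natural module transformations. -/
@[ext]
structure Hom (F F' : DualCat C D) where
  nat : F.functor ⟶ F'.functor
  comm : ∀ (d : D) (c : C), nat.app (d ⊙ᵣ c) ≫ δᵣ F'.functor d c =
    δᵣ F.functor d c ≫ (nat.app d ⊵ᵣ c)

instance : Category (DualCat C D) where
  Hom := Hom
  id F := ⟨𝟙 F.functor, by simp⟩
  comp η θ := ⟨η.nat ≫ θ.nat, fun d c => by
    rw [NatTrans.comp_app, NatTrans.comp_app, Category.assoc, θ.comm, reassoc_of% η.comm]
    simp⟩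

@[ext]
theorem hom_ext {F F' : DualCat C D} {η θ : F ⟶ F'} (h : ∀ d, η.nat.app d = θ.nat.app d) : η = θ :=
  Hom.ext (NatTrans.ext (funext h))

@[simp] theorem id_nat (F : DualCat C D) : Hom.nat (𝟙 F) = 𝟙 F.functor := rfl

@[simp] theorem comp_nat {F F' F'' : DualCat C D} (η : F ⟶ F') (θ : F' ⟶ F'') :
    Hom.nat (η ≫ θ) = η.nat ≫ θ.nat := rfl

/-- An isomorphism of module functors from a natural isomorphism of the underlying functors. -/
@[simps]
def mkIso {F F' : DualCat C D} (e : F.functor ≅ F'.functor)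
    (h : ∀ (d : D) (c : C), e.hom.app (d ⊙ᵣ c) ≫ δᵣ F'.functor d c =
      δᵣ F.functor d c ≫ (e.hom.app d ⊵ᵣ c)) : F ≅ F' where
  hom := ⟨e.hom, h⟩
  inv := ⟨e.inv, fun d c => by
    rw [← cancel_epi (e.hom.app (d ⊙ᵣ c)), Iso.hom_inv_id_app_assoc, reassoc_of% h d c]
    rw [← comp_actionHomLeft, Iso.hom_inv_id_app]
    simp⟩

/-- The composite `F ∘ F'` of module functors. -/
abbrev comp (F F' : DualCat C D) : DualCat C D where
  functor := F'.functor ⋙ F.functor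
  isIso_δ d c := by rw [comp_δ]; infer_instance

/-- The identity module functor. -/
abbrev one : DualCat C D where
  functor := 𝟭 D
  isIso_δ d c := by rw [one_δ]; exact IsIso.id _

/-- The tensor product of module functors is their composition. -/
instance : MonoidalCategoryStruct (DualCat C D) where
  tensorObj := comp
  whiskerLeft F _ _ η := ⟨Functor.whiskerRight η.nat F.functor, fun d c => by
    simp only [comp_δ, Functor.whiskerRight_app, Category.assoc]
    rw [← Functor.map_comp_assoc, η.comm, Functor.map_comp_assoc, δᵣ_naturality_left]⟩
  whiskerRight η F := ⟨Functor.whiskerLeft F.functor η.nat, fun d c => by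
    simp only [comp_δ, Functor.whiskerLeft_app, Category.assoc, Functor.comp_obj]
    rw [← η.nat.naturality_assoc, η.comm]⟩
  tensorUnit := one
  associator F F' F'' := mkIso (Functor.associator _ _ _).symm (fun d c => by
    simp [comp_δ])
  leftUnitor F := mkIso (Functor.rightUnitor _) (fun d c => by simp [comp_δ, one_δ])
  rightUnitor F := mkIso (Functor.leftUnitor _) (fun d c => by simp [comp_δ, one_δ])
  tensorHom {F₁ F₂ F₁' F₂'} η θ := ⟨Functor.whiskerRight θ.nat F₁.functor ≫
    Functor.whiskerLeft F₂'.functor η.nat, fun d c => by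
    simp only [comp_δ, Functor.whiskerLeft_app, Functor.whiskerRight_app, Category.assoc,
      Functor.comp_obj, NatTrans.comp_app, comp_actionHomLeft]
    rw [← η.nat.naturality_assoc, η.comm, ← Functor.map_comp_assoc, θ.comm,
      Functor.map_comp_assoc, δᵣ_naturality_left_assoc]⟩

instance : MonoidalCategory (DualCat C D) where
  tensorHom_def η θ := by
    ext d
    exact η.nat.naturality _
  id_tensorHom_id F F' := by
    ext d; simp [MonoidalCategoryStruct.tensorHom, MonoidalCategoryStruct.tensorObj]
  tensorHom_comp_tensorHom η θ η' θ' := by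
    ext d; simp [MonoidalCategoryStruct.tensorHom, MonoidalCategoryStruct.tensorObj]
  whiskerLeft_id F F' := by
    ext d; simp [MonoidalCategoryStruct.whiskerLeft, MonoidalCategoryStruct.tensorObj]
  id_whiskerRight F F' := by
    ext d; simp [MonoidalCategoryStruct.whiskerRight, MonoidalCategoryStruct.tensorObj]
  associator_naturality η θ κ := by
    ext d
    simp [MonoidalCategoryStruct.tensorHom, MonoidalCategoryStruct.tensorObj,
      MonoidalCategoryStruct.associator]
  leftUnitor_naturality η := by
    ext d
    simp [MonoidalCategoryStruct.whiskerLeft, MonoidalCategoryStruct.tensorObj,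
      MonoidalCategoryStruct.leftUnitor, MonoidalCategoryStruct.tensorUnit]
  rightUnitor_naturality η := by
    ext d
    simp [MonoidalCategoryStruct.whiskerRight, MonoidalCategoryStruct.tensorObj,
      MonoidalCategoryStruct.rightUnitor, MonoidalCategoryStruct.tensorUnit]
  pentagon F₁ F₂ F₃ F₄ := by
    ext d
    simp [MonoidalCategoryStruct.whiskerRight, MonoidalCategoryStruct.whiskerLeft,
      MonoidalCategoryStruct.tensorObj, MonoidalCategoryStruct.associator]
  triangle F₁ F₂ := by
    ext d
    simp [MonoidalCategoryStruct.whiskerRight, MonoidalCategoryStruct.whiskerLeft,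
      MonoidalCategoryStruct.tensorObj, MonoidalCategoryStruct.associator,
      MonoidalCategoryStruct.leftUnitor, MonoidalCategoryStruct.rightUnitor,
      MonoidalCategoryStruct.tensorUnit]

end DualCat

end Dual

/-! ## Pointedness -/

section Pointed

/-- An object `X` of a tensor category is invertible if `X ⊗ Y ≅ 1` and `Y ⊗ X ≅ 1` for some
object `Y`. -/
def IsInvertible {C : Type*} [Category* C] [MonoidalCategory C] (X : C) : Prop :=
  ∃ Y : C, Nonempty (X ⊗ Y ≅ 𝟙_ C) ∧ Nonempty (Y ⊗ X ≅ 𝟙_ C)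

/-- A tensor category is pointed if all its simple objects are invertible. -/
def IsPointed (C : Type*) [Category* C] [Limits.HasZeroMorphisms C] [MonoidalCategory C] : Prop :=
  ∀ X : C, Simple X → IsInvertible X

variable {G : Type u} [Group G] [Fintype G] {A : Subgroup G} {ω : ZGroup G 3}

theorem zero_actionHomLeft (m : ModuleDatum A ω) (M N : ModCat m) (V : VectG ω) :
    (0 : M ⟶ N) ⊵ᵣ V = 0 :=
  GrVect.zero_tensorMap (X := RightCosets A) (Y := G) act M N (𝟙 (V : GrVect G))

instance (m : ModuleDatum A ω) : Limits.HasZeroMorphisms (DualCat (VectG ω) (ModCat m)) where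
  zero F F' := ⟨⟨0, fun M V => by simp [zero_actionHomLeft]⟩⟩
  comp_zero η F := DualCat.Hom.ext (Limits.comp_zero (f := η.nat))
  zero_comp F _ _ η := DualCat.Hom.ext (Limits.zero_comp (f := η.nat))

end Pointed

/-! ## The double complex of a group extension -/

/-- Families of functions `f p q : K^p → Map(K × G^q, ℂ*)`, one for each bidegree `(p, q)`. -/
abbrev Bigraded (G K : Type u) : Type u := ∀ p q : ℕ, (Fin p → K) → K → (Fin q → G) → ℂˣ

section Inflation

variable {G : Type u} (K : Type u)

/-- The map `π^*` from functions on `G^n` to functions in bidegree `(0, n)`, constant in the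
variable of `K`. -/
def infl (n : ℕ) : ((Fin n → G) → ℂˣ) →* Bigraded G K where
  toFun f p q := if h : p = 0 ∧ q = n then fun _ _ g => f (fun i => g (Fin.cast h.2.symm i)) else 1
  map_one' := by funext p q; split_ifs <;> rfl
  map_mul' f f' := by
    funext p q
    simp only [Pi.mul_apply]
    split_ifs
    · rfl
    · simp

variable {K}

theorem infl_zero (n : ℕ) (f : (Fin n → G) → ℂˣ) (k : Fin 0 → K) (x : K) (g : Fin n → G) :
    infl K n f 0 n k x g = f g := by
  simp [infl]

theorem infl_of_ne (n : ℕ) (f : (Fin n → G) → ℂˣ) (p q : ℕ) (h : ¬ (p = 0 ∧ q = n)) :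
    infl K n f p q = 1 := by
  simp [infl, h]

end Inflation

section DoubleComplex

variable {G K : Type u} [Group G] [Group K] [MulAction Gᵐᵒᵖ K]

/-- The differential `δ_K` of the complex `C^*(K, C^q(G, Map(K, ℂ*)))`, where `K` acts on
`C^q(G, Map(K, ℂ*))` from the right by `(f ◁ k)(x; g) = f(k x; g)`. -/
def dK (p q : ℕ) : ((Fin p → K) → K → (Fin q → G) → ℂˣ) →*
    ((Fin (p + 1) → K) → K → (Fin q → G) → ℂˣ) where
  toFun f k x g := f (Fin.tail k) x g *
    (∏ j : Fin p, f (Fin.contractNth j.castSucc (· * ·) k) x g ^ ((-1 : ℤ) ^ (j.val + 1))) *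
    f (Fin.init k) (k (Fin.last p) * x) g ^ ((-1 : ℤ) ^ (p + 1))
  map_one' := by ext k x g; simp
  map_mul' f f' := by
    funext k x g
    simp only [Pi.mul_apply, mul_zpow, Finset.prod_mul_distrib]
    ac_rfl

/-- The component in bidegree `(p, q)` of the part of `δ_Tot` that comes from `δ_K`. -/
def dTotK (f : Bigraded G K) : Bigraded G K
  | 0, _ => 1
  | p + 1, q => dK p q (f p q)

/-- The component in bidegree `(p, q)` of the part of `δ_Tot` that comes from `δ_G`. -/
def dTotG (f : Bigraded G K) : Bigraded G K
  | _, 0 => 1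
  | p, q + 1 => fun k => dG q (f p q k) ^ ((-1 : ℤ) ^ p)

/-- The differential `δ_Tot = δ_K ⊕ (δ_G)^((-1)^p)` of the total complex. -/
def dTot : Bigraded G K →* Bigraded G K where
  toFun f := dTotK f * dTotG f
  map_one' := by
    funext p q
    rcases p with _ | p <;> rcases q with _ | q <;> ext k x g <;> simp [dTotK, dTotG, ← Pi.one_def]
  map_mul' f f' := by
    funext p q
    have hK : dTotK (f * f') p q = dTotK f p q * dTotK f' p q := by
      rcases p with _ | p
      · simp [dTotK]
      · exact map_mul (dK p q) _ _
    have hG : dTotG (f * f') p q = dTotG f p q * dTotG f' p q := by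
      rcases q with _ | q
      · simp [dTotG]
      · funext k
        exact (congrArg (· ^ ((-1 : ℤ) ^ p)) (map_mul (dG q) (f p q k) (f' p q k))).trans
          (mul_zpow _ _ _)
    show dTotK (f * f') p q * dTotG (f * f') p q =
      (dTotK f p q * dTotG f p q) * (dTotK f' p q * dTotG f' p q)
    rw [hK, hG, mul_mul_mul_comm]

variable (G K)

/-- The group `Tot^n = ⨁_{p + q = n} C^{p,q}` of normalized cochains of total degree `n`. -/
def Tot (n : ℕ) : Subgroup (Bigraded G K) where
  carrier := {f | (∀ p q, p + q ≠ n → f p q = 1) ∧ (∀ p q k x, IsNormalized (f p q k x)) ∧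
    ∀ p q k, (∃ i, k i = 1) → f p q k = 1}
  one_mem' := ⟨fun _ _ _ => rfl, fun _ _ _ _ _ _ => rfl, fun _ _ _ _ => rfl⟩
  mul_mem' hf hf' := ⟨fun p q h => by simp [hf.1 p q h, hf'.1 p q h],
    fun p q k x g hg => by simp [hf.2.1 p q k x g hg, hf'.2.1 p q k x g hg],
    fun p q k hk => by simp [hf.2.2 p q k hk, hf'.2.2 p q k hk]⟩
  inv_mem' hf := ⟨fun p q h => by simp [hf.1 p q h],
    fun p q k x g hg => by simp [hf.2.1 p q k x g hg],
    fun p q k hk => by simp [hf.2.2 p q k hk]⟩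

/-- The filtration by the degree of the `K`-cochains: `F^i` consists of the families that are
trivial in the bidegrees `(p, q)` with `p < i`. -/
def Fil (i : ℕ) : Subgroup (Bigraded G K) where
  carrier := {f | ∀ p q, p < i → f p q = 1}
  one_mem' _ _ _ := rfl
  mul_mem' hf hf' p q h := by simp [hf p q h, hf' p q h]
  inv_mem' hf p q h := by simp [hf p q h]

/-- The cocycles of total degree `n`. -/
def ZTot (n : ℕ) : Subgroup (Bigraded G K) := Tot G K n ⊓ dTot.ker

/-- The coboundaries of total degree `n`. -/
def BTot : (n : ℕ) → Subgroup (Bigraded G K)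
  | 0 => ⊥
  | n + 1 => (Tot G K n).map dTot

/-- The cohomology `H^n(Tot)`. -/
abbrev HTot (n : ℕ) : Type u := ZTot G K n ⧸ (BTot G K n).subgroupOf (ZTot G K n)

/-- The subgroup `F^p H^n(Tot)` of the classes represented by cocycles in `F^p Tot^n`. -/
def FilH (p n : ℕ) : Subgroup (HTot G K n) :=
  ((Fil G K p).subgroupOf (ZTot G K n)).map (QuotientGroup.mk' _)

/-- The component of bidegree `(p, q)`. -/
def comp (p q : ℕ) : Bigraded G K →* ((Fin p → K) → K → (Fin q → G) → ℂˣ) where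
  toFun f := f p q
  map_one' := rfl
  map_mul' _ _ := rfl

/-- The permanent cycles `Z_∞^{p,q} ⊆ C^{p,q}`: the leading components of the cocycles in
`F^p Tot^{p+q}`. -/
def ZInf (p q : ℕ) : Subgroup ((Fin p → K) → K → (Fin q → G) → ℂˣ) :=
  (ZTot G K (p + q) ⊓ Fil G K p).map (comp G K p q)

/-- The boundaries `B_∞^{p,q} ⊆ C^{p,q}`: the leading components of those cocycles in
`F^p Tot^{p+q}` which are coboundaries in the total complex. -/
def BInf (p q : ℕ) : Subgroup ((Fin p → K) → K → (Fin q → G) → ℂˣ) :=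
  (ZTot G K (p + q) ⊓ BTot G K (p + q) ⊓ Fil G K p).map (comp G K p q)

/-- The entry `E_∞^{p,q}` of the spectral sequence of the total complex, filtered by the degree of
the `K`-cochains. -/
abbrev EInf (p q : ℕ) : Type u := ZInf G K p q ⧸ (BInf G K p q).subgroupOf (ZInf G K p q)

variable {G K}

/-- The class in `E_∞^{p,q}` of the leading component of a cocycle in `F^p Tot^{p+q}`. -/
def leading (p q : ℕ) :
    (Fil G K p).subgroupOf (ZTot G K (p + q)) →* EInf G K p q where
  toFun z := QuotientGroup.mk ⟨z.1.1 p q, z.1.1, ⟨z.1.2, z.2⟩, rfl⟩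
  map_one' := rfl
  map_mul' _ _ := rfl

theorem ker_le_ker_leading (p q : ℕ) :
    ((QuotientGroup.mk' ((BTot G K (p + q)).subgroupOf (ZTot G K (p + q)))).subgroupMap
      ((Fil G K p).subgroupOf (ZTot G K (p + q)))).ker ≤ (leading p q).ker := by
  intro z hz
  have h₁ : (QuotientGroup.mk' ((BTot G K (p + q)).subgroupOf (ZTot G K (p + q)))) z.1 = 1 :=
    congrArg Subtype.val (MonoidHom.mem_ker.1 hz)
  have h₂ : z.1 ∈ (BTot G K (p + q)).subgroupOf (ZTot G K (p + q)) :=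
    (QuotientGroup.eq_one_iff z.1).1 h₁
  refine MonoidHom.mem_ker.2 ((QuotientGroup.eq_one_iff _).2 ?_)
  exact ⟨z.1.1, ⟨⟨z.1.2, h₂⟩, z.2⟩, rfl⟩

/-- The homomorphism `F^p H^{p+q}(Tot) → E_∞^{p,q}` which sends the class of a cocycle in
`F^p Tot^{p+q}` to the class of its leading component. -/
def toEInf (p q : ℕ) : FilH G K p (p + q) →* EInf G K p q :=
  MonoidHom.liftOfSurjective
    ((QuotientGroup.mk' ((BTot G K (p + q)).subgroupOf (ZTot G K (p + q)))).subgroupMap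
      ((Fil G K p).subgroupOf (ZTot G K (p + q))))
    (MonoidHom.subgroupMap_surjective _ _)
    ⟨leading p q, ker_le_ker_leading p q⟩

theorem toEInf_mk (p q : ℕ) (z : (Fil G K p).subgroupOf (ZTot G K (p + q))) :
    toEInf p q ⟨QuotientGroup.mk z.1, z.1, z.2, rfl⟩ = leading p q z :=
  MonoidHom.liftOfRightInverse_comp_apply _ _ _ ⟨leading p q, ker_le_ker_leading p q⟩ z

theorem mem_FilH_zero {n : ℕ} (c : HTot G K n) : c ∈ FilH G K 0 n := by
  induction c using QuotientGroup.induction_on with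
  | H z => exact ⟨z, fun _ _ h => absurd h (Nat.not_lt_zero _), rfl⟩

theorem mem_FilH_succ (p q : ℕ) (c : FilH G K p (p + q)) (hc : toEInf p q c = 1) :
    c.1 ∈ FilH G K (p + 1) (p + q) := by
  obtain ⟨_, z, hz, rfl⟩ := c
  have h₁ : leading p q ⟨z, hz⟩ = 1 := (toEInf_mk p q ⟨z, hz⟩).symm.trans hc
  obtain ⟨b, ⟨⟨hbZ, hbB⟩, hbF⟩, hbz⟩ :
      z.1 p q ∈ BInf G K p q :=
    (QuotientGroup.eq_one_iff (⟨z.1 p q, z.1, ⟨z.2, hz⟩, rfl⟩ : ZInf G K p q)).1 h₁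
  refine ⟨z * (⟨b, hbZ⟩ : ZTot G K (p + q))⁻¹, ?_, ?_⟩
  · intro p' q' hp
    show z.1 p' q' * (b p' q')⁻¹ = 1
    rcases Nat.lt_succ_iff_lt_or_eq.1 hp with hp | rfl
    · rw [show z.1 p' q' = 1 from hz p' q' hp, hbF p' q' hp]; simp
    · by_cases hq : q' = q
      · subst hq
        rw [← hbz]
        exact mul_inv_cancel _
      · have hne : p' + q' ≠ p' + q := fun h => hq (Nat.add_left_cancel h)
        rw [z.2.1.1 p' q' hne, hbZ.1.1 p' q' hne]; simp
  · refine (QuotientGroup.eq).2 ?_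
    show ((z * (⟨b, hbZ⟩ : ZTot G K (p + q))⁻¹)⁻¹ * z).1 ∈ BTot G K (p + q)
    have : (z * (⟨b, hbZ⟩ : ZTot G K (p + q))⁻¹)⁻¹ * z = ⟨b, hbZ⟩ := by
      rw [mul_inv_rev, inv_inv, mul_assoc, inv_mul_cancel, mul_one]
    rw [this]; exact hbB

theorem infl_dGroup (n : ℕ) (f : (Fin n → G) → ℂˣ) :
    infl K (n + 1) (dGroup n f) = dTot (infl K n f) := by
  funext p q
  show infl K (n + 1) (dGroup n f) p q = dTotK (infl K n f) p q * dTotG (infl K n f) p q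
  rcases p with _ | p
  · have h₁ : dTotK (infl K n f) 0 q = 1 := rfl
    rw [h₁, one_mul]
    rcases q with _ | q
    · exact infl_of_ne _ _ _ _ (by simp)
    · by_cases hq : q = n
      · subst hq
        funext k x g
        show _ = (dG q (infl K q f 0 q k) ^ ((-1 : ℤ) ^ 0)) x g
        rw [pow_zero, zpow_one, infl_zero]
        simp only [dGroup, dG, MonoidHom.coe_mk, OneHom.coe_mk, infl_zero]
      · rw [infl_of_ne _ _ _ _ (by omega)]
        funext k
        show 1 = dG q (infl K n f 0 q k) ^ ((-1 : ℤ) ^ 0)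
        rw [infl_of_ne _ _ _ _ (by omega), Pi.one_apply, map_one, one_zpow]
  · rw [infl_of_ne _ _ _ _ (by omega)]
    have h₁ : dTotG (infl K n f) (p + 1) q = 1 := by
      rcases q with _ | q
      · rfl
      · funext k
        show dG q (infl K n f (p + 1) q k) ^ ((-1 : ℤ) ^ (p + 1)) = 1
        rw [infl_of_ne _ _ _ _ (by omega), Pi.one_apply, map_one, one_zpow]
    have h₂ : dTotK (infl K n f) (p + 1) q = 1 := by
      show dK p q (infl K n f p q) = 1
      by_cases h : p = 0 ∧ q = n
      · obtain ⟨rfl, rfl⟩ := h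
        funext k x g
        simp [dK, infl_zero]
      · rw [infl_of_ne _ _ _ _ h, map_one]
    rw [h₁, h₂, one_mul]

theorem infl_mem_Tot (n : ℕ) {f : (Fin n → G) → ℂˣ} (hf : f ∈ CGroup G n) :
    infl K n f ∈ Tot G K n := by
  refine ⟨fun p q h => infl_of_ne _ _ _ _ (by omega), fun p q k x g hg => ?_, fun p q k hk => ?_⟩
  · by_cases h : p = 0 ∧ q = n
    · obtain ⟨rfl, rfl⟩ := h
      rw [infl_zero]; exact hf g hg
    · rw [infl_of_ne _ _ _ _ h]; rfl
  · obtain ⟨i, -⟩ := hk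
    rw [infl_of_ne _ _ _ _ (fun h => by obtain ⟨rfl, -⟩ := h; exact i.elim0)]
    rfl

theorem infl_mem_ZTot (n : ℕ) {f : (Fin n → G) → ℂˣ} (hf : f ∈ ZGroup G n) :
    infl K n f ∈ ZTot G K n :=
  ⟨infl_mem_Tot n hf.1, MonoidHom.mem_ker.2 (by
    rw [← infl_dGroup, MonoidHom.mem_ker.1 hf.2, map_one])⟩

theorem infl_mem_BTot (n : ℕ) {f : (Fin n → G) → ℂˣ} (hf : f ∈ BGroup G n) :
    infl K n f ∈ BTot G K n := by
  rcases n with _ | n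
  · rw [show f = 1 from hf, map_one]; exact one_mem _
  · obtain ⟨b, hb, rfl⟩ := hf
    exact ⟨infl K n b, infl_mem_Tot n hb, (infl_dGroup n b).symm⟩

variable (G K)

/-- The map `π^* : H^n(G, ℂ*) → H^n(Tot)`. -/
def inflH (n : ℕ) : HGroup G n →* HTot G K n :=
  QuotientGroup.map _ _
    (((infl K n).comp (ZGroup G n).subtype).codRestrict (ZTot G K n) fun f => infl_mem_ZTot n f.2)
    fun _ h => infl_mem_BTot n h

/-- The edge map `H^3(G, ℂ*) → E_∞^{0,3}`. -/
def edge₀ : HGroup G 3 →* EInf G K 0 3 :=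
  (toEInf 0 3).comp ((inflH G K 3).codRestrict (FilH G K 0 3) fun _ => mem_FilH_zero _)

/-- The map `ker (H^3(G, ℂ*) → E_∞^{0,3}) → E_∞^{1,2}`. -/
def edge₁ : (edge₀ G K).ker →* EInf G K 1 2 :=
  (toEInf 1 2).comp (((inflH G K 3).comp (edge₀ G K).ker.subtype).codRestrict (FilH G K 1 3)
    fun c => mem_FilH_succ 0 3 _ c.2)

/-- The subgroup `ker (ker (H^3(G, ℂ*) → E_∞^{0,3}) → E_∞^{1,2})` of `H^3(G, ℂ*)`. -/
def Omega : Subgroup (HGroup G 3) := (edge₁ G K).ker.map (edge₀ G K).ker.subtype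

/-- `ω ∈ Z^3(G, ℂ*)` is cohomologous to a cocycle that lives in `C^{2,1} ⊕ C^{3,0}`. -/
def IsCohomologousToLow (ω : ZGroup G 3) : Prop :=
  ∃ c ∈ ZTot G K 3, (∀ p q, (p, q) ≠ (2, 1) → (p, q) ≠ (3, 0) → c p q = 1) ∧
    ∃ b ∈ Tot G K 2, c = infl K 3 ω.1 * dTot b

end DoubleComplex

end PointedDual
end

/-!
The dual category acts on `M(A \ G, μ)`, and its simple objects already move the simple objects
`δ_x` of the module category around enough to compare any two of them.

For points `k`, `l` of `A \ G` the functor `M ↦ ⨁ g, M_{k g}`, with the summand of index `g` placed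
in degree `l g`, is a module functor (`orbitObj`): the quotient of the restrictions of `μ` to the
free orbit of `(k, l)` is a 2-cocycle since both restrictions have coboundary `ω⁻¹`, and it is
trivial since `G` acts freely (`orbitScalar_mul`). This functor represents the component of degree
`l` of `F (δ_k)`, so a monomorphism of module functors is injective on every `F (δ_k)`
(`injective_grApp_of_mono`). Hence a nonzero module functor of least dimension among those
supported on the orbit of `(k, l)` is simple (`simple_of_minimal`), without any appeal to
semisimplicity.

If the dual category is pointed, this functor `F` is an equivalence, so every `F (δ_x)` has only
scalar endomorphisms and is one-dimensional, of some degree `φ x`. The constraint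
`F (δ_x ⊗ δ_g) ≅ F (δ_x) ⊗ δ_g` shows that `φ` is equivariant, and in terms of basis vectors it is
given by scalars `γ x g` whose coboundary is `μ (φ x) / μ x` (`shift_shift`,
`exists_equivariant_of_isInvertible`). As `φ k = l` for arbitrary `k` and `l`, all points of
`A \ G` have the same stabilizer, and `A` is normal.

For normal `A`, let `κ` run through `K = G / A` and take the functor that moves the base point to
`κ`; then `φ` is translation by `κ` and the scalars form a cochain `γ` with
`δ_G γ_κ = μ (κ x) / μ x`. The total coboundary of `(μ, γ⁻¹)` cancels `π^* ω` in bidegree `(0, 3)`,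
is trivial in bidegree `(1, 2)`, and leaves the cocycle `δ_K γ⁻¹` in bidegree `(2, 1)`
(`isCohomologousToLow_of_translation`). That a class has a representative in `C^{2,1} ⊕ C^{3,0}`
precisely when it lies in `Ω(G; A)` holds for the filtration of any complex: the kernel of
`F^p H → E_∞^p` is `F^{p+1} H` (`toEInf_eq_one_iff`).
-/

noncomputable section

open CategoryTheory MonoidalCategory MonoidalRightAction TensorProduct

namespace PointedDual

/-! ### The filtration of the total complex -/

section Filtration

variable {G K : Type u} [Group G] [Group K] [MulAction Gᵐᵒᵖ K]

theorem toEInf_eq_one_iff (p q : ℕ) (c : FilH G K p (p + q)) :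
    toEInf p q c = 1 ↔ c.1 ∈ FilH G K (p + 1) (p + q) := by
  refine ⟨mem_FilH_succ p q c, fun h => ?_⟩
  obtain ⟨c, hc⟩ := c
  obtain ⟨z, hz, rfl⟩ : c ∈ FilH G K (p + 1) (p + q) := h
  have hz' : z ∈ (Fil G K p).subgroupOf (ZTot G K (p + q)) :=
    fun p' q' hp => hz p' q' (Nat.lt_succ_of_lt hp)
  refine (toEInf_mk p q ⟨z, hz'⟩).trans ((QuotientGroup.eq_one_iff _).2 ?_)
  show z.1 p q ∈ BInf G K p q
  have h : z.1 p q = 1 := hz p q (Nat.lt_succ_self p)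
  rw [h]
  exact one_mem _

theorem mem_Omega_iff (c : HGroup G 3) :
    c ∈ Omega G K ↔ inflH G K 3 c ∈ FilH G K 2 3 := by
  constructor
  · rintro ⟨d, hd, rfl⟩
    exact mem_FilH_succ 1 2 _ hd
  · intro h
    have h₁ : inflH G K 3 c ∈ FilH G K 1 3 := by
      obtain ⟨z, hz, hzc⟩ := h
      exact ⟨z, fun p q hp => hz p q (Nat.lt_succ_of_lt hp), hzc⟩
    have h₀ : c ∈ (edge₀ G K).ker :=
      (toEInf_eq_one_iff 0 3 ⟨inflH G K 3 c, mem_FilH_zero _⟩).2 h₁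
    exact ⟨⟨c, h₀⟩, (toEInf_eq_one_iff 1 2 ⟨inflH G K 3 c, h₁⟩).2 h, rfl⟩

theorem isCohomologousToLow_iff (η : ZGroup G 3) :
    IsCohomologousToLow G K η ↔ inflH G K 3 (QuotientGroup.mk η) ∈ FilH G K 2 3 := by
  constructor
  · rintro ⟨c, hc, hlow, b, hb, hcb⟩
    refine ⟨⟨c, hc⟩, fun p q hp => hlow p q (by simp; omega) (by simp; omega), ?_⟩
    refine (QuotientGroup.eq).2 ?_
    show c⁻¹ * infl K 3 η.1 ∈ BTot G K 3
    refine ⟨b⁻¹, inv_mem hb, ?_⟩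
    rw [hcb, map_inv]
    simp [mul_inv_rev, mul_assoc]
  · rintro ⟨z, hz, hzη⟩
    have hzη' : (QuotientGroup.mk z : HTot G K 3) =
        QuotientGroup.mk (⟨infl K 3 η.1, infl_mem_ZTot 3 η.2⟩ : ZTot G K 3) := hzη
    have h := (QuotientGroup.eq).1 hzη'
    obtain ⟨b, hb, hbz⟩ := h
    refine ⟨z.1, z.2, fun p q h₁ h₂ => ?_, b⁻¹, inv_mem hb, ?_⟩
    · by_cases hpq : p + q = 3
      · refine hz p q ?_
        by_contra hp
        have : p = 2 ∧ q = 1 ∨ p = 3 ∧ q = 0 := by omega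
        rcases this with ⟨rfl, rfl⟩ | ⟨rfl, rfl⟩
        · exact h₁ rfl
        · exact h₂ rfl
      · exact z.2.1.1 p q hpq
    · rw [map_inv, hbz]
      show z.1 = infl K 3 η.1 * (z.1⁻¹ * infl K 3 η.1)⁻¹
      simp [mul_inv_rev]

theorem isCohomologousToLow_iff_mem_Omega (η : ZGroup G 3) :
    IsCohomologousToLow G K η ↔ QuotientGroup.mk η ∈ Omega G K :=
  (isCohomologousToLow_iff η).trans (mem_Omega_iff _).symm

end Filtration

/-! ### The cocycle in bidegree `(2, 1)` -/

section Descent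

variable {G K : Type u} [Group G] [Group K] [MulAction Gᵐᵒᵖ K]

/-- The cochain of total degree 2 with components `μ` in bidegree `(0, 2)` and `γ⁻¹` in bidegree
`(1, 1)`. -/
def lowCochain (μ : K → (Fin 2 → G) → ℂˣ) (γ : K → K → G → ℂˣ) : Bigraded G K
  | 0, 2 => fun _ => μ
  | 1, 1 => fun k x g => (γ (k 0) x (g 0))⁻¹
  | _, _ => 1

theorem lowCochain_of_ne (μ : K → (Fin 2 → G) → ℂˣ) (γ : K → K → G → ℂˣ) (p q : ℕ)
    (h₁ : (p, q) ≠ (0, 2)) (h₂ : (p, q) ≠ (1, 1)) : lowCochain μ γ p q = 1 := by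
  unfold lowCochain
  split
  · exact absurd rfl h₁
  · exact absurd rfl h₂
  · rfl

theorem dTot_succ_succ (f : Bigraded G K) (p q : ℕ) :
    dTot f (p + 1) (q + 1) =
      dK p (q + 1) (f p (q + 1)) * fun k => dG q (f (p + 1) q k) ^ ((-1 : ℤ) ^ (p + 1)) := rfl

theorem dTot_zero_succ (f : Bigraded G K) (q : ℕ) :
    dTot f 0 (q + 1) = fun k => dG q (f 0 q k) := by
  show (1 * fun k => dG q (f 0 q k) ^ ((-1 : ℤ) ^ 0) : (Fin 0 → K) → K → (Fin (q + 1) → G) → ℂˣ) = _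
  simp

theorem dTot_succ_zero (f : Bigraded G K) (p : ℕ) :
    dTot f (p + 1) 0 = dK p 0 (f p 0) := by
  show dK p 0 (f p 0) * 1 = _
  simp

theorem dTot_zero_zero (f : Bigraded G K) : dTot f 0 0 = 1 := by
  show (1 * 1 : (Fin 0 → K) → K → (Fin 0 → G) → ℂˣ) = 1
  simp

theorem dK_zero_apply (q : ℕ) (f : (Fin 0 → K) → K → (Fin q → G) → ℂˣ) (k : Fin 1 → K) (x : K)
    (g : Fin q → G) :
    dK 0 q f k x g = f Fin.elim0 x g * (f Fin.elim0 (k 0 * x) g)⁻¹ := by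
  have h₁ : Fin.tail k = Fin.elim0 := Subsingleton.elim _ _
  have h₂ : Fin.init k = Fin.elim0 := Subsingleton.elim _ _
  simp [dK, h₁, h₂]

theorem dK_one_apply (q : ℕ) (f : (Fin 1 → K) → K → (Fin q → G) → ℂˣ) (k : Fin 2 → K) (x : K)
    (g : Fin q → G) :
    dK 1 q f k x g = f ![k 1] x g * (f ![k 0 * k 1] x g)⁻¹ * f ![k 0] (k 1 * x) g := by
  have h₁ : Fin.tail k = ![k 1] := by ext i; fin_cases i; rfl
  have h₂ : Fin.init k = ![k 0] := by ext i; fin_cases i; rfl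
  have h₃ : Fin.contractNth (Fin.castSucc 0) (· * ·) k = ![k 0 * k 1] := by
    ext i; fin_cases i; rfl
  simp only [dK, MonoidHom.coe_mk, OneHom.coe_mk, Fin.prod_univ_one, h₁, h₂, h₃]
  norm_num
  rfl

theorem dK_two_apply (q : ℕ) (f : (Fin 2 → K) → K → (Fin q → G) → ℂˣ) (k : Fin 3 → K) (x : K)
    (g : Fin q → G) :
    dK 2 q f k x g = f ![k 1, k 2] x g * (f ![k 0 * k 1, k 2] x g)⁻¹ *
      f ![k 0, k 1 * k 2] x g * (f ![k 0, k 1] (k 2 * x) g)⁻¹ := by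
  have h₁ : Fin.tail k = ![k 1, k 2] := by ext i; fin_cases i <;> rfl
  have h₂ : Fin.init k = ![k 0, k 1] := by ext i; fin_cases i <;> rfl
  have h₃ : Fin.contractNth (Fin.castSucc 0) (· * ·) k = ![k 0 * k 1, k 2] := by
    ext i; fin_cases i <;> rfl
  have h₄ : Fin.contractNth (Fin.castSucc 1) (· * ·) k = ![k 0, k 1 * k 2] := by
    ext i; fin_cases i <;> rfl
  simp only [dK, MonoidHom.coe_mk, OneHom.coe_mk, Fin.prod_univ_two, h₁, h₂, h₃, h₄]
  norm_num
  rw [show k (Fin.last 2) = k 2 from rfl]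
  simp only [mul_assoc]

theorem dG_one_apply (f : K → (Fin 1 → G) → ℂˣ) (x : K) (g : Fin 2 → G) :
    dG 1 f x g = f (MulOpposite.op (g 0) • x) ![g 1] * (f x ![g 0 * g 1])⁻¹ * f x ![g 0] := by
  have h₁ : Fin.tail g = ![g 1] := by ext i; fin_cases i; rfl
  have h₂ : Fin.init g = ![g 0] := by ext i; fin_cases i; rfl
  have h₃ : Fin.contractNth (Fin.castSucc 0) (· * ·) g = ![g 0 * g 1] := by
    ext i; fin_cases i; rfl
  simp only [dG, MonoidHom.coe_mk, OneHom.coe_mk, Fin.prod_univ_one, h₁, h₂, h₃]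
  norm_num

/-- If translation by each `κ` carries `μ` to itself up to the coboundary of `γ κ`, then `π^* ω`
becomes, modulo the coboundary of `(μ, γ⁻¹)`, the cocycle `δ_K γ⁻¹` in bidegree `(2, 1)`. -/
theorem isCohomologousToLow_of_translation (ω : ZGroup G 3)
    (hK : ∀ (κ x : K) (g : G), MulOpposite.op g • (κ * x) = κ * MulOpposite.op g • x)
    (μ : K → (Fin 2 → G) → ℂˣ) (hμ : ∀ x, IsNormalized (μ x))
    (hδ : dG 2 μ⁻¹ = fun _ g => ω.1 g) (γ : K → K → G → ℂˣ) (hγ₁ : ∀ x g, γ 1 x g = 1)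
    (hγ : ∀ κ x g h, γ κ x (g * h) * μ (κ * x) ![g, h] =
      μ x ![g, h] * γ κ (MulOpposite.op g • x) h * γ κ x g) :
    IsCohomologousToLow G K ω := by
  -- `γ` is normalized in the variable of `G` because `μ` is
  have hγn : ∀ κ x, γ κ x 1 = 1 := by
    intro κ x
    have h := hγ κ x 1 1
    rw [hμ _ _ ⟨0, rfl⟩, hμ _ _ ⟨0, rfl⟩] at h
    simpa using h
  set b := lowCochain μ γ with hb
  have hbTot : b ∈ Tot G K 2 := by
    refine ⟨fun p q h => lowCochain_of_ne _ _ _ _ (by simp; omega) (by simp; omega),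
      fun p q k x g hg => ?_, fun p q k hk => ?_⟩
    · by_cases h₁ : (p, q) = (0, 2)
      · obtain ⟨rfl, rfl⟩ := Prod.mk.inj h₁
        exact hμ x g hg
      by_cases h₂ : (p, q) = (1, 1)
      · obtain ⟨rfl, rfl⟩ := Prod.mk.inj h₂
        obtain ⟨i, hi⟩ := hg
        obtain rfl := Subsingleton.elim i 0
        show (γ (k 0) x (g 0))⁻¹ = 1
        rw [hi, hγn, inv_one]
      rw [hb, lowCochain_of_ne _ _ _ _ h₁ h₂]; rfl
    · by_cases h₁ : (p, q) = (0, 2)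
      · obtain ⟨rfl, rfl⟩ := Prod.mk.inj h₁
        exact hk.choose.elim0
      by_cases h₂ : (p, q) = (1, 1)
      · obtain ⟨rfl, rfl⟩ := Prod.mk.inj h₂
        obtain ⟨i, hi⟩ := hk
        obtain rfl := Subsingleton.elim i 0
        funext x g
        show (γ (k 0) x (g 0))⁻¹ = 1
        rw [hi, hγ₁, inv_one]
      rw [hb, lowCochain_of_ne _ _ _ _ h₁ h₂]; rfl
  set c := infl K 3 ω.1 * dTot b
  have hlow : ∀ p q, (p, q) ≠ (2, 1) → c p q = 1 := by
    intro p q h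
    show infl K 3 ω.1 p q * dTot b p q = 1
    rcases p with _ | p
    · rcases q with _ | q
      · rw [dTot_zero_zero, infl_of_ne _ _ _ _ (by simp), one_mul]
      · rw [dTot_zero_succ]
        by_cases hq : q = 2
        · subst hq
          funext k x g
          show infl K 3 ω.1 0 3 k x g * dG 2 μ x g = 1
          rw [infl_zero, ← congrFun (congrFun hδ x) g, map_inv]
          exact inv_mul_cancel _
        · rw [infl_of_ne _ _ _ _ (by omega), hb,
            lowCochain_of_ne _ _ _ _ (by simpa using hq) (by simp), one_mul]
          funext k
          exact map_one _
    · rw [infl_of_ne _ _ _ _ (by simp), one_mul]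
      rcases q with _ | q
      · rw [dTot_succ_zero, hb, lowCochain_of_ne _ _ _ _ (by simp) (by simp), map_one]
      · rw [dTot_succ_succ]
        by_cases h₁ : p = 0 ∧ q = 1
        · obtain ⟨rfl, rfl⟩ := h₁
          funext k x g
          have hg : g = ![g 0, g 1] := by ext i; fin_cases i <;> rfl
          have e₁ : dK 0 2 (b 0 2) k x g = μ x g * (μ (k 0 * x) g)⁻¹ := dK_zero_apply _ _ _ _ _
          have e₂ : dG 1 (b 1 1 k) x g = (γ (k 0) (MulOpposite.op (g 0) • x) (g 1))⁻¹ *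
              ((γ (k 0) x (g 0 * g 1))⁻¹)⁻¹ * (γ (k 0) x (g 0))⁻¹ := dG_one_apply _ _ _
          show dK 0 2 (b 0 2) k x g * (dG 1 (b 1 1 k) x g) ^ ((-1 : ℤ) ^ (0 + 1)) = 1
          rw [e₁, e₂]
          have h := hγ (k 0) x (g 0) (g 1)
          rw [← hg] at h
          have aux : ∀ m m' a d e : ℂˣ, e * m' = m * a * d →
              m * m'⁻¹ * (a⁻¹ * (e⁻¹)⁻¹ * d⁻¹) ^ ((-1 : ℤ) ^ (0 + 1)) = 1 := by
            intro m m' a d e h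
            obtain rfl : e = m * a * d * m'⁻¹ := by rw [← h, mul_inv_cancel_right]
            rw [zero_add, pow_one, zpow_neg_one, mul_inv_eq_one]
            rw [inv_inv, show a⁻¹ * (m * a * d * m'⁻¹) * d⁻¹ =
              (a⁻¹ * a) * (d * d⁻¹) * (m * m'⁻¹) by ac_rfl]
            simp
          exact aux _ _ _ _ _ h
        · -- the bidegree `(2, 1)` is the case `p = 1`, `q = 0` here
          have h₂ : ¬ (p = 1 ∧ q = 0) := fun ⟨h₂, h₃⟩ => h (by rw [h₂, h₃])
          rw [hb, lowCochain_of_ne _ _ p (q + 1) (by simp; omega) (by simp; omega),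
            lowCochain_of_ne _ _ (p + 1) q (by simp) (by simp; omega), map_one, one_mul]
          funext k
          show dG q (1 : K → (Fin q → G) → ℂˣ) ^ _ = 1
          rw [map_one, one_zpow]
  have h₂₁ : ∀ k x g, c 2 1 k x g = (γ (k 1) x (g 0))⁻¹ *
      ((γ (k 0 * k 1) x (g 0))⁻¹)⁻¹ * (γ (k 0) (k 1 * x) (g 0))⁻¹ := by
    intro k x g
    have e : c 2 1 = dK 1 1 (b 1 1) := by
      show infl K 3 ω.1 2 1 * dTot b 2 1 = _
      rw [infl_of_ne _ _ _ _ (by simp), one_mul, dTot_succ_succ, hb,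
        lowCochain_of_ne _ _ (1 + 1) 0 (by simp) (by simp)]
      have : (fun k : Fin (1 + 1) → K => dG 0 ((1 : (Fin (1 + 1) → K) → K → (Fin 0 → G) → ℂˣ) k) ^
          ((-1 : ℤ) ^ (1 + 1))) = 1 := by
        funext k
        show dG 0 (1 : K → (Fin 0 → G) → ℂˣ) ^ _ = 1
        rw [map_one, one_zpow]
      rw [this, mul_one]
    rw [e]
    exact dK_one_apply _ _ _ _ _
  have hcTot : c ∈ Tot G K 3 := by
    refine ⟨fun p q h => hlow p q (by simp; omega), fun p q k x g hg => ?_, fun p q k hk => ?_⟩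
    · by_cases h : (p, q) = (2, 1)
      · obtain ⟨rfl, rfl⟩ := Prod.mk.inj h
        obtain ⟨i, hi⟩ := hg
        obtain rfl := Subsingleton.elim i 0
        simp [h₂₁, hi, hγn]
      · rw [hlow p q h]; rfl
    · by_cases h : (p, q) = (2, 1)
      · obtain ⟨rfl, rfl⟩ := Prod.mk.inj h
        funext x g
        obtain ⟨i, hi⟩ := hk
        rw [h₂₁]
        fin_cases i
        · simp_all
        · simp_all
      · rw [hlow p q h]; rfl
  have hker : dTot c = 1 := by
    funext p q
    rcases p with _ | p
    · rcases q with _ | q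
      · exact dTot_zero_zero c
      · rw [dTot_zero_succ, hlow 0 q (by simp)]
        funext k; exact map_one _
    · rcases q with _ | q
      · rw [dTot_succ_zero, hlow p 0 (by simp), map_one]; rfl
      · rw [dTot_succ_succ]
        have e₁ : dK p (q + 1) (c p (q + 1)) = 1 := by
          by_cases h : p = 2 ∧ q = 0
          · obtain ⟨rfl, rfl⟩ := h
            funext k x g
            refine (dK_two_apply _ _ _ _ _).trans ?_
            simp only [h₂₁]
            apply Additive.ofMul.injective
            simp only [ofMul_mul, ofMul_inv, mul_assoc, Matrix.cons_val_zero, Matrix.cons_val_one,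
              Pi.one_apply, ofMul_one]
            abel
          · rw [hlow p (q + 1) (by simp; omega), map_one]
        have e₂ : ∀ k, dG q (c (p + 1) q k) = 1 := by
          intro k
          by_cases h : p = 1 ∧ q = 1
          · obtain ⟨rfl, rfl⟩ := h
            funext x g
            refine (dG_one_apply _ _ _).trans ?_
            simp only [h₂₁]
            -- `δ_G γ⁻¹` is a `δ_K`-coboundary, so the values of `μ` in these three relations cancel
            have a₁ := hγ (k 1) x (g 0) (g 1)
            have a₂ := hγ (k 0 * k 1) x (g 0) (g 1)
            have a₃ := hγ (k 0) (k 1 * x) (g 0) (g 1)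
            rw [hK] at a₃
            rw [mul_assoc (k 0)] at a₂
            simp only [Pi.one_apply, Matrix.cons_val_zero] at a₁ a₂ a₃ ⊢
            apply_fun Additive.ofMul at a₁ a₂ a₃
            apply Additive.ofMul.injective
            simp only [ofMul_mul, ofMul_inv, ofMul_one] at a₁ a₂ a₃ ⊢
            rw [← sub_eq_zero] at a₁ a₂ a₃
            have a₄ := congrArg₂ (· + ·) (congrArg₂ (· - ·) a₁ a₂) a₃
            simp only [sub_zero, add_zero] at a₄
            rw [← a₄]
            abel
          · rw [hlow (p + 1) q (by simp; omega)]
            exact map_one _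
        rw [e₁, one_mul]
        funext k
        show dG q (c (p + 1) q k) ^ _ = 1
        rw [e₂, one_zpow]
  exact ⟨c, ⟨hcTot, MonoidHom.mem_ker.2 hker⟩, fun p q h _ => hlow p q h, b, hbTot, rfl⟩

end Descent

/-! ### Right cosets and normality -/

section Cosets

variable {G : Type u} [Group G] {A : Subgroup G}

/-- The coset `A g`. -/
def rightCoset (A : Subgroup G) (g : G) : RightCosets A := Quotient.mk (QuotientGroup.rightRel A) g

theorem op_smul_rightCoset (g h : G) :
    MulOpposite.op h • rightCoset A g = rightCoset A (g * h) := rfl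

theorem rightCoset_eq_iff {g h : G} : rightCoset A g = rightCoset A h ↔ h * g⁻¹ ∈ A :=
  Quotient.eq.trans QuotientGroup.rightRel_apply

/-- If every point of `A \ G` is the image of the base point under an equivariant map, then `A` is
normal: the stabilizer `A` of the base point fixes all points. -/
theorem normal_of_equivariant
    (h : ∀ l : RightCosets A, ∃ φ : RightCosets A → RightCosets A, φ (rightCoset A 1) = l ∧
      ∀ x (g : G), φ (MulOpposite.op g • x) = MulOpposite.op g • φ x) : A.Normal := by
  refine ⟨fun a ha g => ?_⟩
  obtain ⟨φ, hφ, hφG⟩ := h (rightCoset A g)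
  have h₁ := hφG (rightCoset A 1) a
  have h₂ : rightCoset A (1 * a) = rightCoset A 1 := by
    rw [rightCoset_eq_iff]; simpa using inv_mem ha
  rw [hφ, op_smul_rightCoset, op_smul_rightCoset, h₂, hφ] at h₁
  exact rightCoset_eq_iff.1 h₁

/-- For normal `A`, the identification `G / A ≅ A \ G`, `g A ↦ A g`. -/
def toRightCosets [A.Normal] : G ⧸ A → RightCosets A :=
  Quotient.map' id fun x y h => by
    have h' := QuotientGroup.leftRel_apply.1 h
    refine QuotientGroup.rightRel_apply.2 ?_
    exact (Subgroup.Normal.mem_comm_iff inferInstance).1 h'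

theorem toRightCosets_smul [A.Normal] (x : G ⧸ A) (g : G) :
    toRightCosets (MulOpposite.op g • x) = MulOpposite.op g • toRightCosets x := by
  induction x using QuotientGroup.induction_on with
  | H x => rfl

theorem op_smul_mul [A.Normal] (κ x : G ⧸ A) (g : G) :
    MulOpposite.op g • (κ * x) = κ * MulOpposite.op g • x := by
  induction x using QuotientGroup.induction_on with
  | H x =>
    induction κ using QuotientGroup.induction_on with
    | H k => exact congrArg (QuotientGroup.mk) (mul_assoc k x g)

variable {ω : ZGroup G 3}

/-- The cocycle `ω` descends to `C^{2,1} ⊕ C^{3,0}` as soon as all points of `A \ G` are related by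
equivariant maps that preserve `μ` up to a coboundary. -/
theorem isCohomologousToLow_of_equivariant (m : ModuleDatum A ω) [A.Normal]
    (h : ∀ l : RightCosets A, ∃ (φ : RightCosets A → RightCosets A) (γ : RightCosets A → G → ℂˣ),
      φ (rightCoset A 1) = l ∧ (∀ x (g : G), φ (MulOpposite.op g • x) = MulOpposite.op g • φ x) ∧
      ∀ x g h, γ x (g * h) * m.μ (φ x) ![g, h] =
        m.μ x ![g, h] * γ (MulOpposite.op g • x) h * γ x g) :
    IsCohomologousToLow G (G ⧸ A) ω := by
  classical
  choose φ γ hφ hφG hγ using h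
  have key : ∀ κ x : G ⧸ A, φ (toRightCosets κ) (toRightCosets x) = toRightCosets (κ * x) := by
    intro κ x
    induction x using QuotientGroup.induction_on with
    | H x =>
      induction κ using QuotientGroup.induction_on with
      | H k =>
        have h₁ := hφG (rightCoset A k) (rightCoset A 1) x
        rw [op_smul_rightCoset, one_mul, hφ] at h₁
        exact h₁
  -- for `κ = 1` the trivial scalars are chosen, so that the cochain is normalized
  refine isCohomologousToLow_of_translation ω op_smul_mul (fun x => m.μ (toRightCosets x))
    (fun x => m.normalized _) ?_
    (fun κ x g => if κ = 1 then 1 else γ (toRightCosets κ) (toRightCosets x) g) (by simp) ?_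
  · funext x g
    refine Eq.trans ?_ (congrFun (congrFun m.δ_inv (toRightCosets x)) g)
    simp only [dG, MonoidHom.coe_mk, OneHom.coe_mk, Pi.inv_apply, toRightCosets_smul]
  · intro κ x g h
    by_cases hκ : κ = 1
    · simp [hκ]
    · simp only [if_neg hκ]
      rw [← key, toRightCosets_smul]
      exact hγ _ _ _ _

end Cosets

/-! ### Module functors supported on one orbit -/

namespace GrVect

section OrbitSpace

variable {G X : Type u} [Fintype G] [Fintype X]

/-- The space `⨁ g, M_{a g}`, realized inside a power of `M` indexed by `Fin (card G)` because the
underlying spaces of `GrVect` live in `Type`. -/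
def orbitCarrier (a : G → X) (M : GrVect X) :
    Submodule ℂ (Fin (Fintype.card G) → M.carrier) where
  carrier := {f | ∀ g, M.proj (a g) (f (Fintype.equivFin G g)) = f (Fintype.equivFin G g)}
  add_mem' hf hf' g := by simp [hf g, hf' g]
  zero_mem' g := by simp
  smul_mem' r f hf g := by simp [hf g]

/-- The projection of `⨁ g, M_{a g}` to the summand with index `g`, viewed in `M`. -/
def orbitπ (a : G → X) (M : GrVect X) (g : G) : orbitCarrier a M →ₗ[ℂ] M.carrier :=
  LinearMap.proj (Fintype.equivFin G g) ∘ₗ (orbitCarrier a M).subtype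

open Classical in
/-- The projection of `M` to `M_{a g}`, followed by the inclusion of this summand with index `g`. -/
def orbitι (a : G → X) (M : GrVect X) (g : G) : M.carrier →ₗ[ℂ] orbitCarrier a M :=
  (LinearMap.single ℂ (fun _ => M.carrier) (Fintype.equivFin G g) ∘ₗ M.proj (a g)).codRestrict
    (orbitCarrier a M) fun v h => by
      by_cases hgh : g = h
      · subst hgh; simp [M.proj_self]
      · have : Fintype.equivFin G h ≠ Fintype.equivFin G g :=
          fun e => hgh ((Fintype.equivFin G).injective e).symm
        simp [Pi.single_eq_of_ne this]

variable (a b : G → X) (M : GrVect X)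

theorem orbitπ_orbitι_self (g : G) (v : M.carrier) :
    orbitπ a M g (orbitι a M g v) = M.proj (a g) v := by
  show (Pi.single (Fintype.equivFin G g) (M.proj (a g) v) : Fin (Fintype.card G) → M.carrier)
    (Fintype.equivFin G g) = _
  simp

theorem orbitπ_orbitι_ne {g h : G} (hgh : g ≠ h) (v : M.carrier) :
    orbitπ a M h (orbitι a M g v) = 0 := by
  have : Fintype.equivFin G h ≠ Fintype.equivFin G g :=
    fun e => hgh ((Fintype.equivFin G).injective e).symm
  show (Pi.single (Fintype.equivFin G g) (M.proj (a g) v) : Fin (Fintype.card G) → M.carrier)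
    (Fintype.equivFin G h) = 0
  simp [Pi.single_eq_of_ne this]

theorem proj_orbitπ (g : G) (f : orbitCarrier a M) :
    M.proj (a g) (orbitπ a M g f) = orbitπ a M g f := f.2 g

theorem orbit_ext {f f' : orbitCarrier a M} (h : ∀ g, orbitπ a M g f = orbitπ a M g f') :
    f = f' := by
  refine Subtype.ext (funext fun i => ?_)
  obtain ⟨g, rfl⟩ := (Fintype.equivFin G).surjective i
  exact h g

theorem sum_orbitι_orbitπ (f : orbitCarrier a M) : ∑ g, orbitι a M g (orbitπ a M g f) = f := by
  refine orbit_ext a M fun h => ?_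
  rw [map_sum, Finset.sum_eq_single h]
  · rw [orbitπ_orbitι_self, proj_orbitπ]
  · intro g _ hg
    exact orbitπ_orbitι_ne a M hg _
  · simp

theorem orbitι_of_ne {x : X} {v : M.carrier} (hv : M.IsHomog x v) {g : G} (h : x ≠ a g) :
    orbitι a M g v = 0 := by
  refine orbit_ext a M fun g' => ?_
  by_cases hg : g = g'
  · subst hg
    rw [orbitπ_orbitι_self, hv.proj_eq, if_neg h, map_zero]
  · rw [orbitπ_orbitι_ne a M hg, map_zero]

theorem orbit_lin_ext {N : Type*} [AddCommGroup N] [Module ℂ N]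
    {f f' : orbitCarrier a M →ₗ[ℂ] N}
    (h : ∀ g v, M.IsHomog (a g) v → f (orbitι a M g v) = f' (orbitι a M g v)) : f = f' := by
  ext v
  rw [← sum_orbitι_orbitπ a M v, map_sum, map_sum]
  exact Finset.sum_congr rfl fun g _ => h g _ (proj_orbitπ a M g v)

open Classical in
/-- The projection of `⨁ g, M_{a g}` to the sum of the summands with `b g = y`. -/
def orbitProj (y : X) : orbitCarrier a M →ₗ[ℂ] orbitCarrier a M :=
  ∑ g, if b g = y then orbitι a M g ∘ₗ orbitπ a M g else 0

open Classical in
theorem orbitProj_orbitι (y : X) (g : G) {v : M.carrier} (hv : M.IsHomog (a g) v) :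
    orbitProj a b M y (orbitι a M g v) = if b g = y then orbitι a M g v else 0 := by
  unfold orbitProj
  rw [LinearMap.sum_apply, Finset.sum_eq_single g]
  · split_ifs
    · rw [LinearMap.comp_apply, orbitπ_orbitι_self, hv]
    · rfl
  · intro h _ hh
    split_ifs
    · rw [LinearMap.comp_apply, orbitπ_orbitι_ne a M hh.symm, map_zero]
    · rfl
  · simp

/-- The graded space `⨁ g, M_{a g}` in which the summand with index `g` has degree `b g`. -/
abbrev orbitSpace : GrVect X where
  carrier := orbitCarrier a M
  proj := orbitProj a b M
  proj_self y f := by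
    classical
    have : orbitProj a b M y ∘ₗ orbitProj a b M y = orbitProj a b M y :=
      orbit_lin_ext a M fun g v hv => by
        rw [LinearMap.comp_apply, orbitProj_orbitι a b M y g hv]
        split_ifs with h
        · rw [orbitProj_orbitι a b M y g hv, if_pos h]
        · rw [map_zero]
    exact LinearMap.congr_fun this f
  proj_ne y z hyz f := by
    classical
    have : orbitProj a b M y ∘ₗ orbitProj a b M z = 0 :=
      orbit_lin_ext a M fun g v hv => by
        rw [LinearMap.comp_apply, orbitProj_orbitι a b M z g hv]
        split_ifs with h
        · rw [orbitProj_orbitι a b M y g hv, if_neg (by rw [h]; exact hyz.symm)]; rfl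
        · rw [map_zero]; rfl
    exact LinearMap.congr_fun this f
  sum_proj f := by
    classical
    have : ∑ y, orbitProj a b M y = LinearMap.id :=
      orbit_lin_ext a M fun g v hv => by
        simp only [LinearMap.sum_apply, orbitProj_orbitι a b M _ g hv]
        simp
    simpa using LinearMap.congr_fun this f

theorem isHomog_orbitι (g : G) {v : M.carrier} (hv : M.IsHomog (a g) v) :
    (orbitSpace a b M).IsHomog (b g) (orbitι a M g v) := by
  classical
  exact (orbitProj_orbitι a b M _ g hv).trans (if_pos rfl)

/-- To check that a linear map on `⨁ g, M_{a g}` has degree zero it is enough to look at the degrees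
of the images of the summands. -/
theorem orbit_comm {N : GrVect X} (f : orbitCarrier a M →ₗ[ℂ] N.carrier)
    (h : ∀ g v, M.IsHomog (a g) v → N.IsHomog (b g) (f (orbitι a M g v))) (y : X)
    (t : orbitCarrier a M) : f (orbitProj a b M y t) = N.proj y (f t) := by
  classical
  have : f ∘ₗ orbitProj a b M y = N.proj y ∘ₗ f := orbit_lin_ext a M fun g v hv => by
    rw [LinearMap.comp_apply, LinearMap.comp_apply, orbitProj_orbitι a b M y g hv,
      (h g v hv).proj_eq]
    split_ifs <;> simp
  exact LinearMap.congr_fun this t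

variable {M} in
/-- The functoriality of `⨁ g, M_{a g}` in `M`. -/
def orbitMap {N : GrVect X} (f : M ⟶ N) : orbitSpace a b M ⟶ orbitSpace a b N where
  lin := ∑ g, orbitι a N g ∘ₗ f.lin ∘ₗ orbitπ a M g
  comm := orbit_comm a b M _ fun g v hv => by
    have : (∑ g, orbitι a N g ∘ₗ f.lin ∘ₗ orbitπ a M g) (orbitι a M g v) =
        orbitι a N g (f.lin v) := by
      rw [LinearMap.sum_apply, Finset.sum_eq_single g]
      · simp only [LinearMap.comp_apply, orbitπ_orbitι_self]; rw [hv]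
      · intro h _ hh
        simp only [LinearMap.comp_apply, orbitπ_orbitι_ne a M hh.symm, map_zero]
      · simp
    rw [this]
    exact isHomog_orbitι a b N g (hv.map f)

variable {M} in
theorem orbitMap_orbitι {N : GrVect X} (f : M ⟶ N) (g : G) (v : M.carrier) :
    (orbitMap a b f).lin (orbitι a M g v) = orbitι a N g (f.lin v) := by
  show (∑ g, orbitι a N g ∘ₗ f.lin ∘ₗ orbitπ a M g) (orbitι a M g v) = _
  rw [LinearMap.sum_apply, Finset.sum_eq_single g]
  · simp only [LinearMap.comp_apply, orbitπ_orbitι_self, f.comm]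
    refine orbit_ext a N fun h => ?_
    by_cases hgh : g = h
    · subst hgh; rw [orbitπ_orbitι_self, orbitπ_orbitι_self, N.proj_self]
    · rw [orbitπ_orbitι_ne a N hgh, orbitπ_orbitι_ne a N hgh]
  · intro h _ hh
    simp only [LinearMap.comp_apply, orbitπ_orbitι_ne a M hh.symm, map_zero]
  · simp

theorem orbit_hom_ext {N : GrVect X} {f f' : orbitSpace a b M ⟶ N}
    (h : ∀ g v, M.IsHomog (a g) v → f.lin (orbitι a M g v) = f'.lin (orbitι a M g v)) :
    f = f' :=
  Hom.ext (orbit_lin_ext a M h)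

end OrbitSpace

section OrbitLineator

variable {G X : Type u} [Fintype G] [Fintype X] [Group G] {r : X → G → X}
  (a b : G → X) (s : G → G → ℂˣ) (M : GrVect X) (V W : GrVect G)

/-- Linear maps on `⨁ g, (M ⊗ V)_{a g}` agree if they agree on the tensors `m ⊗ v` in the summands
with index `g * h`, where `m` has degree `a g` and `v` has degree `h`. -/
theorem orbit_tensor_lin_ext (ha : ∀ g h, a (g * h) = r (a g) h)
    (hr : ∀ x y g, r x g = r y g → x = y) {N : Type*} [AddCommGroup N] [Module ℂ N]
    {f f' : orbitCarrier a (tensor r M V) →ₗ[ℂ] N}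
    (H : ∀ g v, M.IsHomog (a g) v → ∀ h w, V.IsHomog h w →
      f (orbitι a (tensor r M V) (g * h) (v ⊗ₜ[ℂ] w)) =
        f' (orbitι a (tensor r M V) (g * h) (v ⊗ₜ[ℂ] w))) : f = f' := by
  refine orbit_lin_ext a _ fun c t _ => ?_
  refine LinearMap.congr_fun (f := f ∘ₗ orbitι a (tensor r M V) c)
    (g := f' ∘ₗ orbitι a (tensor r M V) c) (tensor_lin_ext fun x v hv h w hw => ?_) t
  by_cases hc : r x h = a c
  · have hx : x = a (c * h⁻¹) := hr x _ h (by rw [hc, ← ha, inv_mul_cancel_right])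
    subst hx
    have := H _ v hv h w hw
    rwa [inv_mul_cancel_right] at this
  · have : orbitι a (tensor r M V) c (v ⊗ₜ[ℂ] w) = 0 :=
      orbitι_of_ne a (tensor r M V) (hv.tmul r hw) hc
    rw [LinearMap.comp_apply, LinearMap.comp_apply, this, map_zero, map_zero]

theorem orbit_tensor_lin_ext₃ (ha : ∀ g h, a (g * h) = r (a g) h)
    (hr : ∀ x y g, r x g = r y g → x = y) {N : Type*} [AddCommGroup N] [Module ℂ N]
    {f f' : orbitCarrier a (tensor r M (tensor (· * ·) V W)) →ₗ[ℂ] N}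
    (H : ∀ g v, M.IsHomog (a g) v → ∀ h w, V.IsHomog h w → ∀ l u, W.IsHomog l u →
      f (orbitι a (tensor r M (tensor (· * ·) V W)) (g * (h * l)) (v ⊗ₜ[ℂ] (w ⊗ₜ[ℂ] u))) =
        f' (orbitι a (tensor r M (tensor (· * ·) V W)) (g * (h * l)) (v ⊗ₜ[ℂ] (w ⊗ₜ[ℂ] u)))) :
    f = f' := by
  refine orbit_lin_ext a _ fun c t _ => ?_
  refine LinearMap.congr_fun (f := f ∘ₗ orbitι a (tensor r M (tensor (· * ·) V W)) c)
    (g := f' ∘ₗ orbitι a (tensor r M (tensor (· * ·) V W)) c)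
    (tensor_lin_ext₃ fun x v hv h w hw l u hu => ?_) t
  by_cases hc : r x (h * l) = a c
  · have hx : x = a (c * (h * l)⁻¹) := hr x _ (h * l) (by rw [hc, ← ha, inv_mul_cancel_right])
    subst hx
    have := H _ v hv h w hw l u hu
    rwa [inv_mul_cancel_right] at this
  · have : orbitι a (tensor r M (tensor (· * ·) V W)) c (v ⊗ₜ[ℂ] (w ⊗ₜ[ℂ] u)) = 0 :=
      orbitι_of_ne a _ (hv.tmul r (hw.tmul (· * ·) hu)) hc
    rw [LinearMap.comp_apply, LinearMap.comp_apply, this, map_zero, map_zero]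

theorem orbit_tmul_lin_ext {N : Type*} [AddCommGroup N] [Module ℂ N]
    {f f' : orbitCarrier a M ⊗[ℂ] V.carrier →ₗ[ℂ] N}
    (H : ∀ g v, M.IsHomog (a g) v → ∀ h w, V.IsHomog h w →
      f (orbitι a M g v ⊗ₜ[ℂ] w) = f' (orbitι a M g v ⊗ₜ[ℂ] w)) : f = f' := by
  apply TensorProduct.ext
  refine orbit_lin_ext a M fun g v hv => ?_
  exact lin_ext fun h w hw => by simpa using H g v hv h w hw

/-- The linear map which sends `m ⊗ v` in the summand with index `g * h`, with `m` of degree `a g`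
and `v` of degree `h`, to `s g h • (m ⊗ v)`, with `m` in the summand with index `g`. -/
def orbitδLin : orbitCarrier a (tensor r M V) →ₗ[ℂ] orbitCarrier a M ⊗[ℂ] V.carrier :=
  ∑ g, ∑ h, (s g h : ℂ) •
    (TensorProduct.map (orbitι a M g) (V.proj h) ∘ₗ orbitπ a (tensor r M V) (g * h))

/-- The inverse of `orbitδLin`. -/
def orbitδInv : orbitCarrier a M ⊗[ℂ] V.carrier →ₗ[ℂ] orbitCarrier a (tensor r M V) :=
  ∑ g, ∑ h, ((s g h)⁻¹ : ℂˣ).val •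
    (orbitι a (tensor r M V) (g * h) ∘ₗ TensorProduct.map (orbitπ a M g) (V.proj h))

variable {M V}

theorem isHomog_tmul_of_orbit (ha : ∀ g h, a (g * h) = r (a g) h) {g h : G} {v : M.carrier}
    {w : V.carrier} (hv : M.IsHomog (a g) v) (hw : V.IsHomog h w) :
    (tensor r M V).IsHomog (a (g * h)) (v ⊗ₜ[ℂ] w) := by
  rw [ha]; exact hv.tmul r hw

theorem orbitδLin_orbitι (ha : ∀ g h, a (g * h) = r (a g) h) {g h : G} {v : M.carrier}
    {w : V.carrier} (hv : M.IsHomog (a g) v) (hw : V.IsHomog h w) :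
    orbitδLin a s M V (orbitι a (tensor r M V) (g * h) (v ⊗ₜ[ℂ] w)) =
      (s g h : ℂ) • (orbitι a M g v ⊗ₜ[ℂ] w) := by
  have hvw := isHomog_tmul_of_orbit a ha hv hw
  unfold orbitδLin
  rw [LinearMap.sum_apply, Finset.sum_eq_single g, LinearMap.sum_apply, Finset.sum_eq_single h]
  · rw [LinearMap.smul_apply, LinearMap.comp_apply, orbitπ_orbitι_self, hvw,
      TensorProduct.map_tmul, hw]
  · intro h' _ hh'
    rw [LinearMap.smul_apply, LinearMap.comp_apply, orbitπ_orbitι_ne, map_zero, smul_zero]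
    exact fun e => hh' (mul_left_cancel e).symm
  · simp
  · intro g' _ hg'
    rw [LinearMap.sum_apply]
    refine Finset.sum_eq_zero fun h' _ => ?_
    rw [LinearMap.smul_apply, LinearMap.comp_apply]
    by_cases e : g * h = g' * h'
    · have hh : h ≠ h' := by rintro rfl; exact hg' (mul_right_cancel e).symm
      rw [← e, orbitπ_orbitι_self, hvw, TensorProduct.map_tmul, hw.proj_eq, if_neg hh, tmul_zero,
        smul_zero]
    · rw [orbitπ_orbitι_ne _ _ e, map_zero, smul_zero]
  · simp

theorem orbitδInv_tmul {g h : G} {v : M.carrier} {w : V.carrier} (hv : M.IsHomog (a g) v)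
    (hw : V.IsHomog h w) :
    orbitδInv a s M V (orbitι a M g v ⊗ₜ[ℂ] w) =
      ((s g h)⁻¹ : ℂˣ).val • orbitι a (tensor r M V) (g * h) (v ⊗ₜ[ℂ] w) := by
  unfold orbitδInv
  rw [LinearMap.sum_apply, Finset.sum_eq_single g, LinearMap.sum_apply, Finset.sum_eq_single h]
  · rw [LinearMap.smul_apply, LinearMap.comp_apply, TensorProduct.map_tmul, orbitπ_orbitι_self,
      hv, hw]
  · intro h' _ hh'
    rw [LinearMap.smul_apply, LinearMap.comp_apply, TensorProduct.map_tmul, hw.proj_eq,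
      if_neg hh'.symm, tmul_zero, map_zero, smul_zero]
  · simp
  · intro g' _ hg'
    rw [LinearMap.sum_apply]
    refine Finset.sum_eq_zero fun h' _ => ?_
    rw [LinearMap.smul_apply, LinearMap.comp_apply, TensorProduct.map_tmul,
      orbitπ_orbitι_ne a M hg'.symm, zero_tmul, map_zero, smul_zero]
  · simp

variable (M V)

/-- The isomorphism `⨁ g, (M ⊗ V)_{a g} ≅ (⨁ g, M_{a g}) ⊗ V` of graded spaces. -/
def orbitδ (ha : ∀ g h, a (g * h) = r (a g) h)
    (hb : ∀ g h, b (g * h) = r (b g) h) (hr : ∀ x y g, r x g = r y g → x = y) :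
    orbitSpace a b (tensor r M V) ≅ tensor r (orbitSpace a b M) V :=
  mkIso (V := orbitSpace a b (tensor r M V)) (W := tensor r (orbitSpace a b M) V)
    { orbitδLin a s M V with
      invFun := orbitδInv a s M V
      left_inv := LinearMap.congr_fun (f := orbitδInv a s M V ∘ₗ orbitδLin a s M V)
        (g := LinearMap.id) (orbit_tensor_lin_ext a M V ha hr fun g v hv h w hw => by
          rw [LinearMap.comp_apply, orbitδLin_orbitι a s ha hv hw, map_smul,
            orbitδInv_tmul a s hv hw, smul_smul, ← Units.val_mul, mul_inv_cancel]
          simp)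
      right_inv := LinearMap.congr_fun (f := orbitδLin a s M V ∘ₗ orbitδInv a s M V)
        (g := LinearMap.id) (orbit_tmul_lin_ext a M V (N := orbitCarrier a M ⊗[ℂ] V.carrier)
          (f := orbitδLin a s M V ∘ₗ orbitδInv a s M V) (f' := LinearMap.id) fun g v hv h w hw => by
          show orbitδLin a s M V (orbitδInv a s M V (orbitι a M g v ⊗ₜ[ℂ] w)) =
            orbitι a M g v ⊗ₜ[ℂ] w
          rw [orbitδInv_tmul a s hv hw, map_smul, orbitδLin_orbitι a s ha hv hw, smul_smul,
            ← Units.val_mul, inv_mul_cancel]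
          simp) }
    (by
      classical
      intro y t
      let p : orbitCarrier a M ⊗[ℂ] V.carrier →ₗ[ℂ] orbitCarrier a M ⊗[ℂ] V.carrier :=
        tensorProj r (orbitSpace a b M) V y
      suffices key : orbitδLin a s M V ∘ₗ orbitProj a b (tensor r M V) y =
          p ∘ₗ orbitδLin a s M V from LinearMap.congr_fun key t
      refine orbit_tensor_lin_ext a M V ha hr (N := orbitCarrier a M ⊗[ℂ] V.carrier)
        (f := orbitδLin a s M V ∘ₗ orbitProj a b (tensor r M V) y) (f' := p ∘ₗ orbitδLin a s M V)
        fun g v hv h w hw => ?_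
      have hp : p (orbitι a M g v ⊗ₜ[ℂ] w) =
          if r (b g) h = y then orbitι a M g v ⊗ₜ[ℂ] w else 0 :=
        tensorProj_homog r y (isHomog_orbitι a b M g hv) hw
      rw [LinearMap.comp_apply, LinearMap.comp_apply, orbitδLin_orbitι a s ha hv hw, map_smul, hp,
        orbitProj_orbitι a b _ y _ (isHomog_tmul_of_orbit a ha hv hw), hb]
      split_ifs
      · rw [orbitδLin_orbitι a s ha hv hw]
      · rw [map_zero, smul_zero])

variable {M V}

theorem orbitδ_orbitι (ha : ∀ g h, a (g * h) = r (a g) h)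
    (hb : ∀ g h, b (g * h) = r (b g) h) (hr : ∀ x y g, r x g = r y g → x = y)
    {g h : G} {v : M.carrier} {w : V.carrier} (hv : M.IsHomog (a g) v) (hw : V.IsHomog h w) :
    (orbitδ a b s M V ha hb hr).hom.lin (orbitι a (tensor r M V) (g * h) (v ⊗ₜ[ℂ] w)) =
      (s g h : ℂ) • (orbitι a M g v ⊗ₜ[ℂ] w) :=
  orbitδLin_orbitι a s ha hv hw

end OrbitLineator

section OrbitCoherence

variable {G X : Type u} [Fintype G] [Fintype X] [Group G] {r : X → G → X}
  (a b : G → X) (s : G → G → ℂˣ) (ha : ∀ g h, a (g * h) = r (a g) h)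
  (hb : ∀ g h, b (g * h) = r (b g) h) (hr : ∀ x y g, r x g = r y g → x = y)

theorem orbitMap_id (M : GrVect X) : orbitMap a b (𝟙 M) = 𝟙 (orbitSpace a b M) :=
  orbit_hom_ext a b M fun g v _ => orbitMap_orbitι a b (𝟙 M) g v

theorem orbitMap_comp {M N P : GrVect X} (f : M ⟶ N) (f' : N ⟶ P) :
    orbitMap a b (f ≫ f') = orbitMap a b f ≫ orbitMap a b f' :=
  orbit_hom_ext a b M fun g v _ => by
    rw [comp_lin, orbitMap_orbitι, orbitMap_orbitι, orbitMap_orbitι, comp_lin]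

theorem orbitMap_add {M N : GrVect X} (f f' : M ⟶ N) :
    orbitMap a b (f + f') = orbitMap a b f + orbitMap a b f' :=
  orbit_hom_ext a b M fun g v _ => by
    rw [add_lin, LinearMap.add_apply, orbitMap_orbitι, orbitMap_orbitι, orbitMap_orbitι, add_lin,
      LinearMap.add_apply, map_add]

theorem orbitMap_smul {M N : GrVect X} (c : ℂ) (f : M ⟶ N) :
    orbitMap a b (c • f) = c • orbitMap a b f :=
  orbit_hom_ext a b M fun g v _ => by
    rw [smul_lin, LinearMap.smul_apply, orbitMap_orbitι, orbitMap_orbitι, smul_lin,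
      LinearMap.smul_apply, map_smul]

theorem orbitδ_naturality {M N : GrVect X} {V W : GrVect G} (f : M ⟶ N) (f' : V ⟶ W) :
    orbitMap a b (tensorMap r f f') ≫ (orbitδ a b s N W ha hb hr).hom =
      (orbitδ a b s M V ha hb hr).hom ≫ tensorMap r (orbitMap a b f) f' := by
  refine Hom.ext (orbit_tensor_lin_ext a M V ha hr fun g v hv h w hw => ?_)
  refine (congrArg (orbitδ a b s N W ha hb hr).hom.lin
    (orbitMap_orbitι a b (tensorMap r f f') (g * h) (v ⊗ₜ[ℂ] w))).trans ?_
  refine (orbitδ_orbitι a b s ha hb hr (hv.map f) (hw.map f')).trans (Eq.symm ?_)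
  refine (congrArg (tensorMap r (orbitMap a b f) f').lin
    (orbitδ_orbitι a b s ha hb hr hv hw)).trans ?_
  refine (LinearMap.map_smul _ _ _).trans ?_
  exact congrArg (fun t => (s g h : ℂ) • (t ⊗ₜ[ℂ] f'.lin w)) (orbitMap_orbitι a b f g v)

/-- The scalars `s` must trivialize the quotient of the associativity scalars at the two ends of the
orbit. -/
theorem orbitδ_associativity (hra : ∀ x g h, r (r x g) h = r x (g * h)) (c : X → G → G → ℂˣ)
    (hs : ∀ g h l, s g (h * l) * (c (b g) h l)⁻¹ = (c (a g) h l)⁻¹ * (s (g * h) l * s g h))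
    (M : GrVect X) (V W : GrVect G) :
    (orbitδ a b s M (tensor (· * ·) V W) ha hb hr).hom ≫
        (actAssoc r hra c (orbitSpace a b M) V W).inv =
      orbitMap a b (actAssoc r hra c M V W).inv ≫
        (orbitδ a b s (tensor r M V) W ha hb hr).hom ≫
          tensorMap r (orbitδ a b s M V ha hb hr).hom (𝟙 W) := by
  refine Hom.ext (orbit_tensor_lin_ext₃ a M V W ha hr fun g v hv h w hw l u hu => ?_)
  have e₁ : (orbitδ a b s M (tensor (· * ·) V W) ha hb hr).hom.lin
      (orbitι a (tensor r M (tensor (· * ·) V W)) (g * (h * l)) (v ⊗ₜ[ℂ] (w ⊗ₜ[ℂ] u))) =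
      (s g (h * l) : ℂ) • (orbitι a M g v ⊗ₜ[ℂ] (w ⊗ₜ[ℂ] u)) :=
    orbitδ_orbitι a b s ha hb hr hv (hw.tmul (· * ·) hu)
  have e₂ : (actAssoc r hra c (orbitSpace a b M) V W).inv.lin
      (orbitι a M g v ⊗ₜ[ℂ] (w ⊗ₜ[ℂ] u)) =
      ((c (b g) h l)⁻¹ : ℂˣ).val • ((orbitι a M g v ⊗ₜ[ℂ] w) ⊗ₜ[ℂ] u) :=
    assocIso_inv_homog r r (· * ·) r hra c (isHomog_orbitι a b M g hv) hw hu
  have e₃ : (actAssoc r hra c M V W).inv.lin (v ⊗ₜ[ℂ] (w ⊗ₜ[ℂ] u)) =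
      ((c (a g) h l)⁻¹ : ℂˣ).val • ((v ⊗ₜ[ℂ] w) ⊗ₜ[ℂ] u) :=
    assocIso_inv_homog r r (· * ·) r hra c hv hw hu
  have e₄ : (orbitδ a b s (tensor r M V) W ha hb hr).hom.lin
      (orbitι a (tensor r (tensor r M V) W) (g * h * l) ((v ⊗ₜ[ℂ] w) ⊗ₜ[ℂ] u)) =
      (s (g * h) l : ℂ) • (orbitι a (tensor r M V) (g * h) (v ⊗ₜ[ℂ] w) ⊗ₜ[ℂ] u) :=
    orbitδ_orbitι a b s ha hb hr (isHomog_tmul_of_orbit a ha hv hw) hu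
  have e₅ : (orbitδ a b s M V ha hb hr).hom.lin
      (orbitι a (tensor r M V) (g * h) (v ⊗ₜ[ℂ] w)) = (s g h : ℂ) • (orbitι a M g v ⊗ₜ[ℂ] w) :=
    orbitδ_orbitι a b s ha hb hr hv hw
  have L : ((orbitδ a b s M (tensor (· * ·) V W) ha hb hr).hom ≫
        (actAssoc r hra c (orbitSpace a b M) V W).inv).lin
      (orbitι a (tensor r M (tensor (· * ·) V W)) (g * (h * l)) (v ⊗ₜ[ℂ] (w ⊗ₜ[ℂ] u))) =
      (s g (h * l) * (c (b g) h l)⁻¹ : ℂˣ).val • ((orbitι a M g v ⊗ₜ[ℂ] w) ⊗ₜ[ℂ] u) := by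
    rw [Units.val_mul, ← smul_smul, ← e₂]
    exact (congrArg (actAssoc r hra c (orbitSpace a b M) V W).inv.lin e₁).trans
      (LinearMap.map_smul _ _ _)
  have R : (orbitMap a b (actAssoc r hra c M V W).inv ≫
        (orbitδ a b s (tensor r M V) W ha hb hr).hom ≫
          tensorMap r (orbitδ a b s M V ha hb hr).hom (𝟙 W)).lin
      (orbitι a (tensor r M (tensor (· * ·) V W)) (g * (h * l)) (v ⊗ₜ[ℂ] (w ⊗ₜ[ℂ] u))) =
      ((c (a g) h l)⁻¹ * (s (g * h) l * s g h) : ℂˣ).val •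
        ((orbitι a M g v ⊗ₜ[ℂ] w) ⊗ₜ[ℂ] u) := by
    rw [comp_lin, comp_lin, orbitMap_orbitι, e₃, map_smul, ← mul_assoc g h l, Units.val_mul,
      ← smul_smul]
    refine (LinearMap.map_smul ((tensorMap r (orbitδ a b s M V ha hb hr).hom (𝟙 W)).lin ∘ₗ
      (orbitδ a b s (tensor r M V) W ha hb hr).hom.lin) _ _).trans
      (congrArg (((c (a g) h l)⁻¹ : ℂˣ).val • ·) ?_)
    refine (congrArg (tensorMap r (orbitδ a b s M V ha hb hr).hom (𝟙 W)).lin e₄).trans ?_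
    refine (LinearMap.map_smul _ _ _).trans ?_
    rw [Units.val_mul, ← smul_smul]
    exact congrArg ((s (g * h) l : ℂ) • ·)
      ((congrArg (fun t => t ⊗ₜ[ℂ] u) e₅).trans (smul_tmul' _ _ _).symm)
  exact L.trans ((congrArg (fun z : ℂˣ => z.val • ((orbitι a M g v ⊗ₜ[ℂ] w) ⊗ₜ[ℂ] u))
    (hs g h l)).trans R.symm)

theorem orbitδ_unitality (hr₁ : ∀ x, r x 1 = x) (hs : ∀ g, s g 1 = 1) (M : GrVect X) :
    (rightUnitIso r 1 hr₁ (orbitSpace a b M)).inv =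
      orbitMap a b (rightUnitIso r 1 hr₁ M).inv ≫ (orbitδ a b s M (unit 1) ha hb hr).hom := by
  refine orbit_hom_ext a b M fun g v hv => ?_
  have e : (orbitδ a b s M (unit 1) ha hb hr).hom.lin
      (orbitι a (tensor r M (unit 1)) (g * 1) (v ⊗ₜ[ℂ] (1 : ℂ))) =
      (s g 1 : ℂ) • (orbitι a M g v ⊗ₜ[ℂ] (1 : ℂ)) :=
    orbitδ_orbitι a b s ha hb hr hv (isHomog_unit 1 1)
  rw [hs, mul_one, Units.val_one, one_smul] at e
  rw [comp_lin, orbitMap_orbitι]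
  exact e.symm

end OrbitCoherence

end GrVect

/-! ### The module functor of an orbit -/

section OrbitFunctor

open GrVect Functor.OplaxRightLinear

variable {G : Type u} [Group G] [Fintype G] {A : Subgroup G} {ω : ZGroup G 3}
  (m : ModuleDatum A ω) (k l : RightCosets A)

theorem act_left_injective (x y : RightCosets A) (g : G) (h : act x g = act y g) : x = y :=
  MulAction.injective (MulOpposite.op g) h

/-- The underlying functor `M ↦ ⨁ g, M_{k g}`, with the summand of index `g` in degree `l g`. -/
def orbitFunctor : ModCat m ⥤ ModCat m where
  obj M := orbitSpace (X := RightCosets A) (act k) (act l) M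
  map f := orbitMap (X := RightCosets A) (act k) (act l) f
  map_id M := orbitMap_id (X := RightCosets A) (act k) (act l) M
  map_comp f f' := orbitMap_comp (X := RightCosets A) (act k) (act l) f f'

instance : (orbitFunctor m k l).Additive where
  map_add {_ _ f f'} := orbitMap_add (X := RightCosets A) (act k) (act l) f f'

instance : (orbitFunctor m k l).Linear ℂ where
  map_smul f c := orbitMap_smul (X := RightCosets A) (act k) (act l) c f

/-- The 1-cochain on the free orbit of `(k, l)` whose coboundary is the quotient of the restrictions
of `μ` along the two projections. -/
def orbitScalar (g h : G) : ℂˣ := m.μ l ![g, h] * (m.μ k ![g, h])⁻¹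

theorem orbitScalar_mul (g h j : G) :
    orbitScalar m k l g (h * j) * ((m.μ (act l g) ![h, j])⁻¹)⁻¹ =
      ((m.μ (act k g) ![h, j])⁻¹)⁻¹ * (orbitScalar m k l (g * h) j * orbitScalar m k l g h) := by
  have h₁ := m.pentagon k g h j
  have h₂ := m.pentagon l g h j
  change _ * _ * m.μ (act k g) ![h, j] = _ at h₁
  change _ * _ * m.μ (act l g) ![h, j] = _ at h₂
  -- `ω` cancels in the quotient of the pentagon identities at `l` and at `k`
  have h₃ := congrArg₂ (· / ·) h₂ h₁
  apply_fun Additive.ofMul at h₃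
  apply Additive.ofMul.injective
  simp only [orbitScalar, ofMul_mul, ofMul_inv, ofMul_div] at h₃ ⊢
  rw [← sub_eq_zero] at h₃ ⊢
  rw [← h₃]
  abel

theorem orbitScalar_one (g : G) : orbitScalar m k l g 1 = 1 := by
  rw [orbitScalar, m.normalized l _ ⟨1, rfl⟩, m.normalized k _ ⟨1, rfl⟩]
  simp

instance : (orbitFunctor m k l).OplaxRightLinear (VectG ω) where
  δᵣ M V := (orbitδ (X := RightCosets A) (act k) (act l) (orbitScalar m k l) M V
    (fun g h => (act_act k g h).symm) (fun g h => (act_act l g h).symm) act_left_injective).hom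
  δᵣ_naturality_right M V _ f :=
    (orbitδ_naturality (X := RightCosets A) (act k) (act l) (orbitScalar m k l)
      (fun g h => (act_act k g h).symm) (fun g h => (act_act l g h).symm) act_left_injective
      (𝟙 (M : GrVect (RightCosets A))) f).trans
    (congrArg (fun t => (orbitδ (X := RightCosets A) (act k) (act l) (orbitScalar m k l) M V
        (fun g h => (act_act k g h).symm) (fun g h => (act_act l g h).symm)
        act_left_injective).hom ≫ tensorMap (X := RightCosets A) (Y := G) act t f)
      (orbitMap_id (X := RightCosets A) (act k) (act l) M))
  δᵣ_naturality_left {_ _} f V := orbitδ_naturality (X := RightCosets A) (act k) (act l)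
    (orbitScalar m k l)
    (fun g h => (act_act k g h).symm) (fun g h => (act_act l g h).symm) act_left_injective
    f (𝟙 (V : GrVect G))
  δᵣ_associativity M V W := orbitδ_associativity (X := RightCosets A) (act k) (act l)
    (orbitScalar m k l)
    (fun g h => (act_act k g h).symm) (fun g h => (act_act l g h).symm) act_left_injective
    act_act (fun x g h => (m.μ x ![g, h])⁻¹) (orbitScalar_mul m k l) M V W
  δᵣ_unitality_inv M := orbitδ_unitality (X := RightCosets A) (act k) (act l)
    (orbitScalar m k l)
    (fun g h => (act_act k g h).symm) (fun g h => (act_act l g h).symm) act_left_injective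
    act_one (orbitScalar_one m k l) M

instance (M : ModCat m) (V : VectG ω) : IsIso (δᵣ (orbitFunctor m k l) M V) :=
  (orbitδ (X := RightCosets A) (act k) (act l) (orbitScalar m k l) M V
    (fun g h => (act_act k g h).symm) (fun g h => (act_act l g h).symm)
    act_left_injective).isIso_hom

/-- The module functor `M ↦ ⨁ g, M_{k g}`, with the summand of index `g` in degree `l g`. It
represents the functor that sends a module functor `F` to the component of degree `l` of
`F (δ_k)`. -/
def orbitObj : DualCat (VectG ω) (ModCat m) where
  functor := orbitFunctor m k l

end OrbitFunctor

/-! ### One-dimensional graded spaces -/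

namespace GrVect

section Points

variable {X : Type u} [Fintype X]

/-- The morphism `δ_x ⟶ M` which sends `1` to the component of `v` of degree `x`. -/
def pt (x : X) {M : GrVect X} (v : M.carrier) : unit x ⟶ M where
  lin := LinearMap.toSpanSingleton ℂ M.carrier (M.proj x v)
  comm y r := by
    classical
    have h := ((isHomog_proj M x v).proj_eq y)
    show (((if y = x then LinearMap.id else 0 : ℂ →ₗ[ℂ] ℂ) r) • M.proj x v : M.carrier) =
      M.proj y (r • M.proj x v)
    rw [map_smul, h]
    by_cases hy : y = x
    · simp [hy]
    · simp [hy, Ne.symm hy]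

theorem pt_lin (x : X) {M : GrVect X} (v : M.carrier) (r : ℂ) :
    (pt x v).lin r = r • M.proj x v := rfl

theorem pt_lin_homog {x : X} {M : GrVect X} {v : M.carrier} (hv : M.IsHomog x v) (r : ℂ) :
    (pt x v).lin r = r • v := by rw [pt_lin, hv]

theorem unit_hom_ext {x : X} {M : GrVect X} {f f' : unit x ⟶ M}
    (h : f.lin (1 : ℂ) = f'.lin (1 : ℂ)) : f = f' :=
  Hom.ext (LinearMap.ext_ring h)

theorem pt_comp (x : X) {M N : GrVect X} (v : M.carrier) (f : M ⟶ N) :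
    pt x v ≫ f = pt x (f.lin v) :=
  unit_hom_ext (by rw [comp_lin, pt_lin, pt_lin, one_smul, one_smul, f.comm])

theorem pt_one (x : X) : pt x (M := unit x) (1 : ℂ) = 𝟙 (unit x) :=
  unit_hom_ext (by
    rw [pt_lin_homog (isHomog_unit x 1), id_lin]
    exact one_smul ℂ (1 : ℂ))

theorem pt_add (x : X) {M : GrVect X} (v w : M.carrier) : pt x (v + w) = pt x v + pt x w :=
  unit_hom_ext (by
    rw [add_lin, LinearMap.add_apply, pt_lin, pt_lin, pt_lin, map_add, smul_add])

theorem pt_smul (x : X) {M : GrVect X} (c : ℂ) (v : M.carrier) : pt x (c • v) = c • pt x v :=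
  unit_hom_ext (by
    rw [smul_lin, LinearMap.smul_apply, pt_lin, pt_lin, map_smul, smul_comm])

/-- Every graded space is a direct sum of one-dimensional ones. -/
theorem exists_sum_pt (M : GrVect X) : ∃ (J : Type u) (_ : Fintype J) (x : J → X)
    (p : ∀ j, M ⟶ unit (x j)) (i : ∀ j, unit (x j) ⟶ M), ∑ j, p j ≫ i j = 𝟙 M := by
  classical
  let R : X → Submodule ℂ M.carrier := fun x => LinearMap.range (M.proj x)
  let B : ∀ x, Module.Basis (Fin (Module.finrank ℂ (R x))) ℂ (R x) :=
    fun x => Module.finBasis ℂ (R x)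
  have hB : ∀ x i, M.IsHomog x (B x i : M.carrier) := by
    intro x i
    obtain ⟨v, hv⟩ := (B x i).2
    rw [← hv]; exact isHomog_proj M x v
  let q : ∀ x, M.carrier →ₗ[ℂ] R x := fun x => (M.proj x).rangeRestrict
  let p : ∀ j : Σ x, Fin (Module.finrank ℂ (R x)), M ⟶ unit j.1 := fun j =>
    { lin := (B j.1).coord j.2 ∘ₗ q j.1
      comm := fun y v => by
        show (B j.1).coord j.2 (q j.1 (M.proj y v)) =
          (if y = j.1 then LinearMap.id else 0 : ℂ →ₗ[ℂ] ℂ) ((B j.1).coord j.2 (q j.1 v))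
        by_cases h : y = j.1
        · have : q j.1 (M.proj y v) = q j.1 v := Subtype.ext (by
            subst h; exact M.proj_self _ v)
          rw [this, if_pos h]; rfl
        · have : q j.1 (M.proj y v) = 0 := Subtype.ext (M.proj_ne _ _ (Ne.symm h) v)
          rw [this, if_neg h]; simp }
  refine ⟨Σ x, Fin (Module.finrank ℂ (R x)), inferInstance, fun j => j.1, p,
    fun j => pt j.1 (B j.1 j.2 : M.carrier), ?_⟩
  have hlin : ∀ (s : Finset (Σ x, Fin (Module.finrank ℂ (R x))))
      (f : (Σ x, Fin (Module.finrank ℂ (R x))) → (M ⟶ M)) (v : M.carrier),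
      (∑ j ∈ s, f j).lin v = ∑ j ∈ s, (f j).lin v := by
    intro s f v
    induction s using Finset.induction_on with
    | empty => rfl
    | insert a s ha ih => rw [Finset.sum_insert ha, Finset.sum_insert ha, ← ih]; rfl
  refine hom_ext fun v => ?_
  rw [hlin, Fintype.sum_sigma, id_lin]
  conv_rhs => rw [← M.sum_proj v]
  refine Finset.sum_congr rfl fun x _ => ?_
  have h₁ : ∀ i, (p ⟨x, i⟩ ≫ pt x (B x i : M.carrier)).lin v =
      ((B x).repr (q x v) i • B x i : R x) := by
    intro i
    rw [comp_lin, pt_lin_homog (hB x i)]; rfl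
  rw [Finset.sum_congr rfl fun i _ => h₁ i, ← Submodule.coe_sum, (B x).sum_repr]
  rfl

variable {G : Type u} [Fintype G]

/-- The isomorphism `δ_y ≅ δ_x ⊗ δ_g` for `y = x g`. -/
def unitTensorIso (r : X → G → X) {x y : X} {g : G} (h : r x g = y) :
    unit y ≅ tensor r (unit x) (unit g) :=
  mkIso (V := unit y) (W := tensor r (unit x) (unit g)) (TensorProduct.lid ℂ ℂ).symm (by
    classical
    intro z c
    have h₁ : tensorProj r (unit x) (unit g) z ((1 : ℂ) ⊗ₜ[ℂ] c) =
        if r x g = z then (1 : ℂ) ⊗ₜ[ℂ] c else 0 :=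
      tensorProj_homog r z (isHomog_unit x 1) (isHomog_unit g c)
    refine Eq.trans ?_ h₁.symm
    rw [h]
    show (1 : ℂ) ⊗ₜ[ℂ] ((if z = y then LinearMap.id else 0 : ℂ →ₗ[ℂ] ℂ) c) = _
    by_cases hz : z = y
    · simp [hz]
    · simp [hz, Ne.symm hz])

theorem unitTensorIso_hom_lin (r : X → G → X) {x y : X} {g : G} (h : r x g = y) (c : ℂ) :
    (unitTensorIso r h).hom.lin c = (1 : ℂ) ⊗ₜ[ℂ] c := rfl

theorem pt_tmul (r : X → G → X) {x y : X} {g : G} (h : r x g = y) {M : GrVect X} {V : GrVect G}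
    {v : M.carrier} {w : V.carrier} (hv : M.IsHomog x v) (hw : V.IsHomog g w) :
    pt y (M := tensor r M V) (v ⊗ₜ[ℂ] w) =
      (unitTensorIso r h).hom ≫ tensorMap r (pt x v) (pt g w) := by
  have hvw : (tensor r M V).IsHomog y (v ⊗ₜ[ℂ] w) := h ▸ hv.tmul r hw
  refine unit_hom_ext ((pt_lin_homog hvw 1).trans (Eq.symm ?_))
  rw [comp_lin, unitTensorIso_hom_lin]
  refine (tensorMap_tmul r _ _ _ _).trans ?_
  rw [pt_lin_homog hv, pt_lin_homog hw, one_smul, one_smul, one_smul]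

theorem rid_tensorProj (r : X → G → X) (hr : ∀ x y g, r x g = r y g → x = y) (M : GrVect X) (g : G)
    (d : X) (q : M.carrier ⊗[ℂ] ℂ) :
    TensorProduct.rid ℂ M.carrier (tensorProj r M (unit g) (r d g) q) =
      M.proj d (TensorProduct.rid ℂ M.carrier q) := by
  classical
  let T : M.carrier ⊗[ℂ] ℂ →ₗ[ℂ] M.carrier ⊗[ℂ] ℂ := tensorProj r M (unit g) (r d g)
  refine LinearMap.congr_fun (f := (TensorProduct.rid ℂ M.carrier).toLinearMap ∘ₗ T)
    (g := M.proj d ∘ₗ (TensorProduct.rid ℂ M.carrier).toLinearMap) ?_ q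
  apply TensorProduct.ext
  refine lin_ext fun x v hv => LinearMap.ext fun c => ?_
  have h₁ : T (v ⊗ₜ[ℂ] c) = if r x g = r d g then v ⊗ₜ[ℂ] c else 0 :=
    tensorProj_homog r _ hv (isHomog_unit g c)
  show TensorProduct.rid ℂ M.carrier (T (v ⊗ₜ[ℂ] c)) =
    M.proj d (TensorProduct.rid ℂ M.carrier (v ⊗ₜ[ℂ] c))
  rw [h₁, TensorProduct.rid_tmul, map_smul, hv.proj_eq]
  by_cases hx : x = d
  · simp [hx]
  · rw [if_neg fun e => hx (hr x d g e), if_neg hx, map_zero, smul_zero]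

end Points

end GrVect

/-! ### Evaluation of module functors -/

section Evaluation

open GrVect Functor.OplaxRightLinear

variable {G : Type u} [Group G] [Fintype G] {A : Subgroup G} {ω : ZGroup G 3}
  {m : ModuleDatum A ω}

namespace DualCat

variable (F F' : DualCat (VectG ω) (ModCat m))

/-- The value of a module functor, as a graded space. -/
def grObj (M : GrVect (RightCosets A)) : GrVect (RightCosets A) :=
  F.functor.obj M

/-- The action of a module functor on morphisms of graded spaces. -/
def grMap {M N : GrVect (RightCosets A)} (f : M ⟶ N) : F.grObj M ⟶ F.grObj N :=
  F.functor.map (X := M) (Y := N) f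

/-- The module functor constraint, as a morphism of graded spaces. -/
def grδ (M : GrVect (RightCosets A)) (V : GrVect G) :
    F.grObj (tensor act M V) ⟶ tensor act (F.grObj M) V :=
  δᵣ F.functor (C := VectG ω) M V

variable {F F'} in
/-- The components of a natural module transformation, as morphisms of graded spaces. -/
def grApp (η : F ⟶ F') (M : GrVect (RightCosets A)) : F.grObj M ⟶ F'.grObj M :=
  η.nat.app M

theorem grMap_id (M : GrVect (RightCosets A)) : F.grMap (𝟙 M) = 𝟙 (F.grObj M) :=
  F.functor.map_id M

theorem grMap_comp {M N P : GrVect (RightCosets A)} (f : M ⟶ N) (f' : N ⟶ P) :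
    F.grMap (f ≫ f') = F.grMap f ≫ F.grMap f' :=
  F.functor.map_comp (X := M) (Y := N)
    (Z := P) f f'

theorem grMap_add {M N : GrVect (RightCosets A)} (f f' : M ⟶ N) :
    F.grMap (f + f') = F.grMap f + F.grMap f' :=
  F.functor.map_add (X := M) (Y := N) (f := f) (g := f')

theorem grMap_smul {M N : GrVect (RightCosets A)} (c : ℂ) (f : M ⟶ N) :
    F.grMap (c • f) = c • F.grMap f :=
  Functor.map_smul F.functor (X := M) (Y := N) c f

theorem grδ_naturality {M N : GrVect (RightCosets A)} {V W : GrVect G} (f : M ⟶ N) (f' : V ⟶ W) :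
    F.grMap (tensorMap act f f') ≫ F.grδ N W =
      F.grδ M V ≫ tensorMap act (F.grMap f) f' := by
  have h₁ : F.grMap (tensorMap act f (𝟙 V)) ≫ F.grδ N V =
      F.grδ M V ≫ tensorMap act (F.grMap f) (𝟙 V) :=
    δᵣ_naturality_left F.functor (C := VectG ω) (d := M) (d' := N) f V
  have h₂ : F.grMap (tensorMap act (𝟙 N) f') ≫ F.grδ N W =
      F.grδ N V ≫ tensorMap act (𝟙 (F.grObj N)) f' :=
    δᵣ_naturality_right F.functor (C := VectG ω) N (c := V)
      (c' := W) f'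
  rw [tensorMap_def act f f', grMap_comp, Category.assoc, h₂, ← Category.assoc, h₁,
    Category.assoc, ← tensorMap_def]

theorem grδ_associativity (M : GrVect (RightCosets A)) (V W : GrVect G) :
    F.grδ M (tensor (· * ·) V W) ≫
        (actAssoc act act_act (fun k g h => (m.μ k ![g, h])⁻¹) (F.grObj M) V W).inv =
      F.grMap (actAssoc act act_act (fun k g h => (m.μ k ![g, h])⁻¹) M V W).inv ≫
        F.grδ (tensor act M V) W ≫ tensorMap act (F.grδ M V) (𝟙 W) :=
  δᵣ_associativity F.functor (C := VectG ω) M V W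

instance isIso_grMap {M N : GrVect (RightCosets A)} (f : M ⟶ N) [IsIso f] : IsIso (F.grMap f) :=
  ⟨F.grMap (inv f), by rw [← grMap_comp, IsIso.hom_inv_id, grMap_id],
    by rw [← grMap_comp, IsIso.inv_hom_id, grMap_id]⟩

instance isIso_grδ (M : GrVect (RightCosets A)) (V : GrVect G) : IsIso (F.grδ M V) :=
  F.isIso_δ M V

variable {F F'}

theorem grApp_naturality (η : F ⟶ F') {M N : GrVect (RightCosets A)} (f : M ⟶ N) :
    F.grMap f ≫ grApp η N = grApp η M ≫ F'.grMap f :=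
  η.nat.naturality (X := M) (Y := N) f

theorem grApp_comm (η : F ⟶ F') (M : GrVect (RightCosets A)) (V : GrVect G) :
    grApp η (tensor act M V) ≫ F'.grδ M V = F.grδ M V ≫ tensorMap act (grApp η M) (𝟙 V) :=
  η.comm M V

theorem grHom_ext {η θ : F ⟶ F'} (h : ∀ M, grApp η M = grApp θ M) : η = θ :=
  DualCat.hom_ext fun M => h M

end DualCat

theorem GrVect.bijective_lin {X : Type u} [Fintype X] {M N : GrVect X} (f : M ⟶ N) [IsIso f] :
    Function.Bijective f.lin := by
  refine ⟨Function.LeftInverse.injective (g := (inv f).lin) fun v => ?_,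
    Function.RightInverse.surjective (g := (inv f).lin) fun v => ?_⟩
  · rw [← comp_lin, IsIso.hom_inv_id, id_lin]
  · rw [← comp_lin, IsIso.inv_hom_id, id_lin]

theorem GrVect.isIso_of_bijective {X : Type u} [Fintype X] {M N : GrVect X} (f : M ⟶ N)
    (h : Function.Bijective f.lin) : IsIso f :=
  (mkIso (LinearEquiv.ofBijective f.lin h) f.comm).isIso_hom

namespace DualCat

variable (F F' : DualCat (VectG ω) (ModCat m))

/-- The isomorphism `F (δ_y) → F (δ_x)`, for `y = x g`, that underlies
`F (δ_x ⊗ δ_g) ≅ F (δ_x) ⊗ δ_g`. It moves degree `d g` to degree `d`. -/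
def shift {x y : RightCosets A} {g : G} (h : act x g = y) :
    (F.grObj (unit y)).carrier →ₗ[ℂ] (F.grObj (unit x)).carrier :=
  (TensorProduct.rid ℂ _).toLinearMap ∘ₗ (F.grδ (unit x) (unit g)).lin ∘ₗ
    (F.grMap (unitTensorIso act h).hom).lin

variable {F F'} {x y : RightCosets A} {g : G}

theorem grδ_grMap_unit (h : act x g = y) (t : (F.grObj (unit y)).carrier) :
    (F.grδ (unit x) (unit g)).lin ((F.grMap (unitTensorIso act h).hom).lin t) =
      F.shift h t ⊗ₜ[ℂ] (1 : ℂ) :=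
  ((TensorProduct.rid ℂ _).symm_apply_apply _).symm

theorem bijective_shift (h : act x g = y) : Function.Bijective (F.shift h) := by
  exact (TensorProduct.rid ℂ _).bijective.comp ((bijective_lin (F.grδ (unit x) (unit g))).comp
    (bijective_lin (F.grMap (unitTensorIso act h).hom)))

theorem shift_proj (h : act x g = y) (d : RightCosets A) (t : (F.grObj (unit y)).carrier) :
    F.shift h ((F.grObj (unit y)).proj (act d g) t) = (F.grObj (unit x)).proj d (F.shift h t) := by
  show TensorProduct.rid ℂ _ ((F.grδ (unit x) (unit g)).lin
    ((F.grMap (unitTensorIso act h).hom).lin ((F.grObj (unit y)).proj (act d g) t))) = _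
  rw [GrVect.Hom.comm, GrVect.Hom.comm]
  exact rid_tensorProj act act_left_injective (F.grObj (unit x)) g d _

theorem shift_grApp (η : F ⟶ F') (h : act x g = y) (t : (F.grObj (unit y)).carrier) :
    F'.shift h ((grApp η (unit y)).lin t) = (grApp η (unit x)).lin (F.shift h t) := by
  have e₁ : (F'.grMap (unitTensorIso act h).hom).lin ((grApp η (unit y)).lin t) =
      (grApp η (tensor act (unit x) (unit g))).lin ((F.grMap (unitTensorIso act h).hom).lin t) := by
    rw [← comp_lin, ← comp_lin, grApp_naturality]
  have e₂ := congrArg (fun f => Hom.lin f ((F.grMap (unitTensorIso act h).hom).lin t))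
    (grApp_comm η (unit x) (unit g))
  have e₃ : F'.shift h ((grApp η (unit y)).lin t) ⊗ₜ[ℂ] (1 : ℂ) =
      (grApp η (unit x)).lin (F.shift h t) ⊗ₜ[ℂ] (1 : ℂ) := by
    rw [← grδ_grMap_unit, e₁]
    refine e₂.trans ?_
    refine (congrArg (tensorMap act (grApp η (unit x)) (𝟙 (unit g))).lin
      (grδ_grMap_unit h t)).trans ?_
    exact tensorMap_tmul act _ _ _ _
  exact (TensorProduct.rid ℂ _).symm.injective e₃

/-- The constraint of a module functor on homogeneous vectors, in terms of `shift`. -/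
theorem grδ_grMap_pt (h : act x g = y) {M : GrVect (RightCosets A)} {V : GrVect G} {v : M.carrier}
    {w : V.carrier} (hv : M.IsHomog x v) (hw : V.IsHomog g w) (t : (F.grObj (unit y)).carrier) :
    (F.grδ M V).lin ((F.grMap (pt y (M := tensor act M V) (v ⊗ₜ[ℂ] w))).lin t) =
      (F.grMap (pt x v)).lin (F.shift h t) ⊗ₜ[ℂ] w := by
  rw [pt_tmul act h hv hw, grMap_comp, comp_lin]
  refine (congrArg (fun f => Hom.lin f ((F.grMap (unitTensorIso act h).hom).lin t))
    (grδ_naturality F (pt x v) (pt g w))).trans ?_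
  refine (congrArg (tensorMap act (F.grMap (pt x v)) (pt g w)).lin (grδ_grMap_unit h t)).trans ?_
  refine (tensorMap_tmul act _ _ _ _).trans ?_
  rw [pt_lin_homog hw, one_smul]

/-- Shifting in two steps differs from shifting in one step by the quotient of the values of `μ` at
`d` and at `x`, where `d` is the degree of the resulting vector of `F (δ_x)`. This is the pentagon
axiom for `F` on `δ_x`, `δ_g`, `δ_h`. -/
theorem shift_shift {x y z : RightCosets A} {g h : G} (hxy : act x g = y) (hyz : act y h = z)
    (hxz : act x (g * h) = z) {d : RightCosets A} {t : (F.grObj (unit z)).carrier}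
    (ht : (F.grObj (unit x)).IsHomog d (F.shift hxz t)) :
    (m.μ x ![g, h] : ℂ) • F.shift hxy (F.shift hyz t) =
      (m.μ d ![g, h] : ℂ) • F.shift hxz t := by
  have h1 : (unit x).IsHomog x (1 : ℂ) := isHomog_unit x 1
  have hg : (unit g).IsHomog g (1 : ℂ) := isHomog_unit g 1
  have hh : (unit h).IsHomog h (1 : ℂ) := isHomog_unit h 1
  have hgh : (tensor (· * ·) (unit g) (unit h)).IsHomog (g * h) ((1 : ℂ) ⊗ₜ[ℂ] (1 : ℂ)) :=
    hg.tmul (· * ·) hh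
  have hy : (tensor act (unit x) (unit g)).IsHomog y ((1 : ℂ) ⊗ₜ[ℂ] (1 : ℂ)) :=
    hxy ▸ h1.tmul act hg
  -- `q` and `q'` send `1` to the two bracketings of `1 ⊗ 1 ⊗ 1`; the pentagon is evaluated at `F q`
  let q : unit z ⟶ tensor act (unit x) (tensor (· * ·) (unit g) (unit h)) :=
    pt z ((1 : ℂ) ⊗ₜ[ℂ] ((1 : ℂ) ⊗ₜ[ℂ] (1 : ℂ)))
  let q' : unit z ⟶ tensor act (tensor act (unit x) (unit g)) (unit h) :=
    pt z (((1 : ℂ) ⊗ₜ[ℂ] (1 : ℂ)) ⊗ₜ[ℂ] (1 : ℂ))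
  have hid : ∀ (x : RightCosets A) (s : (F.grObj (unit x)).carrier),
      (F.grMap (pt x (M := unit x) (1 : ℂ))).lin s = s := by
    intro x s; rw [pt_one, grMap_id, id_lin]
  have e₁ : (F.grδ (unit x) (tensor (· * ·) (unit g) (unit h))).lin ((F.grMap q).lin t) =
      F.shift hxz t ⊗ₜ[ℂ] ((1 : ℂ) ⊗ₜ[ℂ] (1 : ℂ)) := by
    refine (grδ_grMap_pt hxz h1 hgh t).trans ?_
    rw [hid]
  have e₂ : (actAssoc act act_act (fun k g h => (m.μ k ![g, h])⁻¹) (F.grObj (unit x))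
      (unit g) (unit h)).inv.lin (F.shift hxz t ⊗ₜ[ℂ] ((1 : ℂ) ⊗ₜ[ℂ] (1 : ℂ))) =
      (((m.μ d ![g, h])⁻¹)⁻¹ : ℂˣ).val • ((F.shift hxz t ⊗ₜ[ℂ] (1 : ℂ)) ⊗ₜ[ℂ] (1 : ℂ)) :=
    assocIso_inv_homog act act (· * ·) act act_act _ ht hg hh
  have e₃ : q ≫ (actAssoc act act_act (fun k g h => (m.μ k ![g, h])⁻¹) (unit x)
      (unit g) (unit h)).inv = (((m.μ x ![g, h])⁻¹)⁻¹ : ℂˣ).val • q' := by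
    refine (pt_comp z _ _).trans ?_
    refine (congrArg (pt z) (assocIso_inv_homog act act (· * ·) act act_act _ h1 hg hh)).trans ?_
    exact pt_smul z _ _
  have e₄ : (F.grδ (tensor act (unit x) (unit g)) (unit h)).lin ((F.grMap q').lin t) =
      (F.grMap (unitTensorIso act hxy).hom).lin (F.shift hyz t) ⊗ₜ[ℂ] (1 : ℂ) := by
    refine (grδ_grMap_pt hyz hy hh t).trans ?_
    rw [pt_tmul act hxy h1 hg]
    have : tensorMap act (pt x (M := unit x) (1 : ℂ)) (pt g (M := unit g) (1 : ℂ)) = 𝟙 _ := by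
      rw [pt_one, pt_one, tensorMap_id]
    rw [this, Category.comp_id]
  have e₅ := congrArg (fun f => Hom.lin f ((F.grMap q).lin t))
    (grδ_associativity F (unit x) (unit g) (unit h))
  have L := (congrArg (actAssoc act act_act (fun k g h => (m.μ k ![g, h])⁻¹) (F.grObj (unit x))
      (unit g) (unit h)).inv.lin e₁).trans e₂
  have R₁ : (F.grMap (actAssoc act act_act (fun k g h => (m.μ k ![g, h])⁻¹) (unit x)
      (unit g) (unit h)).inv).lin ((F.grMap q).lin t) =
      (((m.μ x ![g, h])⁻¹)⁻¹ : ℂˣ).val • (F.grMap q').lin t := by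
    rw [← comp_lin, ← grMap_comp, e₃, grMap_smul]; rfl
  have R₂ : (tensorMap act (F.grδ (unit x) (unit g)) (𝟙 (unit h))).lin
      ((F.grδ (tensor act (unit x) (unit g)) (unit h)).lin ((F.grMap q').lin t)) =
      (F.shift hxy (F.shift hyz t) ⊗ₜ[ℂ] (1 : ℂ)) ⊗ₜ[ℂ] (1 : ℂ) := by
    refine (congrArg (tensorMap act (F.grδ (unit x) (unit g)) (𝟙 (unit h))).lin e₄).trans ?_
    refine (tensorMap_tmul act _ _ _ _).trans ?_
    rw [grδ_grMap_unit]; rfl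
  have R : (tensorMap act (F.grδ (unit x) (unit g)) (𝟙 (unit h))).lin
      ((F.grδ (tensor act (unit x) (unit g)) (unit h)).lin
        ((F.grMap (actAssoc act act_act (fun k g h => (m.μ k ![g, h])⁻¹) (unit x)
          (unit g) (unit h)).inv).lin ((F.grMap q).lin t))) =
      (((m.μ x ![g, h])⁻¹)⁻¹ : ℂˣ).val •
        ((F.shift hxy (F.shift hyz t) ⊗ₜ[ℂ] (1 : ℂ)) ⊗ₜ[ℂ] (1 : ℂ)) := by
    rw [R₁]
    refine (LinearMap.map_smul ((tensorMap act (F.grδ (unit x) (unit g)) (𝟙 (unit h))).lin ∘ₗ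
      (F.grδ (tensor act (unit x) (unit g)) (unit h)).lin) _ _).trans ?_
    exact congrArg _ R₂
  have E := R.symm.trans (e₅.symm.trans L)
  rw [inv_inv, inv_inv, smul_tmul', smul_tmul', smul_tmul', smul_tmul'] at E
  exact (TensorProduct.rid ℂ _).symm.injective ((TensorProduct.rid ℂ _).symm.injective E)

end DualCat

end Evaluation

/-! ### Morphisms out of orbit functors and simple module functors -/

section Simple

open GrVect

variable {G : Type u} [Group G] [Fintype G] {A : Subgroup G} {ω : ZGroup G 3}
  {m : ModuleDatum A ω}

namespace DualCat

section FromOrbit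

variable {F : DualCat (VectG ω) (ModCat m)} {k l : RightCosets A}
  (w : ∀ g : G, (F.grObj (unit (act k g))).carrier)
  (hw : ∀ g, (F.grObj (unit (act k g))).IsHomog (act l g) (w g))

/-- The linear map `M → F M` which sends a vector `v` of degree `k g` to the value at `w g` of
`F` applied to the morphism `δ_{k g} ⟶ M` with image `v`. -/
def evalAt (M : GrVect (RightCosets A)) (g : G) : M.carrier →ₗ[ℂ] (F.grObj M).carrier where
  toFun v := (F.grMap (pt (act k g) v)).lin (w g)
  map_add' v v' := by rw [pt_add, grMap_add]; rfl
  map_smul' c v := by rw [pt_smul, grMap_smul]; rfl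

theorem sum_evalAt_orbitι (M : GrVect (RightCosets A)) (g : G) {v : M.carrier}
    (hv : M.IsHomog (act k g) v) :
    (∑ h, evalAt w M h ∘ₗ orbitπ (act k) M h) (orbitι (act k) M g v) =
      (F.grMap (pt (act k g) v)).lin (w g) := by
  rw [LinearMap.sum_apply, Finset.sum_eq_single g]
  · rw [LinearMap.comp_apply, orbitπ_orbitι_self, hv]; rfl
  · intro h _ hh
    rw [LinearMap.comp_apply, orbitπ_orbitι_ne _ _ hh.symm, map_zero]
  · simp

/-- The components of the transformation from the orbit functor to `F` given by the vectors
`w g`. -/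
def fromOrbitApp (M : GrVect (RightCosets A)) :
    orbitSpace (act k) (act l) M ⟶ F.grObj M where
  lin := ∑ h, evalAt w M h ∘ₗ orbitπ (act k) M h
  comm := orbit_comm (act k) (act l) M _ fun g v hv => by
    rw [sum_evalAt_orbitι w M g hv]
    exact (hw g).map _

theorem fromOrbitApp_orbitι (M : GrVect (RightCosets A)) (g : G) {v : M.carrier}
    (hv : M.IsHomog (act k g) v) :
    (fromOrbitApp w hw M).lin (orbitι (act k) M g v) = (F.grMap (pt (act k g) v)).lin (w g) :=
  sum_evalAt_orbitι w M g hv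

theorem fromOrbitApp_naturality {M N : GrVect (RightCosets A)} (f : M ⟶ N) :
    orbitMap (act k) (act l) f ≫ fromOrbitApp w hw N = fromOrbitApp w hw M ≫ F.grMap f :=
  orbit_hom_ext _ _ M fun g v hv => by
    rw [comp_lin, comp_lin, orbitMap_orbitι, fromOrbitApp_orbitι w hw M g hv,
      fromOrbitApp_orbitι w hw N g (hv.map f), ← pt_comp, grMap_comp, comp_lin]

theorem fromOrbitApp_comm
    (hs : ∀ g h, F.shift (act_act k g h) (w (g * h)) = (orbitScalar m k l g h : ℂ) • w g)
    (M : GrVect (RightCosets A)) (V : GrVect G) :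
    fromOrbitApp w hw (tensor act M V) ≫ F.grδ M V =
      (orbitδ (act k) (act l) (orbitScalar m k l) M V (fun g h => (act_act k g h).symm)
        (fun g h => (act_act l g h).symm) act_left_injective).hom ≫
        tensorMap act (fromOrbitApp w hw M) (𝟙 V) := by
  refine GrVect.Hom.ext (orbit_tensor_lin_ext (act k) M V (fun g h => (act_act k g h).symm)
    act_left_injective fun g v hv h u hu => ?_)
  have hvu : (tensor act M V).IsHomog (act k (g * h)) (v ⊗ₜ[ℂ] u) :=
    isHomog_tmul_of_orbit (act k) (fun g h => (act_act k g h).symm) hv hu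
  rw [comp_lin, comp_lin, fromOrbitApp_orbitι w hw _ _ hvu,
    grδ_grMap_pt (act_act k g h) hv hu, hs, map_smul]
  refine Eq.symm ((congrArg (tensorMap act (fromOrbitApp w hw M) (𝟙 V)).lin
    (orbitδ_orbitι (act k) (act l) (orbitScalar m k l) (fun g h => (act_act k g h).symm)
        (fun g h => (act_act l g h).symm) act_left_injective hv hu)).trans ?_)
  refine (LinearMap.map_smul _ _ _).trans ?_
  rw [← smul_tmul']
  exact congrArg (fun t => (orbitScalar m k l g h : ℂ) • (t ⊗ₜ[ℂ] u))
    (fromOrbitApp_orbitι w hw M g hv)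

/-- The transformation from the orbit functor to `F` given by the vectors `w g`. -/
def fromOrbit
    (hs : ∀ g h, F.shift (act_act k g h) (w (g * h)) = (orbitScalar m k l g h : ℂ) • w g) :
    orbitObj m k l ⟶ F where
  nat :=
    { app := fun M => fromOrbitApp w hw M
      naturality := fun {_ _} f => fromOrbitApp_naturality w hw f }
  comm M V := fromOrbitApp_comm w hw hs M V

end FromOrbit

/-- Every vector of degree `l` in `F (δ_k)` comes from a transformation out of the orbit functor of
`(k, l)`, so a transformation that kills the vector is not a monomorphism unless the vector is
zero. -/
theorem injective_grApp_of_mono {F F' : DualCat (VectG ω) (ModCat m)} (η : F ⟶ F') [Mono η]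
    (k : RightCosets A) : Function.Injective (grApp η (unit k)).lin := by
  suffices key : ∀ l v, (F.grObj (unit k)).IsHomog l v → (grApp η (unit k)).lin v = 0 → v = 0 by
    rw [injective_iff_map_eq_zero]
    intro v hv
    rw [← (F.grObj (unit k)).sum_proj v]
    refine Finset.sum_eq_zero fun l _ => key l _ (isHomog_proj _ l v) ?_
    rw [GrVect.Hom.comm, hv, map_zero]
  intro l v hv hη
  have hsurj : ∀ g, ∃ t, F.shift (rfl : act k g = act k g) t = v :=
    fun g => (bijective_shift _).2 v
  choose w hwv using hsurj
  have hw : ∀ g, (F.grObj (unit (act k g))).IsHomog (act l g) (w g) := by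
    intro g
    apply (bijective_shift (F := F) (rfl : act k g = act k g)).1
    rw [shift_proj, hwv, hv]
  have hs : ∀ g h, F.shift (act_act k g h) (w (g * h)) = (orbitScalar m k l g h : ℂ) • w g := by
    intro g h
    apply (bijective_shift (F := F) (rfl : act k g = act k g)).1
    have e := shift_shift (F := F) (t := w (g * h)) (rfl : act k g = act k g) (act_act k g h) rfl
      (d := l) (by rw [hwv]; exact hv)
    rw [hwv] at e
    rw [map_smul, hwv, orbitScalar, Units.val_mul, mul_comm, ← smul_smul, ← e, smul_smul,
      ← Units.val_mul, inv_mul_cancel, Units.val_one, one_smul]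
  -- the transformation determined by `v` is killed by `η`, hence zero, and it takes the value
  -- `w 1` on the generator of the summand with index `1`
  have hzero : fromOrbit w hw hs ≫ η = 0 := by
    refine grHom_ext fun M => orbit_hom_ext _ _ M fun g u hu => ?_
    show (grApp η M).lin ((fromOrbitApp w hw M).lin (orbitι (act k) M g u)) = 0
    rw [fromOrbitApp_orbitι w hw M g hu, ← comp_lin, grApp_naturality, comp_lin]
    have : (grApp η (unit (act k g))).lin (w g) = 0 := by
      apply (bijective_shift (F := F') (rfl : act k g = act k g)).1
      rw [shift_grApp, hwv, hη, map_zero]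
    rw [this, map_zero]
  have h0 : fromOrbit w hw hs = 0 := Limits.zero_of_comp_mono η hzero
  have h1 : (fromOrbitApp w hw (unit (act k 1))).lin
      (orbitι (act k) (unit (act k 1)) 1 (1 : ℂ)) = 0 :=
    congrArg (fun θ : orbitObj m k l ⟶ F => (grApp θ (unit (act k 1))).lin
      (show ((orbitObj m k l).grObj (unit (act k 1))).carrier from
        orbitι (act k) (unit (act k 1)) 1 (1 : ℂ))) h0
  rw [fromOrbitApp_orbitι w hw _ _ (isHomog_unit _ _), pt_one, grMap_id, id_lin] at h1
  rw [← hwv 1, h1, map_zero]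

/-- A decomposition of `M` into one-dimensional spaces gives a decomposition of `F M`. -/
theorem exists_sum_grMap (M : GrVect (RightCosets A)) :
    ∃ (J : Type u) (_ : Fintype J) (x : J → RightCosets A) (p : ∀ j, M ⟶ unit (x j))
      (i : ∀ j, unit (x j) ⟶ M), ∀ (F : DualCat (VectG ω) (ModCat m)) (v : (F.grObj M).carrier),
        ∑ j, (F.grMap (i j)).lin ((F.grMap (p j)).lin v) = v := by
  obtain ⟨J, hJ, x, p, i, h⟩ := exists_sum_pt M
  refine ⟨J, hJ, x, p, i, fun F v => ?_⟩
  let Φ : (M ⟶ M) →+ (F.grObj M).carrier :=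
    { toFun := fun f => (F.grMap f).lin v
      map_zero' := by
        have := F.grMap_add (0 : M ⟶ M) 0
        rw [add_zero, left_eq_add] at this
        rw [this]; rfl
      map_add' := fun f f' => by rw [grMap_add]; rfl }
  have h₁ : Φ (∑ j, p j ≫ i j) = v := by
    rw [h]
    show (F.grMap (𝟙 M)).lin v = v
    rw [grMap_id, id_lin]
  rw [map_sum] at h₁
  refine Eq.trans (Finset.sum_congr rfl fun j _ => ?_) h₁
  show _ = (F.grMap (p j ≫ i j)).lin v
  rw [grMap_comp, comp_lin]

variable {F F' : DualCat (VectG ω) (ModCat m)}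

theorem bijective_grApp (η : F ⟶ F')
    (h : ∀ x, Function.Bijective (grApp η (unit x)).lin) (M : GrVect (RightCosets A)) :
    Function.Bijective (grApp η M).lin := by
  obtain ⟨J, _, x, p, i, hJ⟩ := exists_sum_grMap (m := m) M
  have hnat : ∀ {N N' : GrVect (RightCosets A)} (f : N ⟶ N') (v : (F.grObj N).carrier),
      (grApp η N').lin ((F.grMap f).lin v) = (F'.grMap f).lin ((grApp η N).lin v) := by
    intro N N' f v
    rw [← comp_lin, grApp_naturality, comp_lin]
  constructor
  · rw [injective_iff_map_eq_zero]
    intro v hv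
    rw [← hJ F v]
    refine Finset.sum_eq_zero fun j _ => ?_
    have : (F.grMap (p j)).lin v = 0 := (h (x j)).1 (by rw [hnat, hv, map_zero, map_zero])
    rw [this, map_zero]
  · intro v
    choose u hu using fun j => (h (x j)).2 ((F'.grMap (p j)).lin v)
    refine ⟨∑ j, (F.grMap (i j)).lin (u j), ?_⟩
    rw [map_sum]
    conv_rhs => rw [← hJ F' v]
    exact Finset.sum_congr rfl fun j _ => by rw [hnat, hu]

theorem isIso_of_bijective_grApp (η : F ⟶ F')
    (h : ∀ x, Function.Bijective (grApp η (unit x)).lin) : IsIso η := by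
  have : ∀ M, IsIso (η.nat.app M) :=
    fun M => GrVect.isIso_of_bijective (grApp η M) (bijective_grApp η h M)
  have : IsIso η.nat := NatIso.isIso_of_isIso_app _
  exact (mkIso (asIso η.nat) η.comm).isIso_hom

theorem eq_zero_of_grApp (η : F ⟶ F') (h : ∀ x, (grApp η (unit x)).lin = 0) : η = 0 := by
  refine grHom_ext fun M => GrVect.hom_ext fun v => ?_
  obtain ⟨J, _, x, p, i, hJ⟩ := exists_sum_grMap (m := m) M
  show _ = (0 : (F'.grObj M).carrier)
  rw [← hJ F v, map_sum]
  refine Finset.sum_eq_zero fun j _ => ?_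
  rw [← comp_lin, grApp_naturality, comp_lin, h, LinearMap.zero_apply, map_zero]

/-- The sum of the dimensions of the spaces `F (δ_x)`. -/
def totalDim (F : DualCat (VectG ω) (ModCat m)) : ℕ :=
  ∑ x, Module.finrank ℂ (F.grObj (unit x)).carrier

/-- `F (δ_x)` has a nonzero component of degree `y` only for `(x, y)` in the orbit of `(k, l)`. -/
def IsSupported (F : DualCat (VectG ω) (ModCat m)) (k l : RightCosets A) : Prop :=
  ∀ x y v, (F.grObj (unit x)).proj y v ≠ 0 → ∃ g, x = act k g ∧ y = act l g

theorem isSupported_orbitObj (k l : RightCosets A) : (orbitObj m k l).IsSupported k l := by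
  classical
  intro x y v hv
  by_contra hg
  refine hv (LinearMap.congr_fun (f := orbitProj (act k) (act l) (unit x) y) (g := 0)
    (orbit_lin_ext (act k) (unit x) fun g c hc => ?_) v)
  rw [orbitProj_orbitι _ _ _ y g hc]
  split_ifs with hy
  · have hx : act k g ≠ x := fun hx => hg ⟨g, hx.symm, hy.symm⟩
    rw [orbitι_of_ne (act k) (unit x) (isHomog_unit x c) hx.symm]; rfl
  · rfl

theorem totalDim_orbitObj_pos (k l : RightCosets A) : 0 < (orbitObj m k l).totalDim := by
  refine Finset.sum_pos' (fun _ _ => Nat.zero_le _) ⟨act k 1, Finset.mem_univ _, ?_⟩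
  refine Module.finrank_pos_iff_exists_ne_zero.2
    ⟨orbitι (act k) (unit (act k 1)) 1 (1 : ℂ), fun h => ?_⟩
  have h₁ : orbitπ (act k) (unit (act k 1)) 1 (orbitι (act k) (unit (act k 1)) 1 (1 : ℂ)) =
      orbitπ (act k) (unit (act k 1)) 1 0 := congrArg (orbitπ (act k) (unit (act k 1)) 1) h
  rw [orbitπ_orbitι_self, (isHomog_unit (act k 1) 1 : _ = _), map_zero] at h₁
  exact one_ne_zero h₁

/-- A nonzero module functor of least total dimension among those supported on the orbit of
`(k, l)` is simple, as its nonzero subobjects are supported on the same orbit. -/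
theorem simple_of_minimal (k l : RightCosets A) (hF : 0 < F.totalDim) (hS : F.IsSupported k l)
    (hmin : ∀ F' : DualCat (VectG ω) (ModCat m), 0 < F'.totalDim → F'.IsSupported k l →
      F.totalDim ≤ F'.totalDim) : Simple F where
  mono_isIso_iff_nonzero {Y} f _ := by
    have hinj := injective_grApp_of_mono f
    constructor
    · rintro _ rfl
      have h1 : 𝟙 F = 0 := by rw [← IsIso.inv_hom_id (0 : Y ⟶ F), Limits.comp_zero]
      obtain ⟨x, -, hx⟩ := Finset.exists_ne_zero_of_sum_ne_zero hF.ne'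
      obtain ⟨v, hv⟩ := Module.finrank_pos_iff_exists_ne_zero.1 (Nat.pos_of_ne_zero hx)
      exact hv (congrArg (fun θ => (grApp θ (unit x)).lin v) h1)
    · intro hf
      have hle : ∀ x, Module.finrank ℂ (Y.grObj (unit x)).carrier ≤
          Module.finrank ℂ (F.grObj (unit x)).carrier :=
        fun x => LinearMap.finrank_le_finrank_of_injective (hinj x)
      have hY : 0 < Y.totalDim := by
        refine Nat.pos_of_ne_zero fun h => hf (eq_zero_of_grApp f fun x => ?_)
        have hx : Module.finrank ℂ (Y.grObj (unit x)).carrier = 0 :=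
          Finset.sum_eq_zero_iff.1 h x (Finset.mem_univ x)
        have := Module.finrank_zero_iff.1 hx
        exact Subsingleton.elim _ _
      have hYS : Y.IsSupported k l := by
        intro x y v hv
        refine hS x y ((grApp f (unit x)).lin v) fun h => hv (hinj x ?_)
        rw [GrVect.Hom.comm, h, map_zero]
      have heq : ∀ x, Module.finrank ℂ (Y.grObj (unit x)).carrier =
          Module.finrank ℂ (F.grObj (unit x)).carrier := fun x =>
        (Finset.sum_eq_sum_iff_of_le fun x _ => hle x).1
          (le_antisymm (Finset.sum_le_sum fun x _ => hle x) (hmin Y hY hYS)) x (Finset.mem_univ x)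
      exact isIso_of_bijective_grApp f fun x =>
        ⟨hinj x, (LinearMap.injective_iff_surjective_of_finrank_eq_finrank (heq x)).1 (hinj x)⟩

/-- For any two points `k`, `l` there is a simple module functor supported on the orbit of
`(k, l)`. -/
theorem exists_simple (k l : RightCosets A) :
    ∃ F : DualCat (VectG ω) (ModCat m), Simple F ∧ 0 < F.totalDim ∧ F.IsSupported k l := by
  obtain ⟨F, ⟨hF, hS⟩, hmin⟩ := (measure (totalDim (m := m))).wf.has_min
    {F | 0 < F.totalDim ∧ F.IsSupported k l}
    ⟨orbitObj m k l, totalDim_orbitObj_pos k l, isSupported_orbitObj k l⟩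
  exact ⟨F, simple_of_minimal k l hF hS fun F' h h' => not_lt.1 (hmin F' ⟨h, h'⟩), hF, hS⟩

end DualCat

end Simple

/-! ### Invertible module functors -/

section Invertible

open GrVect

variable {G : Type u} [Group G] [Fintype G] {A : Subgroup G} {ω : ZGroup G 3}
  {m : ModuleDatum A ω}

/-- A nonzero graded space all of whose endomorphisms are scalars is one-dimensional. -/
theorem GrVect.exists_generator {X : Type u} [Fintype X] (V : GrVect X)
    (hV : ∃ v : V.carrier, v ≠ 0) (hEnd : ∀ f : V ⟶ V, ∃ c : ℂ, f = c • 𝟙 V) :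
    ∃ (y : X) (b : V.carrier), b ≠ 0 ∧ V.IsHomog y b ∧ ∀ v, ∃ c : ℂ, v = c • b := by
  classical
  obtain ⟨v, hv⟩ := hV
  obtain ⟨y, hy⟩ : ∃ y, V.proj y v ≠ 0 := by
    by_contra! h
    exact hv (by rw [← V.sum_proj v, Finset.sum_eq_zero fun y _ => h y])
  have hscalar : ∀ f : V ⟶ V, ∃ c : ℂ, ∀ w, f.lin w = c • w := by
    intro f
    obtain ⟨c, rfl⟩ := hEnd f
    exact ⟨c, fun w => rfl⟩
  obtain ⟨c, hc⟩ := hscalar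
    ⟨V.proj y, fun x w => by
      by_cases h : y = x
      · rw [h]
      · rw [V.proj_ne y x h, V.proj_ne x y (Ne.symm h)]⟩
  replace hc : ∀ w, V.proj y w = c • w := hc
  -- the scalar `c` by which the idempotent `proj y` acts is nonzero, hence it is `1`
  have hc₁ : c = 1 := by
    have h := V.proj_self y v
    rw [hc] at h
    have h' : (c - 1) • V.proj y v = 0 := by rw [sub_smul, one_smul, h, sub_self]
    exact sub_eq_zero.1 ((smul_eq_zero.1 h').resolve_right hy)
  have hhom : ∀ w, V.IsHomog y w := fun w => by rw [IsHomog, hc, hc₁, one_smul]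
  refine ⟨y, v, hv, hhom v, fun w => ?_⟩
  -- the rank one map with `v ↦ w` is a scalar
  obtain ⟨f, hf⟩ := Module.Projective.exists_dual_ne_zero ℂ hv
  obtain ⟨d, hd⟩ := hscalar
    ⟨f.smulRight w, fun x u => by
      rw [(hhom u).proj_eq, (hhom _).proj_eq]
      split_ifs
      · rfl
      · rw [map_zero]⟩
  have h : f v • w = d • v := hd v
  exact ⟨(f v)⁻¹ * d, by rw [← smul_smul, ← h, smul_smul, inv_mul_cancel₀ hf, one_smul]⟩

namespace DualCat

variable {F : DualCat (VectG ω) (ModCat m)}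

/-- An isomorphism of module functors, as an isomorphism of the underlying functors. -/
def functorIso {F F' : DualCat (VectG ω) (ModCat m)} (e : F ≅ F') : F.functor ≅ F'.functor where
  hom := e.hom.nat
  inv := e.inv.nat
  hom_inv_id := congrArg Hom.nat e.hom_inv_id
  inv_hom_id := congrArg Hom.nat e.inv_hom_id

theorem isEquivalence_of_isInvertible (h : IsInvertible F) : F.functor.IsEquivalence := by
  obtain ⟨Q, ⟨e₁⟩, ⟨e₂⟩⟩ := h
  have i₁ : Q.functor ⋙ F.functor ≅ 𝟭 (ModCat m) := functorIso e₁
  have i₂ : F.functor ⋙ Q.functor ≅ 𝟭 (ModCat m) := functorIso e₂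
  exact (CategoryTheory.Equivalence.mk F.functor Q.functor i₂.symm i₁).isEquivalence_functor

theorem exists_generator_of_isInvertible (h : IsInvertible F) (x : RightCosets A) :
    ∃ (y : RightCosets A) (b : (F.grObj (unit x)).carrier), b ≠ 0 ∧
      (F.grObj (unit x)).IsHomog y b ∧ ∀ v, ∃ c : ℂ, v = c • b := by
  have := isEquivalence_of_isInvertible h
  refine GrVect.exists_generator _ ?_ fun f => ?_
  · by_contra! h0
    have h1 : F.grMap (𝟙 (unit x)) = F.grMap 0 :=
      GrVect.hom_ext fun v => (h0 _).trans (h0 _).symm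
    have h2 : 𝟙 (unit x) = 0 := F.functor.map_injective h1
    exact one_ne_zero (α := ℂ) (congrArg (fun f => Hom.lin f (1 : ℂ)) h2)
  · obtain ⟨f', hf'⟩ : ∃ f' : unit x ⟶ unit x, F.grMap f' = f := F.functor.map_surjective f
    refine ⟨f'.lin (1 : ℂ), ?_⟩
    have : f' = (f'.lin (1 : ℂ) : ℂ) • 𝟙 (unit x) :=
      unit_hom_ext (mul_one _).symm
    rw [← hf', ← grMap_id, ← grMap_smul, ← this]

/-- An invertible module functor permutes the one-dimensional spaces `δ_x` equivariantly, and the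
module functor constraint expresses the translate of `μ` as `μ` times a coboundary. -/
theorem exists_equivariant_of_isInvertible (h : IsInvertible F) (hF : 0 < F.totalDim)
    {k l : RightCosets A} (hS : F.IsSupported k l) :
    ∃ (φ : RightCosets A → RightCosets A) (γ : RightCosets A → G → ℂˣ),
      φ k = l ∧ (∀ x (g : G), φ (MulOpposite.op g • x) = MulOpposite.op g • φ x) ∧
      ∀ x g h, γ x (g * h) * m.μ (φ x) ![g, h] =
        m.μ x ![g, h] * γ (MulOpposite.op g • x) h * γ x g := by
  choose φ b hb0 hb hgen using exists_generator_of_isInvertible h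
  have hγ : ∀ x (g : G), ∃ c : ℂˣ, F.shift (rfl : act x g = act x g) (b (act x g)) =
      (c : ℂ) • b x := by
    intro x g
    obtain ⟨c, hc⟩ := hgen x (F.shift (rfl : act x g = act x g) (b (act x g)))
    have hc0 : c ≠ 0 := by
      rintro rfl
      rw [zero_smul] at hc
      exact hb0 _ ((bijective_shift _).1 (hc.trans (map_zero _).symm))
    exact ⟨Units.mk0 c hc0, hc⟩
  choose γ hγ using hγ
  have hφ : ∀ x g, φ (act x g) = act (φ x) g := by
    intro x g
    by_contra hne
    have e := shift_proj (F := F) (rfl : act x g = act x g) (φ x) (b (act x g))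
    rw [(hb (act x g)).proj_eq, if_neg hne, map_zero, hγ, map_smul, hb x] at e
    exact smul_ne_zero (γ x g).ne_zero (hb0 x) e.symm
  refine ⟨φ, γ, ?_, hφ, fun x g h => ?_⟩
  · obtain ⟨x, -, hx⟩ := Finset.exists_ne_zero_of_sum_ne_zero hF.ne'
    obtain ⟨g, rfl, hg⟩ := hS x (φ x) (b x) (by rw [hb x]; exact hb0 x)
    rw [hφ] at hg
    exact act_left_injective _ _ g hg
  · have key : ∀ z (hz : act (act x g) h = z),
        F.shift hz (b z) = (γ (act x g) h : ℂ) • b (act x g) := by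
      rintro _ rfl
      exact hγ (act x g) h
    have e := shift_shift (F := F) (rfl : act x g = act x g) (act_act x g h) rfl (d := φ x)
      (t := b (act x (g * h))) (by rw [hγ, IsHomog, map_smul, hb x])
    rw [key, map_smul, hγ, hγ, smul_smul, smul_smul, smul_smul] at e
    have e' := smul_left_injective ℂ (hb0 x) e
    refine Units.ext ?_
    rw [Units.val_mul, Units.val_mul, Units.val_mul, mul_comm]
    exact e'.symm

end DualCat

/-- In a pointed dual category every two points of `A \ G` are related by an equivariant map that
preserves `μ` up to a coboundary. -/
theorem exists_equivariant_of_isPointed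
    (hpointed : IsPointed (DualCat (VectG ω) (ModCat m))) (k l : RightCosets A) :
    ∃ (φ : RightCosets A → RightCosets A) (γ : RightCosets A → G → ℂˣ),
      φ k = l ∧ (∀ x (g : G), φ (MulOpposite.op g • x) = MulOpposite.op g • φ x) ∧
      ∀ x g h, γ x (g * h) * m.μ (φ x) ![g, h] =
        m.μ x ![g, h] * γ (MulOpposite.op g • x) h * γ x g := by
  obtain ⟨F, hsimple, hF, hS⟩ := DualCat.exists_simple (m := m) k l
  exact DualCat.exists_equivariant_of_isInvertible (hpointed F hsimple) hF hS

end Invertible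

end PointedDual

end

theorem mainTheorem3 {G : Type u} [Group G] [Fintype G] (A : Subgroup G)
    (ω : PointedDual.ZGroup G 3) (m : PointedDual.ModuleDatum A ω)
    (hpointed : PointedDual.IsPointed
      (PointedDual.DualCat (PointedDual.VectG ω) (PointedDual.ModCat m))) :
    ∃ _ : A.Normal,
      PointedDual.IsCohomologousToLow G (G ⧸ A) ω ∧
      QuotientGroup.mk ω ∈ PointedDual.Omega G (G ⧸ A) ∧
      ∀ η : PointedDual.ZGroup G 3,
        PointedDual.IsCohomologousToLow G (G ⧸ A) η ↔
          QuotientGroup.mk η ∈ PointedDual.Omega G (G ⧸ A) := by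
  have hA : A.Normal := PointedDual.normal_of_equivariant fun l => by
    obtain ⟨φ, -, hφ, hφG, -⟩ :=
      PointedDual.exists_equivariant_of_isPointed hpointed (PointedDual.rightCoset A 1) l
    exact ⟨φ, hφ, hφG⟩
  have hω : PointedDual.IsCohomologousToLow G (G ⧸ A) ω :=
    PointedDual.isCohomologousToLow_of_equivariant m
      (PointedDual.exists_equivariant_of_isPointed hpointed (PointedDual.rightCoset A 1))
  exact ⟨hA, hω, (PointedDual.isCohomologousToLow_iff_mem_Omega ω).1 hω,
    PointedDual.isCohomologousToLow_iff_mem_Omega⟩
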